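/- Notation. Let $\mathbb T=\mathbb R/2\pi\mathbb Z$. For $s>0$ let $E_s$ be the Banach space of $2\pi$-periodic functions that are continuous and bounded on the closed strip $\{|\operatorname{Im} z|\le s\}$ and holomorphic in $\{|\operatorname{Im} z|<s\}$, with the sup norm; $\mathcal H(\Omega,E)$ denotes the holomorphic maps from $\Omega$ to $E$. Let $u^{+}=\max(0,u)$, $u^{-}=\max(0,-u)$. Data. Let $0<s_0<r$, $a>0$, $n\in\mathbb N$, $\alpha\in(0,1]$, and let $\phi\in C_c^\infty(\mathbb R)$ be real with $\int\phi=1$; put $\phi_h(y)=h^{-1}\phi(y/h)$. For $0<\epsilon<1$ let $v_0^\epsilon,w_0^\epsilon$ be $2\pi$-periodic and holomorphic in $\{|\operatorname{Im} z|<r\}$ and let $u^\epsilon(z,t)$ be holomorphic in $\{|\operatorname{Im} z|<r\}\times\{t\in\mathbb C:|t|<a\}$ and $2\pi$-periodic in $z$. Assume, uniformly in $\epsilon$, that $|v_0^\epsilon|,|w_0^\epsilon|\le B$ on $\{|\operatorname{Im} z|\le s_0\}$ and $|u^\epsilon|\le M$ on $\{|\operatorname{Im} z|\le s_0\}\times\{|t|<a\}$.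 Assume that $u^\epsilon$ is real for real $(x,t)$ and has there a fixed sign $\sigma\in\{1,-1\}$ away from $0$: $\sigma u^\epsilon(x,t)\ge\eta>0$ for all $\epsilon$, $x\in\mathbb R$, $t\in(-a,a)$. Finally let $v_0,w_0$ and, for each $t\in[0,a)$, $u(\cdot,t)$ (real valued) be continuous functions on $\mathbb T$ such that, as $\epsilon\to0^+$, $v_0^\epsilon\to v_0$, $w_0^\epsilon\to w_0$ and $u^\epsilon(\cdot,t)\to u(\cdot,t)$ in $L^1(\mathbb T)$. Equations. Consider in $C_b(\mathbb R)$ the linear ODEs $$\tfrac{d}{dt}X^\epsilon(x,t)=\tfrac1\epsilon\big[(X^\epsilon u^{\epsilon+})(x-\epsilon,t)-(X^\epsilon|u^\epsilon|)(x,t)+(X^\epsilon u^{\epsilon-})(x+\epsilon,t)\big],\quad X^\epsilon(x,0)=v_0^\epsilon(x),\tag{A}$$ $$\tfrac{d}{dt}w^\epsilon(x,t)=\tfrac1\epsilon\big[(w^\epsilon u^{\epsilon+})(x-\epsilon,t)-(w^\epsilon|u^\epsilon|)(x,t)+(w^\epsilon u^{\epsilon-})(x+\epsilon,t)\big]-n(v^\epsilon)^{n-1}\tfrac{\partial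 v^\epsilon}{\partial x}(x,t),\quad w^\epsilon(x,0)=w_0^\epsilon(x),\tag{B}$$ with $v^\epsilon(\cdot,t)=X^\epsilon(\cdot,t)*\phi_{\epsilon^\alpha}$. Since $u^\epsilon$ has the sign $\sigma$, the bracket terms are $-\frac{\sigma}{\epsilon}[(Xu^\epsilon)(x,t)-(Xu^\epsilon)(x-\sigma\epsilon,t)]$, $X=X^\epsilon$ or $w^\epsilon$ (for $\sigma=1$, (A) reads $\partial_tX^\epsilon=-\frac1\epsilon[(X^\epsilon u^\epsilon)(x,t)-(X^\epsilon u^\epsilon)(x-\epsilon,t)]$), and in this form (A), (B) make sense for $x=z$ in a complex strip and complex $t$. Theorem. There is $C>0$ depending only on $M$ such that, for all data as above and every $0<s<s_0$, with $\delta=\min(a,C(s_0-s))$: (1) for every $\epsilon\in(0,1)$, (A) and (B) in complex form have unique solutions $X^\epsilon,w^\epsilon\in\mathcal H(\{|t|<\delta\},E_s)$; for $t\in[0,\delta)$ their restrictions to the real axis are the unique solutions of (A), (B) in $C_b(\mathbb R)$; (2) for every $\rho<\delta$, $\|X^\epsilon(t)\|_{E_s}$ and $\|w^\epsilon(t)\|_{E_s}$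 are bounded uniformly in $\epsilon\in(0,1)$ and $|t|\le\rho$; (3) there are $X,w\in\mathcal H(\{|t|<\delta\},E_s)$ (same $\delta$) whose restrictions to $\mathbb R\times[0,\delta)$ are classical solutions of $$\partial_tX=-\partial_x(Xu),\quad X(x,0)=v_0(x),\qquad\qquad \partial_tw=-\partial_x(wu)-\partial_x(X^n),\quad w(x,0)=w_0(x),$$ and are the only $2\pi$-periodic $C^1$ solutions on $\mathbb R\times[0,\delta)$; (4) as $\epsilon\to0^+$, $X^\epsilon\to X$ and $w^\epsilon\to w$ uniformly on the compact subsets of $\{|\operatorname{Im} z|<s\}\times\{|t|<\delta\}$ (in particular on the compact subsets of $\mathbb T\times[0,\delta)$). -/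

import Mathlib

open Set Filter Topology MeasureTheory
open scoped BoundedContinuousFunction

noncomputable section

namespace WeakAsymptotic

/-- The open horizontal strip `|Im z| < s`. -/
def strip (s : ℝ) : Set ℂ := {z | |z.im| < s}

/-- The closed horizontal strip `|Im z| ≤ s`. -/
def closedStrip (s : ℝ) : Set ℂ := {z | |z.im| ≤ s}

/-- A function on the closed strip, read as a function on `ℂ` (with value `0` off the strip). -/
def evalStrip {s : ℝ} (f : closedStrip s →ᵇ ℂ) (z : ℂ) : ℂ :=
  open Classical in if h : z ∈ closedStrip s then f ⟨z, h⟩ else 0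

lemma evalStrip_of_mem {s : ℝ} (f : closedStrip s →ᵇ ℂ) {z : ℂ} (h : z ∈ closedStrip s) :
    evalStrip f z = f ⟨z, h⟩ := by
  simp [evalStrip, h]

lemma strip_subset_closedStrip (s : ℝ) : strip s ⊆ closedStrip s :=
  fun z (hz : |z.im| < s) => (le_of_lt hz : |z.im| ≤ s)

lemma isOpen_strip (s : ℝ) : IsOpen (strip s) :=
  isOpen_lt (by fun_prop) continuous_const

/-- The space `E_s`: bounded continuous `2π`-periodic functions on the closed strip `|Im z| ≤ s`
that are holomorphic in the open strip, with the sup norm. -/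
def StripSpace (s : ℝ) : Submodule ℂ (closedStrip s →ᵇ ℂ) where
  carrier := {f | (∀ z w : closedStrip s, (w : ℂ) = (z : ℂ) + 2 * Real.pi → f w = f z) ∧
    DifferentiableOn ℂ (evalStrip f) (strip s)}
  zero_mem' := by
    refine ⟨fun _ _ _ => rfl, ?_⟩
    refine (differentiableOn_const (0 : ℂ)).congr fun z hz => ?_
    simp [evalStrip_of_mem _ (strip_subset_closedStrip s hz)]
  add_mem' := by
    rintro f g ⟨hf, hf'⟩ ⟨hg, hg'⟩
    refine ⟨fun z w h => by simp [hf z w h, hg z w h], ?_⟩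
    refine (hf'.add hg').congr fun z hz => ?_
    simp [evalStrip_of_mem _ (strip_subset_closedStrip s hz)]
  smul_mem' := by
    rintro c f ⟨hf, hf'⟩
    refine ⟨fun z w h => by simp [hf z w h], ?_⟩
    refine (hf'.const_smul c).congr fun z hz => ?_
    simp [evalStrip_of_mem _ (strip_subset_closedStrip s hz)]

/-- `E_s` is a Banach space. -/
instance (s : ℝ) : CompleteSpace (StripSpace s) := by
  suffices h : IsClosed (StripSpace s : Set (closedStrip s →ᵇ ℂ)) from h.completeSpace_coe
  refine IsSeqClosed.isClosed fun f g hf hfg => ?_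
  have hu := BoundedContinuousFunction.tendsto_iff_tendstoUniformly.1 hfg
  refine ⟨fun z w h => ?_, ?_⟩
  · refine tendsto_nhds_unique (hu.tendsto_at w) ?_
    have := hu.tendsto_at z
    refine this.congr fun k => ((hf k).1 z w h).symm
  · have hloc : TendstoLocallyUniformlyOn (fun k => evalStrip (f k)) (evalStrip g) atTop
        (strip s) := by
      refine TendstoUniformlyOn.tendstoLocallyUniformlyOn ?_
      rw [Metric.tendstoUniformlyOn_iff]
      rw [Metric.tendstoUniformly_iff] at hu
      intro e he
      filter_upwards [hu e he] with k hk z hz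
      have hz' := strip_subset_closedStrip s hz
      rw [evalStrip_of_mem _ hz', evalStrip_of_mem _ hz']
      exact hk ⟨z, hz'⟩
    exact hloc.differentiableOn (Eventually.of_forall fun k => (hf k).2) (isOpen_strip s)

/-- The value `f(z)` of an element of `E_s`, for `|Im z| ≤ s`. -/
def val {s : ℝ} (f : StripSpace s) (z : ℂ) : ℂ := evalStrip (f : closedStrip s →ᵇ ℂ) z

/-- The restriction of an element of `E_s` to the real axis, in `C_b(ℝ)`. -/
def restrictReal {s : ℝ} (hs : 0 < s) (f : StripSpace s) : ℝ →ᵇ ℂ :=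
  (f : closedStrip s →ᵇ ℂ).compContinuous
    ⟨fun x => ⟨(x : ℂ), by simpa [closedStrip] using hs.le⟩, by fun_prop⟩

/-! ### The approximating differential equations -/

/-- The convolution `g * φ_h` on the real line, where `φ_h(y) = φ(y/h)/h`. -/
def mollify (φ : ℝ → ℝ) (h : ℝ) (g : ℝ → ℂ) (x : ℝ) : ℂ :=
  ∫ y : ℝ, g (x - y) * ((h⁻¹ * φ (y / h) : ℝ) : ℂ)

/-- The same convolution (along the real direction) for functions of a complex variable. -/
def mollifyC (φ : ℝ → ℝ) (h : ℝ) (g : ℂ → ℂ) (z : ℂ) : ℂ :=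
  ∫ y : ℝ, g (z - y) * ((h⁻¹ * φ (y / h) : ℝ) : ℂ)

/-- `∂(vⁿ)/∂x = n vⁿ⁻¹ ∂v/∂x` for `v = g * φ_h`, on the real line. -/
def pressureGrad (n : ℕ) (φ : ℝ → ℝ) (h : ℝ) (g : ℝ → ℂ) (x : ℝ) : ℂ :=
  n * mollify φ h g x ^ (n - 1) * deriv (mollify φ h g) x

/-- `∂(vⁿ)/∂z = n vⁿ⁻¹ ∂v/∂z` for `v = g * φ_h`, in the complex domain. -/
def pressureGradC (n : ℕ) (φ : ℝ → ℝ) (h : ℝ) (g : ℂ → ℂ) (z : ℂ) : ℂ :=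
  n * mollifyC φ h g z ^ (n - 1) * deriv (mollifyC φ h g) z

/-- `t ↦ X(t)` is a solution on `[0, T)`, in the Banach space `C_b(ℝ)`, of
`dX/dt (x,t) = ε⁻¹ [(X u⁺)(x-ε,t) - (X |u|)(x,t) + (X u⁻)(x+ε,t)] - f(x,t)`, `X(x,0) = g₀(x)`,
where `u⁺ = max 0 u`, `u⁻ = max 0 (-u)`. -/
structure SolvesUpwindODE (ε T : ℝ) (u : ℝ → ℝ → ℝ) (f : ℝ → ℝ → ℂ) (g₀ : ℝ → ℂ)
    (X : ℝ → ℝ →ᵇ ℂ) : Prop where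
  init : ∀ x, X 0 x = g₀ x
  ode : ∀ t ∈ Ico 0 T, ∃ D : ℝ →ᵇ ℂ, HasDerivWithinAt X D (Ici 0) t ∧
    ∀ x, D x = (1 / (ε : ℂ)) * (X t (x - ε) * ((max 0 (u (x - ε) t) : ℝ) : ℂ)
        - X t x * ((|u x t| : ℝ) : ℂ)
        + X t (x + ε) * ((max 0 (-u (x + ε) t) : ℝ) : ℂ)) - f x t

/-- `X ∈ H({|t| < δ}, E_s)` solves, for a coefficient `u` of constant sign `σ = ±1`,
`dX/dt (z,t) = -(σ/ε) [(X u)(z,t) - (X u)(z - σε,t)] - f(z,t)`, `X(z,0) = g₀(z)`.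
For `σ = 1` the difference quotient is taken to the left, for `σ = -1` to the right. -/
structure SolvesStripODE (σ ε δ : ℝ) {s : ℝ} (u f : ℂ → ℂ → ℂ) (g₀ : ℂ → ℂ)
    (X : ℂ → StripSpace s) : Prop where
  holo : DifferentiableOn ℂ X (Metric.ball 0 δ)
  init : ∀ z ∈ closedStrip s, val (X 0) z = g₀ z
  ode : ∀ t ∈ Metric.ball (0 : ℂ) δ, ∀ z ∈ strip s,
    val (deriv X t) z = -((σ : ℂ) / ε) *
      (val (X t) z * u z t - val (X t) (z - σ * ε) * u (z - σ * ε) t) - f z t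

/-! ### The limiting partial differential equation -/

/-- `Y` is a classical (`C¹`, `2π`-periodic in `x`) solution on `ℝ × [0, δ)` of
`∂Y/∂t = -∂(Y u)/∂x - f`, `Y(x,0) = g₀(x)`. -/
structure IsClassicalSolution (δ : ℝ) (u : ℝ → ℝ → ℝ) (f : ℝ → ℝ → ℂ) (g₀ : ℝ → ℂ)
    (Y : ℝ → ℝ → ℂ) : Prop where
  periodic : ∀ t ∈ Ico 0 δ, Function.Periodic (fun x => Y x t) (2 * Real.pi)
  contDiffOn : ContDiffOn ℝ 1 (Function.uncurry Y) (univ ×ˢ Ico 0 δ)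
  init : ∀ x, Y x 0 = g₀ x
  pde : ∀ x, ∀ t ∈ Ico 0 δ, ∃ d : ℂ, HasDerivAt (fun ξ => Y ξ t * (u ξ t : ℂ)) d x ∧
    HasDerivWithinAt (Y x) (-d - f x t) (Ici 0) t

/-! ### The assumptions -/

/-- An initial datum holomorphic and `2π`-periodic on the strip `|Im z| < r` and bounded by `B` on
`|Im z| ≤ s₀`, uniformly for `0 < ε < 1`. -/
structure AnalyticDatum (r s₀ B : ℝ) (g : ℝ → ℂ → ℂ) : Prop where
  holo : ∀ ε ∈ Ioo (0 : ℝ) 1, DifferentiableOn ℂ (g ε) (strip r)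
  periodic : ∀ ε ∈ Ioo (0 : ℝ) 1, ∀ z ∈ strip r, g ε (z + 2 * Real.pi) = g ε z
  bounded : ∀ ε ∈ Ioo (0 : ℝ) 1, ∀ z ∈ closedStrip s₀, ‖g ε z‖ ≤ B

/-- A coefficient `u^ε(z,t)` holomorphic for `|Im z| < r`, `|t| < a`, `2π`-periodic in `z`, bounded
by `M` for `|Im z| ≤ s₀`, `|t| < a`, uniformly for `0 < ε < 1`, real for real arguments, and there
of constant sign `σ` and at distance at least `η` from `0`. -/
structure AnalyticCoefficient (r s₀ a M σ η : ℝ) (u : ℝ → ℂ → ℂ → ℂ) : Prop where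
  holo : ∀ ε ∈ Ioo (0 : ℝ) 1,
    DifferentiableOn ℂ (Function.uncurry (u ε)) (strip r ×ˢ Metric.ball 0 a)
  periodic : ∀ ε ∈ Ioo (0 : ℝ) 1, ∀ z ∈ strip r, ∀ t ∈ Metric.ball (0 : ℂ) a,
    u ε (z + 2 * Real.pi) t = u ε z t
  bounded : ∀ ε ∈ Ioo (0 : ℝ) 1, ∀ z ∈ closedStrip s₀, ∀ t ∈ Metric.ball (0 : ℂ) a,
    ‖u ε z t‖ ≤ M
  real : ∀ ε ∈ Ioo (0 : ℝ) 1, ∀ x t : ℝ, |t| < a → (u ε x t).im = 0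
  sign : ∀ ε ∈ Ioo (0 : ℝ) 1, ∀ x t : ℝ, |t| < a → η ≤ σ * (u ε x t).re

/-- `g` is continuous and `2π`-periodic and `g^ε → g` in `L¹(𝕋)` as `ε → 0⁺`. -/
structure ConvergesL1Torus (gε : ℝ → ℝ → ℂ) (g : ℝ → ℂ) : Prop where
  continuous : Continuous g
  periodic : Function.Periodic g (2 * Real.pi)
  tendsto : Tendsto (fun ε => ∫ x in (-Real.pi)..Real.pi, ‖gε ε x - g x‖) (𝓝[>] 0) (𝓝 0)

/-- `F^ε → F` uniformly on the compact subsets of `{|Im z| < s} × {|t| < δ}` as `ε → 0⁺`. -/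
def ConvergesOnCompacts (δ : ℝ) {s : ℝ} (Fε : ℝ → ℂ → StripSpace s) (F : ℂ → StripSpace s) :
    Prop :=
  ∀ Q : Set (ℂ × ℂ), IsCompact Q → Q ⊆ strip s ×ˢ Metric.ball 0 δ →
    TendstoUniformlyOn (fun ε p => val (Fε ε p.2) p.1) (fun p => val (F p.2) p.1) (𝓝[>] 0) Q

/-- `F^ε(t)` is bounded in `E_s` uniformly in `0 < ε < 1` and in `t` on smaller discs. -/
def UniformlyBounded (δ : ℝ) {s : ℝ} (Fε : ℝ → ℂ → StripSpace s) : Prop :=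
  ∀ ρ < δ, ∃ B : ℝ, ∀ ε ∈ Ioo (0 : ℝ) 1, ∀ t : ℂ, ‖t‖ ≤ ρ → ‖Fε ε t‖ ≤ B

end WeakAsymptotic

end

noncomputable section

namespace WeakAsymptotic

/-! ### Strips -/

/-! For fixed $\epsilon$ the two equations are linear ODEs in $E_s$ driven by an operator of norm at
most $2M/\epsilon$, since the shift by $\sigma\epsilon$ is real and preserves strips. The Picard
series therefore converges on the whole disc (`exists_linearODE_solution`). What remains is a bound
free of $\epsilon$.

That bound is of Cauchy-Kovalevskaya type. By the mean value inequality on a horizontal line and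
Cauchy's estimate, the difference quotient of $Xu$ costs a width $\rho$ and a factor $1/\rho$, like
a derivative, but no power of $1/\epsilon$ (`norm_differenceQuotient_le`). With
$r=s-|\operatorname{Im}z|$, the weight $r/(r-8M|t|)$ absorbs this loss: inserting the bound
$\Phi\cdot$weight into the equation returns $(B+F\delta+\Phi/2)\cdot$weight, where $F$ bounds the
source (`SolvesStripODE.bound_improve`). Iteration removes the $\epsilon$-dependent starting
constant. The admissible time is proportional to the width given up divided by $M$, whence the form
of $\delta$. The pressure term loses width once more, to Cauchy's estimate and not to the mollifier.

Bounded holomorphic families are locally equi-Lipschitz by Schwarz's lemma. Hence pointwise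
convergence is locally uniform and passes to derivatives and to difference quotients with vanishing
step. Along an ultrafilter finer than $\epsilon\to0^+$ pointwise convergence is free, and the limits
satisfy the limit equations. The $L^1$ hypotheses identify the data and the coefficient on the real
axis for $t\in[0,\delta)$ only. This suffices: there the classical solution is unique by a maximum
principle (`IsClassicalSolution.eq`), and the identity theorem in $t$ and then in $z$ carries the
equality to the complex domain (`eqOn_ball_of_eq_real`). All ultrafilters thus give the same limit,
so the whole family converges. -/

lemma mem_strip {s : ℝ} {z : ℂ} : z ∈ strip s ↔ |z.im| < s := Iff.rfl

lemma mem_closedStrip {s : ℝ} {z : ℂ} : z ∈ closedStrip s ↔ |z.im| ≤ s := Iff.rfl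

lemma closedStrip_subset_strip {s s' : ℝ} (h : s < s') : closedStrip s ⊆ strip s' :=
  fun _ hz => mem_strip.2 ((mem_closedStrip.1 hz).trans_lt h)

lemma closedStrip_mono {s s' : ℝ} (h : s ≤ s') : closedStrip s ⊆ closedStrip s' :=
  fun _ hz => mem_closedStrip.2 ((mem_closedStrip.1 hz).trans h)

lemma strip_mono {s s' : ℝ} (h : s ≤ s') : strip s ⊆ strip s' :=
  fun _ hz => mem_strip.2 ((mem_strip.1 hz).trans_le h)

lemma sub_ofReal_mem_strip {s : ℝ} {z : ℂ} (hz : z ∈ strip s) (y : ℝ) : z - y ∈ strip s := by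
  simpa [mem_strip] using hz

lemma sub_ofReal_mem_closedStrip {s : ℝ} {z : ℂ} (hz : z ∈ closedStrip s) (y : ℝ) :
    z - y ∈ closedStrip s := by
  simpa [mem_closedStrip] using hz

lemma add_two_pi_mem_closedStrip {s : ℝ} {z : ℂ} (hz : z ∈ closedStrip s) :
    z + 2 * Real.pi ∈ closedStrip s := by
  simpa [mem_closedStrip] using hz

lemma ofReal_mem_strip {s : ℝ} (hs : 0 < s) (x : ℝ) : (x : ℂ) ∈ strip s := by
  simpa [mem_strip] using hs

lemma ofReal_mem_closedStrip {s : ℝ} (hs : 0 ≤ s) (x : ℝ) : (x : ℂ) ∈ closedStrip s := by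
  simpa [mem_closedStrip] using hs

lemma abs_im_le_abs_im_add_dist (z w : ℂ) : |w.im| ≤ |z.im| + dist w z := by
  have h1 : |w.im - z.im| ≤ dist w z := by
    rw [dist_eq_norm, ← Complex.sub_im]
    exact Complex.abs_im_le_norm _
  have h2 := abs_add_le (w.im - z.im) z.im
  rw [sub_add_cancel] at h2
  linarith

lemma closedBall_subset_closedStrip {s R : ℝ} {z : ℂ} (h : |z.im| + R ≤ s) :
    Metric.closedBall z R ⊆ closedStrip s := fun w hw => by
  have := abs_im_le_abs_im_add_dist z w
  have hw' := Metric.mem_closedBall.1 hw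
  exact mem_closedStrip.2 (by linarith)

lemma closedBall_subset_strip {s R : ℝ} {z : ℂ} (h : |z.im| + R < s) :
    Metric.closedBall z R ⊆ strip s := fun w hw => by
  have := abs_im_le_abs_im_add_dist z w
  have hw' := Metric.mem_closedBall.1 hw
  exact mem_strip.2 (by linarith)

lemma ball_subset_strip {s R : ℝ} {z : ℂ} (h : |z.im| + R ≤ s) :
    Metric.ball z R ⊆ strip s := fun w hw => by
  have := abs_im_le_abs_im_add_dist z w
  have hw' := Metric.mem_ball.1 hw
  exact mem_strip.2 (by linarith)

lemma closedStrip_subset_closure_strip {s : ℝ} (hs : 0 < s) :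
    closedStrip s ⊆ closure (strip s) := by
  intro z hz
  have hc : Tendsto (fun θ : ℝ => (z.re : ℂ) + θ * z.im * Complex.I) (𝓝[<] 1) (𝓝 z) := by
    have h : Continuous (fun θ : ℝ => (z.re : ℂ) + θ * z.im * Complex.I) := by fun_prop
    have := h.tendsto 1
    simp only [Complex.ofReal_one, one_mul, Complex.re_add_im] at this
    exact this.mono_left nhdsWithin_le_nhds
  refine mem_closure_of_tendsto hc ?_
  filter_upwards [Ioo_mem_nhdsLT (zero_lt_one' ℝ)] with θ hθ
  rw [mem_strip]
  simp only [Complex.add_im, Complex.ofReal_im, zero_add, Complex.mul_im, Complex.mul_re,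
    Complex.ofReal_re, mul_zero, zero_mul, sub_zero, Complex.I_im, Complex.I_re, mul_one, add_zero]
  rw [abs_mul, abs_of_pos hθ.1]
  have h1 := mem_closedStrip.1 hz
  rcases (abs_nonneg z.im).eq_or_lt with h | h
  · rw [← h]; simpa using hs
  · nlinarith [hθ.2]

/-! ### Elements of `E_s` as functions -/

/-- `g` is the restriction of an element of `E_s` of norm at most `K`. -/
structure IsStripFunction (s K : ℝ) (g : ℂ → ℂ) : Prop where
  cont : ContinuousOn g (closedStrip s)
  diff : DifferentiableOn ℂ g (strip s)
  per : ∀ z ∈ closedStrip s, g (z + 2 * Real.pi) = g z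
  bdd : ∀ z ∈ closedStrip s, ‖g z‖ ≤ K

/-- The element of `E_s` given by a function on the strip. -/
def ofFun (s : ℝ) (g : ℂ → ℂ) : StripSpace s :=
  open Classical in
  if h : ∃ K, IsStripFunction s K g then
    ⟨BoundedContinuousFunction.ofNormedAddCommGroup (fun z : closedStrip s => g z)
      (continuousOn_iff_continuous_domRestrict.1 h.choose_spec.cont) h.choose
      (fun z => h.choose_spec.bdd z z.2), by
        refine ⟨fun z w hzw => ?_, ?_⟩
        · have := h.choose_spec.per z z.2
          rw [← hzw] at this
          exact this
        · refine h.choose_spec.diff.congr fun z hz => ?_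
          rw [evalStrip_of_mem _ (strip_subset_closedStrip s hz)]
          rfl⟩
  else 0

variable {s : ℝ}

lemma val_of_mem (f : StripSpace s) {z : ℂ} (hz : z ∈ closedStrip s) :
    val f z = (f : closedStrip s →ᵇ ℂ) ⟨z, hz⟩ := evalStrip_of_mem _ hz

lemma IsStripFunction.val_ofFun {K : ℝ} {g : ℂ → ℂ} (h : IsStripFunction s K g) {z : ℂ}
    (hz : z ∈ closedStrip s) : val (ofFun s g) z = g z := by
  have h' : ∃ K, IsStripFunction s K g := ⟨K, h⟩
  rw [val_of_mem _ hz, ofFun, dif_pos h']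
  rfl

lemma norm_val_le (f : StripSpace s) (z : ℂ) : ‖val f z‖ ≤ ‖f‖ := by
  by_cases hz : z ∈ closedStrip s
  · rw [val_of_mem _ hz]
    exact (f : closedStrip s →ᵇ ℂ).norm_coe_le_norm _
  · rw [val, evalStrip, dif_neg hz, norm_zero]
    exact norm_nonneg f

lemma continuousOn_val (f : StripSpace s) : ContinuousOn (val f) (closedStrip s) := by
  rw [continuousOn_iff_continuous_domRestrict]
  refine (f : closedStrip s →ᵇ ℂ).continuous.congr fun z => ?_
  rw [domRestrict_apply, val_of_mem _ z.2]

lemma differentiableOn_val (f : StripSpace s) : DifferentiableOn ℂ (val f) (strip s) := f.2.2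

lemma val_periodic (f : StripSpace s) {z : ℂ} (hz : z ∈ closedStrip s) :
    val f (z + 2 * Real.pi) = val f z := by
  rw [val_of_mem _ hz, val_of_mem _ (add_two_pi_mem_closedStrip hz)]
  exact f.2.1 _ _ rfl

lemma isStripFunction_val (f : StripSpace s) : IsStripFunction s ‖f‖ (val f) :=
  ⟨continuousOn_val f, differentiableOn_val f, fun _ hz => val_periodic f hz,
    fun z _ => norm_val_le f z⟩

lemma val_ext {f g : StripSpace s} (h : ∀ z ∈ closedStrip s, val f z = val g z) : f = g := by
  apply Subtype.ext
  ext z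
  have := h z z.2
  rwa [val_of_mem _ z.2, val_of_mem _ z.2] at this

lemma val_ext_strip (hs : 0 < s) {f g : StripSpace s} (h : ∀ z ∈ strip s, val f z = val g z) :
    f = g := by
  refine val_ext ?_
  have : EqOn (val f) (val g) (strip s) := h
  exact this.of_subset_closure (continuousOn_val f) (continuousOn_val g)
    (strip_subset_closedStrip s) (closedStrip_subset_closure_strip hs)

lemma norm_le_of_val_le {f : StripSpace s} {K : ℝ} (hK : 0 ≤ K)
    (h : ∀ z ∈ closedStrip s, ‖val f z‖ ≤ K) : ‖f‖ ≤ K := by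
  refine (BoundedContinuousFunction.norm_le hK).2 fun z => ?_
  have := h z z.2
  rwa [val_of_mem _ z.2] at this

/-- The ODE is imposed only on the open strip; continuity up to the edge recovers the full norm of
$E_s$. -/
lemma norm_le_of_val_le_strip (hs : 0 < s) {f : StripSpace s} {K : ℝ}
    (h : ∀ z ∈ strip s, ‖val f z‖ ≤ K) : ‖f‖ ≤ K := by
  have hK : 0 ≤ K := (norm_nonneg _).trans (h 0 (by simpa [mem_strip] using hs))
  refine norm_le_of_val_le hK fun z hz => ?_
  have hzc := closedStrip_subset_closure_strip hs hz
  have hc : ContinuousWithinAt (fun z => ‖val f z‖) (strip s) z :=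
    ((continuousOn_val f z hz).mono (strip_subset_closedStrip s)).norm
  exact hc.closure_le hzc continuousWithinAt_const h

lemma IsStripFunction.norm_ofFun_le {K : ℝ} {g : ℂ → ℂ} (h : IsStripFunction s K g) (hK : 0 ≤ K) :
    ‖ofFun s g‖ ≤ K :=
  norm_le_of_val_le hK fun z hz => by rw [h.val_ofFun hz]; exact h.bdd z hz

lemma val_add (f g : StripSpace s) (z : ℂ) : val (f + g) z = val f z + val g z := by
  by_cases hz : z ∈ closedStrip s
  · simp [val_of_mem _ hz]
  · simp [val, evalStrip, hz]

lemma val_sub (f g : StripSpace s) (z : ℂ) : val (f - g) z = val f z - val g z := by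
  by_cases hz : z ∈ closedStrip s
  · simp [val_of_mem _ hz]
  · simp [val, evalStrip, hz]

lemma val_smul (c : ℂ) (f : StripSpace s) (z : ℂ) : val (c • f) z = c * val f z := by
  by_cases hz : z ∈ closedStrip s
  · simp [val_of_mem _ hz]
  · simp [val, evalStrip, hz]

/-- Evaluation at a point, as a continuous linear functional on `E_s`. -/
def evalL (s : ℝ) (z : ℂ) : StripSpace s →L[ℂ] ℂ :=
  LinearMap.mkContinuous
    { toFun := fun f => val f z
      map_add' := fun f g => val_add f g z
      map_smul' := fun c f => val_smul c f z } 1 fun f => (norm_val_le f z).trans_eq (one_mul _).symm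

/-- The continuous linear map into `E_s` given by a linear, uniformly bounded family of functions
on the strip. -/
def ofFunL {E : Type*} [NormedAddCommGroup E] [NormedSpace ℂ E] (s K : ℝ) (T : E → ℂ → ℂ)
    (hK : 0 ≤ K) (hT : ∀ f, IsStripFunction s (K * ‖f‖) (T f))
    (hadd : ∀ f g, ∀ z ∈ closedStrip s, T (f + g) z = T f z + T g z)
    (hsmul : ∀ (c : ℂ) f, ∀ z ∈ closedStrip s, T (c • f) z = c * T f z) : E →L[ℂ] StripSpace s :=
  LinearMap.mkContinuous
    { toFun := fun f => ofFun s (T f)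
      map_add' := fun f g => val_ext fun z hz => by
        rw [val_add, (hT _).val_ofFun hz, (hT _).val_ofFun hz, (hT _).val_ofFun hz, hadd f g z hz]
      map_smul' := fun c f => val_ext fun z hz => by
        rw [RingHom.id_apply, val_smul, (hT _).val_ofFun hz, (hT _).val_ofFun hz, hsmul c f z hz] }
    K fun f => (hT f).norm_ofFun_le (by positivity)

lemma val_ofFunL {E : Type*} [NormedAddCommGroup E] [NormedSpace ℂ E] {s K : ℝ} {T : E → ℂ → ℂ}
    {hK : 0 ≤ K} {hT : ∀ f, IsStripFunction s (K * ‖f‖) (T f)}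
    {hadd : ∀ f g, ∀ z ∈ closedStrip s, T (f + g) z = T f z + T g z}
    {hsmul : ∀ (c : ℂ) f, ∀ z ∈ closedStrip s, T (c • f) z = c * T f z} (f : E) {z : ℂ}
    (hz : z ∈ closedStrip s) : val (ofFunL s K T hK hT hadd hsmul f) z = T f z :=
  (hT f).val_ofFun hz

lemma norm_ofFunL_le {E : Type*} [NormedAddCommGroup E] [NormedSpace ℂ E] {s K : ℝ}
    {T : E → ℂ → ℂ} {hK : 0 ≤ K} {hT : ∀ f, IsStripFunction s (K * ‖f‖) (T f)}
    {hadd : ∀ f g, ∀ z ∈ closedStrip s, T (f + g) z = T f z + T g z}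
    {hsmul : ∀ (c : ℂ) f, ∀ z ∈ closedStrip s, T (c • f) z = c * T f z} (f : E) :
    ‖ofFunL s K T hK hT hadd hsmul f‖ ≤ K * ‖f‖ :=
  (hT f).norm_ofFun_le (by positivity)

lemma IsStripFunction.mono {K s' : ℝ} {g : ℂ → ℂ} (h : IsStripFunction s' K g) (hs : s ≤ s') :
    IsStripFunction s K g :=
  ⟨h.cont.mono (closedStrip_mono hs), h.diff.mono (strip_mono hs),
    fun z hz => h.per z (closedStrip_mono hs hz), fun z hz => h.bdd z (closedStrip_mono hs hz)⟩

/-- The restriction `E_{s'} → E_s` for `s ≤ s'`. -/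
def restrictL {s s' : ℝ} (h : s ≤ s') : StripSpace s' →L[ℂ] StripSpace s :=
  ofFunL s 1 val zero_le_one (fun f => by rw [one_mul]; exact (isStripFunction_val f).mono h)
    (fun f g z _ => val_add f g z) (fun c f z _ => val_smul c f z)

lemma val_restrictL {s s' : ℝ} (h : s ≤ s') (f : StripSpace s') {z : ℂ} (hz : z ∈ closedStrip s) :
    val (restrictL h f) z = val f z := val_ofFunL f hz

lemma norm_restrictL_le {s s' : ℝ} (h : s ≤ s') (f : StripSpace s') : ‖restrictL h f‖ ≤ ‖f‖ :=
  (norm_ofFunL_le f).trans_eq (one_mul _)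

/-- Cauchy's estimate on the disc of radius `s' - s`, the largest one that surely stays in the wider
closed strip. -/
lemma norm_deriv_le_of_strip {K s' : ℝ} {g : ℂ → ℂ} (h : IsStripFunction s' K g) (hs : s < s')
    {z : ℂ} (hz : z ∈ closedStrip s) : ‖deriv g z‖ ≤ K / (s' - s) := by
  have hz' : |z.im| + (s' - s) ≤ s' := by linarith [mem_closedStrip.1 hz]
  refine Complex.norm_deriv_le_of_forall_mem_sphere_norm_le (sub_pos.2 hs) ⟨?_, ?_⟩ fun w hw => ?_
  · exact h.diff.mono (ball_subset_strip hz')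
  · rw [closure_ball _ (sub_pos.2 hs).ne']
    exact h.cont.mono (closedBall_subset_closedStrip hz')
  · exact h.bdd w (closedBall_subset_closedStrip hz' (Metric.sphere_subset_closedBall hw))

lemma isStripFunction_deriv {K s' : ℝ} {g : ℂ → ℂ} (h : IsStripFunction s' K g) (hs : s < s') :
    IsStripFunction s (K / (s' - s)) (deriv g) := by
  have hd := h.diff.deriv (isOpen_strip s')
  refine ⟨hd.continuousOn.mono (closedStrip_subset_strip hs), hd.mono (strip_mono hs.le), ?_,
    fun z hz => norm_deriv_le_of_strip h hs hz⟩
  intro z hz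
  rw [← deriv_comp_add_const]
  refine EventuallyEq.deriv_eq ?_
  filter_upwards [(isOpen_strip s').mem_nhds (closedStrip_subset_strip hs hz)] with w hw
  exact h.per w (strip_subset_closedStrip _ hw)

lemma differentiableAt_val (f : StripSpace s) {z : ℂ} (hz : z ∈ strip s) :
    DifferentiableAt ℂ (val f) z :=
  (differentiableOn_val f).differentiableAt ((isOpen_strip s).mem_nhds hz)

/-- Complex differentiation `E_{s'} → E_s` for `s < s'`. -/
def derivL {s s' : ℝ} (h : s < s') : StripSpace s' →L[ℂ] StripSpace s :=
  ofFunL s (1 / (s' - s)) (fun f => deriv (val f)) (by have := sub_pos.2 h; positivity)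
    (fun f => by
      rw [one_div_mul_eq_div]
      exact isStripFunction_deriv (isStripFunction_val f) h)
    (fun f g z hz => by
      have hz' := closedStrip_subset_strip h hz
      rw [← deriv_fun_add (differentiableAt_val f hz') (differentiableAt_val g hz')]
      congr 1
      ext w
      exact val_add f g w)
    (fun c f z hz => by
      rw [← deriv_const_mul c (differentiableAt_val f (closedStrip_subset_strip h hz))]
      congr 1
      ext w
      exact val_smul c f w)

lemma val_derivL {s s' : ℝ} (h : s < s') (f : StripSpace s') {z : ℂ} (hz : z ∈ closedStrip s) :
    val (derivL h f) z = deriv (val f) z := val_ofFunL f hz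

lemma norm_derivL_le {s s' : ℝ} (h : s < s') (f : StripSpace s') :
    ‖derivL h f‖ ≤ 1 / (s' - s) * ‖f‖ := norm_ofFunL_le f

/-! ### Bounded families of holomorphic functions -/

/-- Schwarz's lemma: `f` maps the ball into the closed ball of radius `2 * K` about `f c`. General
normed spaces allow its use in $z$, in $t$ and in the pair $(z,t)$. -/
lemma norm_sub_le_of_bounded {E F : Type*} [NormedAddCommGroup E] [NormedSpace ℂ E]
    [NormedAddCommGroup F] [NormedSpace ℂ F] {f : E → F} {c z : E} {R K : ℝ}
    (hd : DifferentiableOn ℂ f (Metric.ball c R)) (hb : ∀ w ∈ Metric.ball c R, ‖f w‖ ≤ K)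
    (hz : z ∈ Metric.ball c R) : ‖f z - f c‖ ≤ 2 * K / R * ‖z - c‖ := by
  have hR : 0 < R := Metric.nonempty_ball.1 ⟨z, hz⟩
  have h := Complex.dist_le_div_mul_dist_of_mapsTo_ball (R₂ := 2 * K) hd (fun w hw => ?_) hz
  · rwa [dist_eq_norm, dist_eq_norm] at h
  · rw [Metric.mem_closedBall, dist_eq_norm]
    have h1 := hb w hw
    have h2 := hb c (Metric.mem_ball_self hR)
    linarith [norm_sub_le (f w) (f c)]

/-- A weak form of Vitali's theorem: the common bound makes the family equi-Lipschitz near each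
point, and the Lipschitz constant passes to the limit. -/
theorem tendstoLocallyUniformlyOn_of_bounded {ι E : Type*} [NormedAddCommGroup E]
    [NormedSpace ℂ E] {l : Filter ι} [l.NeBot] {Ω : Set E} (hΩ : IsOpen Ω) {g : ι → E → ℂ}
    {g₀ : E → ℂ} {K : ℝ} (hd : ∀ᶠ i in l, DifferentiableOn ℂ (g i) Ω)
    (hb : ∀ᶠ i in l, ∀ z ∈ Ω, ‖g i z‖ ≤ K)
    (hp : ∀ z ∈ Ω, Tendsto (fun i => g i z) l (𝓝 (g₀ z))) :
    TendstoLocallyUniformlyOn g g₀ l Ω := by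
  rw [Metric.tendstoLocallyUniformlyOn_iff]
  intro e he p hpΩ
  obtain ⟨R, hR, hRΩ⟩ := Metric.isOpen_iff.1 hΩ p hpΩ
  have hLip : ∀ᶠ i in l, ∀ z ∈ Metric.ball p R, ‖g i z - g i p‖ ≤ 2 * K / R * ‖z - p‖ := by
    filter_upwards [hd, hb] with i hdi hbi z hz
    exact norm_sub_le_of_bounded (hdi.mono hRΩ) (fun w hw => hbi w (hRΩ hw)) hz
  have hLip₀ : ∀ z ∈ Metric.ball p R, ‖g₀ z - g₀ p‖ ≤ 2 * K / R * ‖z - p‖ := by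
    intro z hz
    refine le_of_tendsto ((hp z (hRΩ hz)).sub (hp p hpΩ)).norm ?_
    filter_upwards [hLip] with i hi using hi z hz
  have hsmall : ∀ᶠ z in 𝓝 p, 2 * K / R * ‖z - p‖ < e / 3 := by
    have : Continuous fun z => 2 * K / R * ‖z - p‖ := by fun_prop
    have h := this.tendsto p
    simp only [sub_self, norm_zero, mul_zero] at h
    exact h.eventually (gt_mem_nhds (by positivity))
  have hpt : ∀ᶠ i in l, ‖g₀ p - g i p‖ < e / 3 := by
    have h := (tendsto_const_nhds (x := g₀ p)).sub (hp p hpΩ)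
    simp only [sub_self] at h
    have := h.norm
    rw [norm_zero] at this
    exact this.eventually (gt_mem_nhds (by positivity))
  refine ⟨Metric.ball p R ∩ {z | 2 * K / R * ‖z - p‖ < e / 3},
    mem_nhdsWithin_of_mem_nhds (inter_mem (Metric.ball_mem_nhds p hR) hsmall), ?_⟩
  filter_upwards [hLip, hpt] with i hi hpi z hz
  have h1 := hi z hz.1
  have h2 := hLip₀ z hz.1
  have h3 : 2 * K / R * ‖z - p‖ < e / 3 := hz.2
  rw [dist_eq_norm]
  calc ‖g₀ z - g i z‖ = ‖(g₀ z - g₀ p) + (g₀ p - g i p) - (g i z - g i p)‖ := by congr 1; ring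
    _ ≤ ‖g₀ z - g₀ p‖ + ‖g₀ p - g i p‖ + ‖g i z - g i p‖ :=
        (norm_sub_le _ _).trans (add_le_add_left (norm_add_le _ _) _)
    _ < e := by linarith

theorem tendsto_deriv_of_bounded {ι : Type*} {l : Filter ι} [l.NeBot] {Ω : Set ℂ}
    (hΩ : IsOpen Ω) {g : ι → ℂ → ℂ} {g₀ : ℂ → ℂ} {K : ℝ}
    (hd : ∀ᶠ i in l, DifferentiableOn ℂ (g i) Ω) (hb : ∀ᶠ i in l, ∀ z ∈ Ω, ‖g i z‖ ≤ K)
    (hp : ∀ z ∈ Ω, Tendsto (fun i => g i z) l (𝓝 (g₀ z))) {z : ℂ} (hz : z ∈ Ω) :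
    Tendsto (fun i => deriv (g i) z) l (𝓝 (deriv g₀ z)) :=
  ((tendstoLocallyUniformlyOn_of_bounded hΩ hd hb hp).deriv hd hΩ).tendsto_at hz

/-- The step varies with the index. Since the derivatives converge locally uniformly, `g i w - deriv
g₀ z * w` has derivative at most `2 * e / 3` near `z`, and the mean value inequality applies. -/
theorem tendsto_differenceQuotient_of_bounded {ι : Type*} {l : Filter ι} [l.NeBot] {Ω : Set ℂ}
    (hΩ : IsOpen Ω) {g : ι → ℂ → ℂ} {g₀ : ℂ → ℂ} {K : ℝ}
    (hd : ∀ᶠ i in l, DifferentiableOn ℂ (g i) Ω) (hb : ∀ᶠ i in l, ∀ z ∈ Ω, ‖g i z‖ ≤ K)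
    (hp : ∀ z ∈ Ω, Tendsto (fun i => g i z) l (𝓝 (g₀ z))) {z : ℂ} (hz : z ∈ Ω)
    {h : ι → ℂ} (hh : Tendsto h l (𝓝 0)) (hne : ∀ᶠ i in l, h i ≠ 0) :
    Tendsto (fun i => (h i)⁻¹ * (g i z - g i (z - h i))) l (𝓝 (deriv g₀ z)) := by
  have hloc := tendstoLocallyUniformlyOn_of_bounded hΩ hd hb hp
  have hg₀ := hloc.differentiableOn hd hΩ
  have hderiv := hloc.deriv hd hΩ
  rw [Metric.tendsto_nhds]
  intro e he
  rw [Metric.tendstoLocallyUniformlyOn_iff] at hderiv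
  obtain ⟨V, hV, hVe⟩ := hderiv (e / 3) (by positivity) z hz
  rw [hΩ.nhdsWithin_eq hz] at hV
  have hcont : ∀ᶠ w in 𝓝 z, dist (deriv g₀ w) (deriv g₀ z) < e / 3 :=
    Metric.tendsto_nhds.1 ((hg₀.deriv hΩ).continuousOn.continuousAt (hΩ.mem_nhds hz)) _
      (by positivity)
  obtain ⟨R, hR, hRs⟩ := Metric.mem_nhds_iff.1
    (inter_mem (inter_mem hV (hΩ.mem_nhds hz)) hcont)
  have hhR : ∀ᶠ i in l, ‖h i‖ < R := by
    have := hh.norm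
    rw [norm_zero] at this
    exact this.eventually (gt_mem_nhds hR)
  filter_upwards [hVe, hd, hne, hhR] with i hi hdi hnei hRi
  have hmem : z - h i ∈ Metric.ball z R := by simpa [dist_eq_norm] using hRi
  have hmv := (convex_ball z R).norm_image_sub_le_of_norm_hasDerivWithin_le
    (f := fun w => g i w - deriv g₀ z * w) (f' := fun w => deriv (g i) w - deriv g₀ z)
    (C := 2 * e / 3) (fun w hw => ?_) (fun w hw => ?_) hmem (Metric.mem_ball_self hR)
  · have hpos : 0 < ‖h i‖ := norm_pos_iff.2 hnei
    have heq : (h i)⁻¹ * (g i z - g i (z - h i)) - deriv g₀ z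
        = (h i)⁻¹ * (g i z - deriv g₀ z * z - (g i (z - h i) - deriv g₀ z * (z - h i))) := by
      field_simp
      ring
    rw [dist_eq_norm, heq, norm_mul, norm_inv]
    rw [show z - (z - h i) = h i by ring] at hmv
    calc _ ≤ ‖h i‖⁻¹ * (2 * e / 3 * ‖h i‖) := by gcongr
      _ = 2 * e / 3 := by field_simp
      _ < e := by linarith
  · have hwΩ := (hRs hw).1.2
    have h1 := ((hdi w hwΩ).differentiableAt (hΩ.mem_nhds hwΩ)).hasDerivAt
    have h2 := (hasDerivAt_id w).const_mul (deriv g₀ z)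
    rw [mul_one] at h2
    exact (h1.sub h2).hasDerivWithinAt
  · have h1 := hi w (hRs hw).1.1
    have h2 : dist (deriv g₀ w) (deriv g₀ z) < e / 3 := (hRs hw).2
    rw [dist_comm] at h1
    have h3 := dist_triangle (deriv (g i) w) (deriv g₀ w) (deriv g₀ z)
    rw [← dist_eq_norm]
    have h1' : dist (deriv (g i) w) (deriv g₀ w) < e / 3 := h1
    linarith

/-! ### Holomorphic maps into `E_s` -/

lemma clm_circleIntegral_comm {E : Type*} [NormedAddCommGroup E] [NormedSpace ℂ E]
    [CompleteSpace E] (L : E →L[ℂ] ℂ) {f : ℂ → E} {c : ℂ} {R : ℝ} (hf : CircleIntegrable f c R) :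
    L (∮ z in C(c, R), f z) = ∮ z in C(c, R), L (f z) := by
  rw [circleIntegral, ← ContinuousLinearMap.intervalIntegral_comp_comm L hf.out, circleIntegral]
  simp only [map_smul]

/-- A bounded map into a Banach space that is holomorphic after composition with each functional of
a norming family is holomorphic. -/
theorem differentiableOn_of_norming {E Z : Type*} [NormedAddCommGroup E] [NormedSpace ℂ E]
    [CompleteSpace E] {e : Z → E →L[ℂ] ℂ}
    (he : ∀ (x : E) (K : ℝ), 0 ≤ K → (∀ i, ‖e i x‖ ≤ K) → ‖x‖ ≤ K) {U : Set ℂ} (hU : IsOpen U)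
    {K : ℝ} {G : ℂ → E} (hb : ∀ t ∈ U, ∀ i, ‖e i (G t)‖ ≤ K)
    (hd : ∀ i, DifferentiableOn ℂ (fun t => e i (G t)) U) : DifferentiableOn ℂ G U := by
  -- Schwarz's lemma gives a Lipschitz constant independent of the functional, so the norming family
  -- yields continuity in norm, which the Cauchy integral requires.
  have hcont : ContinuousOn G U := by
    intro t₀ ht₀
    obtain ⟨R, hR, hRT⟩ := Metric.isOpen_iff.1 hU t₀ ht₀
    refine ContinuousAt.continuousWithinAt ?_
    have hlim : Tendsto (fun t => 2 * |K| / R * ‖t - t₀‖) (𝓝 t₀) (𝓝 0) := by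
      have : Continuous fun t => 2 * |K| / R * ‖t - t₀‖ := by fun_prop
      simpa using this.tendsto t₀
    refine tendsto_iff_norm_sub_tendsto_zero.2 ?_
    refine tendsto_of_tendsto_of_tendsto_of_le_of_le' tendsto_const_nhds hlim
      (Eventually.of_forall fun t => norm_nonneg (G t - G t₀)) ?_
    filter_upwards [Metric.ball_mem_nhds t₀ hR] with t ht
    refine he _ _ (by positivity) fun i => ?_
    rw [map_sub]
    exact norm_sub_le_of_bounded ((hd i).mono hRT)
      (fun w hw => (hb w (hRT hw) i).trans (le_abs_self K)) ht
  intro t₀ ht₀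
  obtain ⟨R, hR, hRT⟩ := Metric.nhds_basis_closedBall.mem_iff.1 (hU.mem_nhds ht₀)
  lift R to NNReal using hR.le
  have hR' : 0 < R := by exact_mod_cast hR
  have hint : CircleIntegrable G t₀ R :=
    (hcont.mono (Metric.sphere_subset_closedBall.trans hRT)).circleIntegrable R.coe_nonneg
  -- The Cauchy integral of `G` is analytic; that it equals `G` is tested on the functionals, with
  -- bound `0` in `he`.
  have hF := (hasFPowerSeriesOn_cauchy_integral hint hR').differentiableOn
  rw [Metric.eball_coe] at hF
  refine DifferentiableAt.differentiableWithinAt ?_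
  refine (hF.differentiableAt (Metric.ball_mem_nhds t₀ hR)).congr_of_eventuallyEq ?_
  filter_upwards [Metric.ball_mem_nhds t₀ hR] with w hw
  rw [← sub_eq_zero, ← norm_le_zero_iff]
  refine he _ 0 le_rfl fun i => ?_
  have hcw : ContinuousOn (fun ζ => (ζ - w)⁻¹ • G ζ) (Metric.sphere t₀ R) := by
    refine ContinuousOn.smul (ContinuousOn.inv₀ (continuousOn_id.sub continuousOn_const)
      fun ζ hζ h => ?_) (hcont.mono (Metric.sphere_subset_closedBall.trans hRT))
    rw [show ζ = w from sub_eq_zero.1 h] at hζ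
    exact absurd (Metric.mem_sphere.1 hζ) (Metric.mem_ball.1 hw).ne
  have hdc : DiffContOnCl ℂ (fun t => e i (G t)) (Metric.ball t₀ R) := by
    refine ((hd i).mono ?_).diffContOnCl
    rw [closure_ball _ hR.ne']
    exact hRT
  rw [map_sub, map_smul, clm_circleIntegral_comm (e i) (hcw.circleIntegrable R.coe_nonneg),
    ← hdc.two_pi_i_inv_smul_circleIntegral_sub_inv_smul hw]
  simp only [map_smul, sub_self, norm_zero, le_refl]

theorem differentiableOn_of_val {s T K : ℝ} {G : ℂ → StripSpace s}
    (hb : ∀ t ∈ Metric.ball (0 : ℂ) T, ∀ z ∈ closedStrip s, ‖val (G t) z‖ ≤ K)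
    (hd : ∀ z ∈ closedStrip s, DifferentiableOn ℂ (fun t => val (G t) z) (Metric.ball 0 T)) :
    DifferentiableOn ℂ G (Metric.ball 0 T) :=
  differentiableOn_of_norming (e := fun z : closedStrip s => evalL s z)
    (fun _ _ hK h => norm_le_of_val_le hK fun z hz => h ⟨z, hz⟩) Metric.isOpen_ball
    (fun t ht z => hb t ht z z.2) fun z => hd z z.2

/-! ### Linear differential equations in a Banach space, in the complex domain -/

section LinearODE

variable {E : Type*} [NormedAddCommGroup E] [NormedSpace ℂ E]

lemma mul_mem_ball {T : ℝ} {t : ℂ} (ht : t ∈ Metric.ball 0 T) {τ : ℝ} (hτ : τ ∈ Icc (0 : ℝ) 1) :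
    (τ : ℂ) * t ∈ Metric.ball 0 T := by
  rw [mem_ball_zero_iff] at ht ⊢
  rw [norm_mul, Complex.norm_real, Real.norm_of_nonneg hτ.1]
  nlinarith [norm_nonneg t, hτ.2]

lemma hasDerivAt_ray {g g' : ℂ → E} {T : ℝ} (hg : ∀ t ∈ Metric.ball 0 T, HasDerivAt g (g' t) t)
    {t : ℂ} (ht : t ∈ Metric.ball 0 T) {τ : ℝ} (hτ : τ ∈ Icc (0 : ℝ) 1) :
    HasDerivAt (fun τ : ℝ => g (τ * t)) (t • g' (τ * t)) τ := by
  have h1 : HasDerivAt (fun τ : ℝ => (τ : ℂ) * t) t τ := by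
    simpa using (Complex.ofRealCLM.hasDerivAt (x := τ)).mul_const t
  exact (hg _ (mul_mem_ball ht hτ)).scomp τ h1

/-- Reduces a differential inequality on the disc to the segment from `0` to `t`; the factor `‖t‖`
comes from the chain rule. -/
lemma norm_le_of_hasDerivAt_ray {g g' : ℂ → E} {T : ℝ}
    (hg : ∀ t ∈ Metric.ball 0 T, HasDerivAt g (g' t) t) {t : ℂ} (ht : t ∈ Metric.ball 0 T)
    {b b' : ℝ → ℝ} (h0 : ‖g 0‖ ≤ b 0) (hb : ∀ τ ∈ Icc (0 : ℝ) 1, HasDerivAt b (b' τ) τ)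
    (hbd : ∀ τ ∈ Ico (0 : ℝ) 1, ‖t‖ * ‖g' (τ * t)‖ ≤ b' τ) : ‖g t‖ ≤ b 1 := by
  have h := image_norm_le_of_norm_deriv_right_le_deriv_boundary' (a := 0) (b := 1)
    (f := fun τ : ℝ => g (τ * t)) (f' := fun τ : ℝ => t • g' (τ * t)) (B := b) (B' := b')
    (fun τ hτ => (hasDerivAt_ray hg ht hτ).continuousAt.continuousWithinAt)
    (fun τ hτ => (hasDerivAt_ray hg ht (Ico_subset_Icc_self hτ)).hasDerivWithinAt)
    (by simpa using h0) (fun τ hτ => (hb τ hτ).continuousAt.continuousWithinAt)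
    (fun τ hτ => (hb τ (Ico_subset_Icc_self hτ)).hasDerivWithinAt)
    (fun τ hτ => by rw [norm_smul]; exact hbd τ hτ) (right_mem_Icc.2 zero_le_one)
  simpa using h

lemma eq_zero_of_norm_deriv_le {g g' : ℂ → E} {T K : ℝ}
    (hg : ∀ t ∈ Metric.ball 0 T, HasDerivAt g (g' t) t) (h0 : g 0 = 0)
    (hK : ∀ t ∈ Metric.ball 0 T, ‖g' t‖ ≤ K * ‖g t‖) {t : ℂ} (ht : t ∈ Metric.ball 0 T) :
    g t = 0 := by
  have h := eq_zero_of_abs_deriv_le_mul_abs_self_of_eq_zero_right (a := 0) (b := 1)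
    (K := ‖t‖ * K) (f := fun τ : ℝ => g (τ * t)) (f' := fun τ : ℝ => t • g' (τ * t))
    (fun τ hτ => (hasDerivAt_ray hg ht hτ).continuousAt.continuousWithinAt)
    (fun τ hτ => (hasDerivAt_ray hg ht (Ico_subset_Icc_self hτ)).hasDerivWithinAt)
    (by simpa using h0)
    (fun τ hτ => by
      rw [norm_smul, mul_assoc]
      exact mul_le_mul_of_nonneg_left (hK _ (mul_mem_ball ht (Ico_subset_Icc_self hτ)))
        (norm_nonneg t)) 1 (right_mem_Icc.2 zero_le_one)
  simpa using h

/-- Picard series built from primitives on the disc. `hA` only asks that `A` preserve holomorphic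
curves, which for shift and multiplication operators can be checked pointwise in $z$, instead of
holomorphy in operator norm. -/
theorem exists_linearODE_solution [CompleteSpace E] {A : ℂ → E →L[ℂ] E} {f : ℂ → E} {T K F : ℝ}
    (hT : 0 < T) (hK : 0 ≤ K)
    (hA : ∀ X : ℂ → E, DifferentiableOn ℂ X (Metric.ball 0 T) →
      DifferentiableOn ℂ (fun t => A t (X t)) (Metric.ball 0 T))
    (hAK : ∀ t ∈ Metric.ball 0 T, ∀ x, ‖A t x‖ ≤ K * ‖x‖)
    (hf : DifferentiableOn ℂ f (Metric.ball 0 T)) (hF : ∀ t ∈ Metric.ball 0 T, ‖f t‖ ≤ F)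
    (x₀ : E) : ∃ X : ℂ → E, X 0 = x₀ ∧
      (∀ t ∈ Metric.ball 0 T, HasDerivAt X (A t (X t) + f t) t) ∧
      ∃ B, ∀ t ∈ Metric.ball 0 T, ‖X t‖ ≤ B := by
  obtain ⟨g, hg0, hg⟩ := hf.isExactOn_ball.with_val_at 0 x₀
  have hgd : DifferentiableOn ℂ g (Metric.ball 0 T) :=
    fun t ht => (hg t ht).differentiableAt.differentiableWithinAt
  have hF0 : 0 ≤ F := (norm_nonneg _).trans (hF 0 (Metric.mem_ball_self hT))
  have hgb : ∀ t ∈ Metric.ball (0 : ℂ) T, ‖g t‖ ≤ ‖x₀‖ + F * T := by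
    intro t ht
    have := norm_le_of_hasDerivAt_ray hg ht (b := fun τ => ‖x₀‖ + F * T * τ)
      (b' := fun _ => F * T) (by simp [hg0])
      (fun τ _ => by simpa using ((hasDerivAt_id τ).const_mul (F * T)).const_add ‖x₀‖)
      (fun τ hτ => by
        rw [mul_comm]
        exact mul_le_mul (hF _ (mul_mem_ball ht (Ico_subset_Icc_self hτ)))
          (mem_ball_zero_iff.1 ht).le (norm_nonneg t) hF0)
    simpa using this
  -- `P X` is the primitive $\int_0^t A(\tau)X(\tau)\,d\tau$, which exists because every holomorphic
  -- map on a disc has one.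
  choose P hP0 hP using fun X : {X : ℂ → E // DifferentiableOn ℂ X (Metric.ball 0 T)} =>
    (hA X.1 X.2).isExactOn_ball.with_val_at 0 (0 : E)
  have hPd : ∀ X, DifferentiableOn ℂ (P X) (Metric.ball 0 T) :=
    fun X t ht => (hP X t ht).differentiableAt.differentiableWithinAt
  let D : ℕ → {X : ℂ → E // DifferentiableOn ℂ X (Metric.ball 0 T)} :=
    fun k => Nat.rec ⟨g, hgd⟩ (fun _ X => ⟨P X, hPd X⟩) k
  have hD0 : (D 0).1 = g := rfl
  have hDs : ∀ k, (D (k + 1)).1 = P (D k) := fun k => rfl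
  set G := ‖x₀‖ + F * T with hG
  have hG0 : 0 ≤ G := by positivity
  -- Along the ray the bound for the `k`-th term grows like $\tau^k$, and each integration supplies
  -- the next factor of the factorial.
  have hbound : ∀ k, ∀ t ∈ Metric.ball (0 : ℂ) T,
      ‖(D k).1 t‖ ≤ G * ((K * ‖t‖) ^ k / k.factorial) := by
    intro k
    induction k with
    | zero => intro t ht; simpa [hD0] using hgb t ht
    | succ k ih =>
      intro t ht
      rw [hDs]
      have := norm_le_of_hasDerivAt_ray (hP (D k)) ht
        (b := fun τ => G * ((K * ‖t‖) ^ (k + 1) / (k + 1).factorial) * τ ^ (k + 1))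
        (b' := fun τ => G * ((K * ‖t‖) ^ (k + 1) / (k + 1).factorial) * ((k + 1 : ℕ) * τ ^ k))
        (by simp [hP0])
        (fun τ _ => (hasDerivAt_pow (k + 1) τ).const_mul _)
        (fun τ hτ => by
          have hmem := mul_mem_ball ht (Ico_subset_Icc_self hτ)
          have h1 := (hAK _ hmem ((D k).1 (τ * t))).trans
            (mul_le_mul_of_nonneg_left (ih _ hmem) hK)
          refine (mul_le_mul_of_nonneg_left h1 (norm_nonneg t)).trans_eq ?_
          rw [norm_mul, Complex.norm_real, Real.norm_of_nonneg hτ.1, Nat.factorial_succ]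
          have : (k.factorial : ℝ) ≠ 0 := by positivity
          push_cast
          field_simp
          ring)
      simpa using this
  have hsum : Summable fun k : ℕ => G * ((K * T) ^ k / k.factorial) :=
    (Real.summable_pow_div_factorial (K * T)).mul_left G
  have hle : ∀ (k : ℕ) (t : ℂ), t ∈ Metric.ball (0 : ℂ) T →
      ‖(D k).1 t‖ ≤ G * ((K * T) ^ k / k.factorial) := fun k t ht =>
    (hbound k t ht).trans (by
      have := (mem_ball_zero_iff.1 ht).le
      gcongr)
  have hsumD : ∀ t ∈ Metric.ball (0 : ℂ) T, Summable fun k => (D k).1 t := fun t ht =>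
    Summable.of_norm_bounded hsum fun k => hle k t ht
  refine ⟨fun t => ∑' k, (D k).1 t, ?_, fun t ht => ?_,
    ∑' k : ℕ, G * ((K * T) ^ k / k.factorial), fun t ht => ?_⟩
  · have h0 : ∀ k, k ≠ 0 → (D k).1 0 = 0 := by
      intro k hk
      obtain ⟨j, rfl⟩ := Nat.exists_eq_succ_of_ne_zero hk
      exact hP0 (D j)
    exact (tsum_eq_single 0 h0).trans hg0
  · have hdiff := Complex.differentiableOn_tsum_of_summable_norm hsum (fun k => (D k).2)
      Metric.isOpen_ball hle
    have hder := Complex.hasSum_deriv_of_summable_norm hsum (fun k => (D k).2)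
      Metric.isOpen_ball hle ht
    have hder' : HasSum (fun k => deriv (D k).1 t) (A t (∑' k, (D k).1 t) + f t) := by
      -- The term of index `0` contributes `f t`; the shifted series is `A t` applied to the sum.
      rw [add_comm, ← hasSum_nat_add_iff' 1]
      simp only [Finset.range_one, Finset.sum_singleton]
      rw [hD0, (hg t ht).deriv, add_sub_cancel_left]
      have := (A t).hasSum (hsumD t ht).hasSum
      refine this.congr_fun ?_
      intro k
      rw [hDs, (hP (D k) t ht).deriv]
    have hd := (hdiff.differentiableAt (Metric.isOpen_ball.mem_nhds ht)).hasDerivAt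
    rwa [hder.unique hder'] at hd
  · exact tsum_of_norm_bounded hsum.hasSum fun k => hle k t ht

end LinearODE

/-! ### The approximating equation in `E_s` -/

namespace IsStripFunction

variable {s K L : ℝ} {g k : ℂ → ℂ}

lemma mul (hg : IsStripFunction s K g) (hk : IsStripFunction s L k) (hK : 0 ≤ K) :
    IsStripFunction s (K * L) (fun z => g z * k z) :=
  ⟨hg.cont.mul hk.cont, hg.diff.mul hk.diff, fun z hz => by rw [hg.per z hz, hk.per z hz],
    fun z hz => by
      rw [norm_mul]
      exact mul_le_mul (hg.bdd z hz) (hk.bdd z hz) (norm_nonneg _) hK⟩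

lemma sub (hg : IsStripFunction s K g) (hk : IsStripFunction s L k) :
    IsStripFunction s (K + L) (fun z => g z - k z) :=
  ⟨hg.cont.sub hk.cont, hg.diff.sub hk.diff, fun z hz => by rw [hg.per z hz, hk.per z hz],
    fun z hz => (norm_sub_le _ _).trans (add_le_add (hg.bdd z hz) (hk.bdd z hz))⟩

lemma const_mul (hg : IsStripFunction s K g) (c : ℂ) :
    IsStripFunction s (‖c‖ * K) (fun z => c * g z) :=
  ⟨hg.cont.const_mul c, hg.diff.const_mul c, fun z hz => by rw [hg.per z hz],
    fun z hz => by
      rw [norm_mul]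
      exact mul_le_mul_of_nonneg_left (hg.bdd z hz) (norm_nonneg c)⟩

lemma shift (hg : IsStripFunction s K g) (y : ℝ) : IsStripFunction s K (fun z => g (z - y)) :=
  ⟨hg.cont.comp (by fun_prop) fun z hz => sub_ofReal_mem_closedStrip hz y,
    hg.diff.comp (by fun_prop) fun z hz => sub_ofReal_mem_strip hz y,
    fun z hz => by
      rw [add_sub_right_comm]
      exact hg.per _ (sub_ofReal_mem_closedStrip hz y),
    fun z hz => hg.bdd _ (sub_ofReal_mem_closedStrip hz y)⟩

lemma mono_bound (hg : IsStripFunction s K g) (h : K ≤ L) : IsStripFunction s L g :=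
  ⟨hg.cont, hg.diff, hg.per, fun z hz => (hg.bdd z hz).trans h⟩

lemma pow (hg : IsStripFunction s K g) (n : ℕ) :
    IsStripFunction s (K ^ n) (fun z => g z ^ n) :=
  ⟨hg.cont.pow n, hg.diff.pow n, fun z hz => by rw [hg.per z hz], fun z hz => by
    rw [norm_pow]
    exact pow_le_pow_left₀ (norm_nonneg _) (hg.bdd z hz) n⟩

lemma nonneg (hg : IsStripFunction s K g) (hs : 0 ≤ s) : 0 ≤ K :=
  (norm_nonneg _).trans (hg.bdd 0 (by simpa [mem_closedStrip] using hs))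

end IsStripFunction

/-- A coefficient that is an element of `E_s` of norm at most `M` for each `|t| < T` and is
holomorphic in `t`. -/
structure StripCoefficient (s T M : ℝ) (u : ℂ → ℂ → ℂ) : Prop where
  space : ∀ t ∈ Metric.ball (0 : ℂ) T, IsStripFunction s M (fun z => u z t)
  time : ∀ z ∈ closedStrip s, DifferentiableOn ℂ (fun t => u z t) (Metric.ball 0 T)

lemma StripCoefficient.mono {s s' T T' M : ℝ} {u : ℂ → ℂ → ℂ} (h : StripCoefficient s' T' M u)
    (hs : s ≤ s') (hT : T ≤ T') : StripCoefficient s T M u :=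
  ⟨fun t ht => (h.space t (Metric.ball_subset_ball hT ht)).mono hs,
    fun z hz => (h.time z (closedStrip_mono hs hz)).mono (Metric.ball_subset_ball hT)⟩

lemma norm_sigma_div {σ ε : ℝ} (hσ : |σ| = 1) (hε : 0 < ε) : ‖-((σ : ℂ) / ε)‖ = 1 / ε := by
  rw [norm_neg, norm_div, Complex.norm_real, Complex.norm_real, Real.norm_eq_abs, hσ,
    Real.norm_of_nonneg hε.le]

/-- A crude bound: no width is lost, but the constant blows up like $1/\epsilon$. It serves only for
fixed $\epsilon$. -/
lemma isStripFunction_upwind {s M K σ ε : ℝ} {u g : ℂ → ℂ} (hσ : |σ| = 1) (hε : 0 < ε)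
    (hu : IsStripFunction s M u) (hg : IsStripFunction s K g) (hK : 0 ≤ K) :
    IsStripFunction s (2 * M / ε * K) (fun z => -((σ : ℂ) / ε) *
      (g z * u z - g (z - σ * ε) * u (z - σ * ε))) := by
  have h1 := hg.mul hu hK
  have h2 := (h1.sub (h1.shift (σ * ε))).const_mul (-((σ : ℂ) / ε))
  rw [norm_sigma_div hσ hε] at h2
  push_cast at h2
  convert h2 using 1
  ring

/-- The bound `K` obtained here may depend on $\epsilon$; it only starts the iteration in
`SolvesStripODE.norm_val_le_of_bound`. -/
theorem exists_solvesStripODE {s T M σ ε F B : ℝ} (hs : 0 < s) (hT : 0 < T) (hσ : |σ| = 1)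
    (hε : 0 < ε) {u : ℂ → ℂ → ℂ} (hu : StripCoefficient s T M u) {f : ℂ → StripSpace s}
    (hf : DifferentiableOn ℂ f (Metric.ball 0 T)) (hF : ∀ t ∈ Metric.ball 0 T, ‖f t‖ ≤ F)
    {g₀ : ℂ → ℂ} (hg₀ : IsStripFunction s B g₀) :
    ∃ X : ℂ → StripSpace s, SolvesStripODE σ ε T u (fun z t => val (f t) z) g₀ X ∧
      ∃ K, ∀ t ∈ Metric.ball 0 T, ‖X t‖ ≤ K := by
  have hM : 0 ≤ M := (hu.space 0 (Metric.mem_ball_self hT)).nonneg hs.le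
  have hK : 0 ≤ 2 * M / ε := by positivity
  have hex : ∀ t : ℂ, t ∈ Metric.ball (0 : ℂ) T → ∃ L : StripSpace s →L[ℂ] StripSpace s,
      (∀ g, ∀ z ∈ closedStrip s, val (L g) z = -((σ : ℂ) / ε) *
        (val g z * u z t - val g (z - σ * ε) * u (z - σ * ε) t)) ∧
      ∀ g, ‖L g‖ ≤ 2 * M / ε * ‖g‖ := by
    intro t ht
    have hT : ∀ g : StripSpace s, IsStripFunction s (2 * M / ε * ‖g‖) (fun z =>
        -((σ : ℂ) / ε) * (val g z * u z t - val g (z - σ * ε) * u (z - σ * ε) t)) := fun g =>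
      isStripFunction_upwind hσ hε (hu.space t ht) (isStripFunction_val g) (norm_nonneg g)
    refine ⟨ofFunL s (2 * M / ε) _ hK hT (fun f g z _ => ?_) (fun c g z _ => ?_),
      fun g z hz => val_ofFunL g hz, fun g => norm_ofFunL_le g⟩
    · simp only [val_add]; ring
    · simp only [val_smul]; ring
  choose! A hAval hAnorm using hex
  have hA : ∀ X : ℂ → StripSpace s, DifferentiableOn ℂ X (Metric.ball 0 T) →
      DifferentiableOn ℂ (fun t => A t (X t)) (Metric.ball 0 T) := by
    -- The criterion `differentiableOn_of_norming` needs a bound, which `X` is only known to have on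
    -- compact subdiscs; hence the localization.
    intro X hX t₀ ht₀
    obtain ⟨R, hR, hRT⟩ := Metric.nhds_basis_closedBall.mem_iff.1
      (Metric.isOpen_ball.mem_nhds ht₀)
    obtain ⟨C, hC⟩ := (isCompact_closedBall t₀ R).exists_bound_of_continuousOn
      (hX.continuousOn.mono hRT)
    have hRT' := Metric.ball_subset_closedBall.trans hRT
    have hd : DifferentiableOn ℂ (fun t => A t (X t)) (Metric.ball t₀ R) := by
      refine differentiableOn_of_norming (e := fun z : closedStrip s => evalL s z)
        (K := 2 * M / ε * C)
        (fun _ _ hK h => norm_le_of_val_le hK fun z hz => h ⟨z, hz⟩) Metric.isOpen_ball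
        (fun t ht z => ?_) fun z => ?_
      · refine (norm_val_le _ _).trans ((hAnorm t (hRT' ht) _).trans ?_)
        exact mul_le_mul_of_nonneg_left (hC t (Metric.ball_subset_closedBall ht)) hK
      · have hz2 : (z : ℂ) - σ * ε ∈ closedStrip s := by
          have := sub_ofReal_mem_closedStrip z.2 (σ * ε)
          push_cast at this
          exact this
        have hXz : ∀ w : ℂ, DifferentiableOn ℂ (fun t => val (X t) w) (Metric.ball t₀ R) :=
          fun w => (evalL s w).differentiable.comp_differentiableOn (hX.mono hRT')
        have : DifferentiableOn ℂ (fun t => -((σ : ℂ) / ε) *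
            (val (X t) z * u z t - val (X t) (z - σ * ε) * u (z - σ * ε) t))
            (Metric.ball t₀ R) :=
          (((hXz z).mul ((hu.time z z.2).mono hRT')).sub
            ((hXz _).mul ((hu.time _ hz2).mono hRT'))).const_mul _
        exact this.congr fun t ht => hAval t (hRT' ht) (X t) z z.2
    exact (hd.differentiableAt (Metric.ball_mem_nhds t₀ hR)).differentiableWithinAt
  obtain ⟨X, hX0, hX, K, hXK⟩ := exists_linearODE_solution (f := fun t => -f t) (F := F) hT hK hA
    hAnorm hf.neg (fun t ht => by rw [norm_neg]; exact hF t ht) (ofFun s g₀)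
  refine ⟨X, ⟨fun t ht => (hX t ht).differentiableAt.differentiableWithinAt, fun z hz => ?_,
    fun t ht z hz => ?_⟩, K, hXK⟩
  · rw [hX0, hg₀.val_ofFun hz]
  · rw [(hX t ht).deriv, ← sub_eq_add_neg, val_sub,
      hAval t ht (X t) z (strip_subset_closedStrip s hz)]

/-! ### Uniqueness of strip solutions, their restriction and their bounds. -/

section Solutions

variable {s δ σ ε : ℝ} {u f : ℂ → ℂ → ℂ} {g₀ : ℂ → ℂ} {X Y : ℂ → StripSpace s}

lemma SolvesStripODE.hasDerivAt (h : SolvesStripODE σ ε δ u f g₀ X) {t : ℂ}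
    (ht : t ∈ Metric.ball 0 δ) : HasDerivAt X (deriv X t) t :=
  (h.holo.differentiableAt (Metric.isOpen_ball.mem_nhds ht)).hasDerivAt

lemma SolvesStripODE.hasDerivAt_val (h : SolvesStripODE σ ε δ u f g₀ X) (z : ℂ) {t : ℂ}
    (ht : t ∈ Metric.ball 0 δ) : HasDerivAt (fun t => val (X t) z) (val (deriv X t) z) t :=
  (evalL s z).hasFDerivAt.comp_hasDerivAt t (h.hasDerivAt ht)

/-- The source cancels in the difference, whose derivative is at most `2 * M / ε` times its norm:
Grönwall along rays. -/
theorem SolvesStripODE.eqOn {M : ℝ} (hs : 0 < s) (hσ : |σ| = 1) (hε : 0 < ε)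
    (hu : ∀ z ∈ strip s, ∀ t ∈ Metric.ball (0 : ℂ) δ, ‖u z t‖ ≤ M)
    (hX : SolvesStripODE σ ε δ u f g₀ X) (hY : SolvesStripODE σ ε δ u f g₀ Y) :
    EqOn X Y (Metric.ball 0 δ) := by
  intro t ht
  rw [← sub_eq_zero]
  refine eq_zero_of_norm_deriv_le (g := fun t => X t - Y t) (g' := fun t => deriv X t - deriv Y t)
    (K := 2 * M / ε) (fun t ht => (hX.hasDerivAt ht).sub (hY.hasDerivAt ht)) ?_
    (fun t ht => ?_) ht
  · rw [sub_eq_zero]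
    exact val_ext fun z hz => by rw [hX.init z hz, hY.init z hz]
  · refine norm_le_of_val_le_strip hs fun z hz => ?_
    have hz2 : z - σ * ε ∈ strip s := by
      have := sub_ofReal_mem_strip hz (σ * ε)
      push_cast at this
      exact this
    rw [val_sub, hX.ode t ht z hz, hY.ode t ht z hz]
    have heq : ∀ a b c d p q r w : ℂ, w * (a * p - b * q) - r - (w * (c * p - d * q) - r)
        = w * ((a - c) * p - (b - d) * q) := by intros; ring
    rw [heq, norm_mul, norm_sigma_div hσ hε, ← val_sub, ← val_sub]
    have hM := hu z hz t ht
    have hM2 := hu _ hz2 t ht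
    have hM0 : 0 ≤ M := (norm_nonneg _).trans hM
    have h1 : ‖val (X t - Y t) z * u z t‖ ≤ ‖X t - Y t‖ * M := by
      rw [norm_mul]
      exact mul_le_mul (norm_val_le _ _) hM (norm_nonneg _) (norm_nonneg (X t - Y t))
    have h2 : ‖val (X t - Y t) (z - σ * ε) * u (z - σ * ε) t‖ ≤ ‖X t - Y t‖ * M := by
      rw [norm_mul]
      exact mul_le_mul (norm_val_le _ _) hM2 (norm_nonneg _) (norm_nonneg (X t - Y t))
    calc _ ≤ 1 / ε * (‖X t - Y t‖ * M + ‖X t - Y t‖ * M) := by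
          refine mul_le_mul_of_nonneg_left ?_ (by positivity)
          exact (norm_sub_le _ _).trans (add_le_add h1 h2)
      _ = _ := by ring

theorem SolvesStripODE.restrict {s' δ' : ℝ} (hs : s' ≤ s) (hδ : δ' ≤ δ) {f' : ℂ → ℂ → ℂ}
    (hX : SolvesStripODE σ ε δ u f g₀ X)
    (hf : ∀ t ∈ Metric.ball (0 : ℂ) δ', ∀ z ∈ strip s', f z t = f' z t) :
    SolvesStripODE σ ε δ' u f' g₀ (fun t => restrictL hs (X t)) := by
  have hb : Metric.ball (0 : ℂ) δ' ⊆ Metric.ball 0 δ := Metric.ball_subset_ball hδ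
  refine ⟨(restrictL hs).differentiable.comp_differentiableOn (hX.holo.mono hb), fun z hz => ?_,
    fun t ht z hz => ?_⟩
  · rw [val_restrictL hs _ hz, hX.init z (closedStrip_mono hs hz)]
  · have hz' := strip_subset_closedStrip s' hz
    have hz2 : z - σ * ε ∈ closedStrip s' := by
      have := sub_ofReal_mem_closedStrip hz' (σ * ε)
      push_cast at this
      exact this
    have hd : HasDerivAt (fun t => restrictL hs (X t)) (restrictL hs (deriv X t)) t :=
      (restrictL hs).hasFDerivAt.comp_hasDerivAt t (hX.hasDerivAt (hb ht))
    rw [hd.deriv, val_restrictL hs _ hz', val_restrictL hs _ hz', val_restrictL hs _ hz2,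
      hX.ode t (hb ht) z (strip_mono hs hz), hf t ht z hz]

/-! ### The uniform bound -/

/-- The mean value inequality is used on the horizontal line through `z`, where the distance to the
edge is constant. Only the Cauchy disc of radius `ρ` costs width, so $\epsilon$ disappears. -/
lemma norm_differenceQuotient_le {g : ℂ → ℂ} {z : ℂ} {ρ K : ℝ} (hσ : |σ| = 1) (hε : 0 < ε)
    (hρ : 0 < ρ) (h : |z.im| + ρ < s) (hg : DifferentiableOn ℂ g (strip s))
    (hK : ∀ w : ℂ, |w.im| ≤ |z.im| + ρ → ‖g w‖ ≤ K) :
    ‖-((σ : ℂ) / ε) * (g z - g (z - σ * ε))‖ ≤ K / ρ := by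
  have hconv : Convex ℝ {w : ℂ | w.im = z.im} :=
    convex_hyperplane Complex.imLm.isLinear z.im
  have hmv := hconv.norm_image_sub_le_of_norm_hasDerivWithin_le (f := g) (f' := deriv g)
    (C := K / ρ) (x := z - σ * ε) (y := z) (fun w hw => ?_) (fun w hw => ?_) (by simp) rfl
  · rw [norm_mul, norm_sigma_div hσ hε]
    have hn : ‖z - (z - σ * ε)‖ = ε := by
      rw [sub_sub_cancel, norm_mul, Complex.norm_real, Complex.norm_real, Real.norm_eq_abs, hσ,
        Real.norm_of_nonneg hε.le, one_mul]
    rw [hn] at hmv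
    calc _ ≤ 1 / ε * (K / ρ * ε) := by gcongr
      _ = K / ρ := by field_simp
  · have hws : w ∈ strip s := by
      rw [mem_strip, show w.im = z.im from hw]; linarith
    exact (hg.differentiableAt ((isOpen_strip s).mem_nhds hws)).hasDerivAt.hasDerivWithinAt
  · have hw' : w.im = z.im := hw
    have hcl : Metric.closedBall w ρ ⊆ strip s := closedBall_subset_strip (by rw [hw']; exact h)
    refine Complex.norm_deriv_le_of_forall_mem_sphere_norm_le hρ ?_ fun v hv => ?_
    · refine (hg.mono ?_).diffContOnCl
      rw [closure_ball _ hρ.ne']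
      exact hcl
    · refine hK v ?_
      have := abs_im_le_abs_im_add_dist w v
      rw [Metric.mem_sphere.1 hv, hw'] at this
      exact this

/-- With $r=s-|\operatorname{Im}z|$ and $\theta=8M|t|$, take the Cauchy radius
$\rho=(r-\tau\theta)/2$ at the point $\tau t$. On the widened strip the weight is at most
$(r+\tau\theta)/(r-\tau\theta)$. The bracket, times $|t|$, is then at most
$\frac\Phi2\,r\theta/(r-\tau\theta)^2$, which is the $\tau$-derivative of
$\frac\Phi2\,r/(r-\tau\theta)$. The constant 8 produces the factor one half. -/
lemma SolvesStripODE.bound_improve {M B F Φ : ℝ} (hM : 0 < M) (hσ : |σ| = 1) (hε : 0 < ε)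
    (hu : StripCoefficient s δ M u)
    (hf : ∀ t ∈ Metric.ball (0 : ℂ) δ, ∀ z ∈ strip s, ‖f z t‖ ≤ F)
    (hB : 0 ≤ B) (hF : 0 ≤ F) (hg₀ : ∀ z ∈ closedStrip s, ‖g₀ z‖ ≤ B) (hΦ : 0 ≤ Φ)
    (hX : SolvesStripODE σ ε δ u f g₀ X)
    (hb : ∀ t ∈ Metric.ball (0 : ℂ) δ, ∀ z : ℂ, 8 * M * ‖t‖ < s - |z.im| →
      ‖val (X t) z‖ ≤ Φ * ((s - |z.im|) / (s - |z.im| - 8 * M * ‖t‖)))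
    {t : ℂ} (ht : t ∈ Metric.ball (0 : ℂ) δ) {z : ℂ} (hz : 8 * M * ‖t‖ < s - |z.im|) :
    ‖val (X t) z‖ ≤ (B + F * δ + Φ / 2) * ((s - |z.im|) / (s - |z.im| - 8 * M * ‖t‖)) := by
  set r := s - |z.im| with hr
  set θ := 8 * M * ‖t‖ with hθ
  have hθ0 : 0 ≤ θ := by positivity
  have hr0 : 0 < r := hθ0.trans_lt hz
  have hzs : z ∈ strip s := by rw [mem_strip]; linarith
  have hτθ : ∀ τ ∈ Icc (0 : ℝ) 1, 0 ≤ τ * θ ∧ τ * θ ≤ θ := fun τ hτ =>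
    ⟨mul_nonneg hτ.1 hθ0, mul_le_of_le_one_left hθ0 hτ.2⟩
  have hmain := norm_le_of_hasDerivAt_ray (g := fun t => val (X t) z)
    (g' := fun t => val (deriv X t) z) (fun t ht => hX.hasDerivAt_val z ht) ht
    (b := fun τ => B + F * ‖t‖ * τ + Φ / 2 * r * (r - τ * θ)⁻¹)
    (b' := fun τ => F * ‖t‖ + Φ / 2 * r * (θ / (r - τ * θ) ^ 2)) ?_ ?_ ?_
  · refine hmain.trans ?_
    have hpos : 0 < r - θ := by linarith
    have h1 : 1 ≤ r / (r - θ) := by rw [le_div_iff₀ hpos]; linarith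
    have h2 : F * ‖t‖ ≤ F * δ := mul_le_mul_of_nonneg_left (mem_ball_zero_iff.1 ht).le hF
    have h3 : B + F * δ ≤ (B + F * δ) * (r / (r - θ)) := le_mul_of_one_le_right (by
      have : 0 ≤ F * ‖t‖ := by positivity
      linarith) h1
    simp only [mul_one, one_mul]
    rw [add_mul, mul_assoc (Φ / 2), ← div_eq_mul_inv]
    linarith
  · rw [hX.init z (strip_subset_closedStrip s hzs)]
    have := hg₀ z (strip_subset_closedStrip s hzs)
    have h2 : 0 ≤ Φ / 2 * r * (r - 0 * θ)⁻¹ := by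
      rw [zero_mul, sub_zero]; positivity
    linarith
  · intro τ hτ
    have hpos : 0 < r - τ * θ := by linarith [(hτθ τ hτ).2]
    have h1 : HasDerivAt (fun τ => r - τ * θ) (-θ) τ := by
      simpa using ((hasDerivAt_id τ).mul_const θ).const_sub r
    have h2 := (h1.inv hpos.ne').const_mul (Φ / 2 * r)
    have h3 := ((hasDerivAt_id τ).const_mul (F * ‖t‖)).const_add B
    rw [mul_one] at h3
    rw [neg_neg] at h2
    exact h3.add h2
  · intro τ hτ
    have hτ' := Ico_subset_Icc_self hτ
    have hpos : 0 < r - τ * θ := by linarith [(hτθ τ hτ').2]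
    have hmem := mul_mem_ball ht hτ'
    have hnorm : 8 * M * ‖(τ : ℂ) * t‖ = τ * θ := by
      rw [norm_mul, Complex.norm_real, Real.norm_of_nonneg hτ.1, hθ]; ring
    rw [hX.ode _ hmem z hzs]
    have hdq := norm_differenceQuotient_le (s := s) (σ := σ) (ε := ε)
      (g := fun w => val (X (τ * t)) w * u w (τ * t)) (z := z)
      (ρ := (r - τ * θ) / 2) (K := Φ * ((r + τ * θ) / (r - τ * θ)) * M) hσ hε (by positivity)
      (by linarith [(hτθ τ hτ').1])
      ((differentiableOn_val _).mul (hu.space _ hmem).diff) (fun w hw => ?_)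
    · have hsum := (norm_sub_le (-((σ : ℂ) / ε) * (val (X (τ * t)) z * u z (τ * t) -
        val (X (τ * t)) (z - σ * ε) * u (z - σ * ε) (τ * t))) (f z (τ * t))).trans
        (add_le_add hdq (hf _ hmem z hzs))
      refine (mul_le_mul_of_nonneg_left hsum (norm_nonneg t)).trans ?_
      have hM1 : ‖t‖ * (Φ * ((r + τ * θ) / (r - τ * θ)) * M / ((r - τ * θ) / 2))
          = θ / 4 * Φ * ((r + τ * θ) / (r - τ * θ) ^ 2) := by
        rw [hθ]; field_simp; ring
      rw [mul_add, hM1]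
      have h4 : θ / 4 * Φ * ((r + τ * θ) / (r - τ * θ) ^ 2)
          ≤ θ / 4 * Φ * ((r + r) / (r - τ * θ) ^ 2) := by
        gcongr
        linarith
      have h5 : θ / 4 * Φ * ((r + r) / (r - τ * θ) ^ 2) = Φ / 2 * r * (θ / (r - τ * θ) ^ 2) := by
        ring
      linarith [mul_comm F ‖t‖]
    · have hw' : (r + τ * θ) / 2 ≤ s - |w.im| := by linarith
      have hws : w ∈ closedStrip s := by
        rw [mem_closedStrip]; linarith [(hτθ τ hτ').1]
      have hlt : 8 * M * ‖(τ : ℂ) * t‖ < s - |w.im| := by rw [hnorm]; linarith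
      rw [norm_mul]
      refine mul_le_mul ?_ ((hu.space _ hmem).bdd w hws) (norm_nonneg _) ?_
      · refine (hb _ hmem w hlt).trans (mul_le_mul_of_nonneg_left ?_ hΦ)
        rw [hnorm] at hlt ⊢
        -- $R\mapsto R/(R-\tau\theta)$ is decreasing, so the worst case is the smallest remaining
        -- width $R=(r+\tau\theta)/2$.
        rw [div_le_div_iff₀ (by linarith) hpos]
        nlinarith [mul_le_mul_of_nonneg_left hw' (hτθ τ hτ').1]
      · have := (hτθ τ hτ').1
        positivity

/-- The map $\Phi\mapsto A+\Phi/2$ has fixed point $2A$, and the excess `K` is halved at each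
application. So `K`, the only quantity that may depend on $\epsilon$, vanishes in the limit. Where
$16M|t|\le s-|\operatorname{Im}z|$ the weight is at most 2. -/
theorem SolvesStripODE.norm_val_le_of_bound {M B F K : ℝ} (hM : 0 < M) (hσ : |σ| = 1) (hε : 0 < ε)
    (hu : StripCoefficient s δ M u)
    (hf : ∀ t ∈ Metric.ball (0 : ℂ) δ, ∀ z ∈ strip s, ‖f z t‖ ≤ F)
    (hB : 0 ≤ B) (hF : 0 ≤ F) (hg₀ : ∀ z ∈ closedStrip s, ‖g₀ z‖ ≤ B)
    (hX : SolvesStripODE σ ε δ u f g₀ X) (hK : ∀ t ∈ Metric.ball (0 : ℂ) δ, ‖X t‖ ≤ K)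
    {t : ℂ} (ht : t ∈ Metric.ball (0 : ℂ) δ) {z : ℂ} (hz : 16 * M * ‖t‖ ≤ s - |z.im|)
    (hzs : z ∈ strip s) :
    ‖val (X t) z‖ ≤ 4 * (B + F * δ) := by
  set A := B + F * δ with hA
  have hδ : 0 ≤ δ := (norm_nonneg t).trans (mem_ball_zero_iff.1 ht).le
  have hA0 : 0 ≤ A := by positivity
  have hK0 : 0 ≤ K := (norm_nonneg _).trans (hK t ht)
  have hiter : ∀ k : ℕ, ∀ t ∈ Metric.ball (0 : ℂ) δ, ∀ z : ℂ, 8 * M * ‖t‖ < s - |z.im| →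
      ‖val (X t) z‖ ≤ (2 * A + K * (1 / 2) ^ k) *
        ((s - |z.im|) / (s - |z.im| - 8 * M * ‖t‖)) := by
    intro k
    induction k with
    | zero =>
      intro t ht z hz
      have hθ0 : 0 ≤ 8 * M * ‖t‖ := by positivity
      have h1 : 1 ≤ (s - |z.im|) / (s - |z.im| - 8 * M * ‖t‖) := by
        rw [le_div_iff₀ (by linarith)]; linarith
      refine ((norm_val_le _ _).trans (hK t ht)).trans ?_
      rw [pow_zero, mul_one]
      nlinarith
    | succ k ih =>
      intro t ht z hz
      have := hX.bound_improve hM hσ hε hu hf hB hF hg₀ (by positivity) ih ht hz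
      refine this.trans_eq ?_
      rw [← hA, pow_succ]
      ring
  have hzpos : 0 < s - |z.im| := sub_pos.2 (mem_strip.1 hzs)
  have hθ0 : 0 ≤ M * ‖t‖ := by positivity
  have hlt : 8 * M * ‖t‖ < s - |z.im| := by linarith
  have hlim : ‖val (X t) z‖ ≤ (2 * A + K * 0) * ((s - |z.im|) / (s - |z.im| - 8 * M * ‖t‖)) := by
    refine ge_of_tendsto' (((tendsto_const_nhds.mul (tendsto_pow_atTop_nhds_zero_of_lt_one
      (by norm_num) (by norm_num))).const_add _).mul_const _) fun k => hiter k t ht z hlt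
  have h2 : (s - |z.im|) / (s - |z.im| - 8 * M * ‖t‖) ≤ 2 := by
    rw [div_le_iff₀ (by linarith)]; linarith
  refine hlim.trans ?_
  rw [mul_zero, add_zero]
  nlinarith

/-! ### The equation on the real axis -/

lemma restrictReal_apply (hs : 0 < s) (f : StripSpace s) (x : ℝ) :
    restrictReal hs f x = val f x := (val_of_mem f _).symm

/-- Restriction to the real axis, as a continuous linear map. -/
def restrictRealL (hs : 0 < s) : StripSpace s →L[ℂ] (ℝ →ᵇ ℂ) :=
  LinearMap.mkContinuous
    { toFun := restrictReal hs
      map_add' := fun _ _ => rfl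
      map_smul' := fun _ _ => rfl } 1 fun f => by
    refine (BoundedContinuousFunction.norm_le (mul_nonneg zero_le_one (norm_nonneg f))).2
      fun x => ?_
    rw [one_mul]
    exact (congrArg norm (restrictReal_apply hs f x)).trans_le (norm_val_le f x)

lemma hasDerivAt_comp_ofReal {E : Type*} [NormedAddCommGroup E] [NormedSpace ℂ E] {g : ℂ → E}
    {d : E} {t : ℝ} (h : HasDerivAt g d (t : ℂ)) : HasDerivAt (fun τ : ℝ => g τ) d t := by
  simpa [Function.comp_def] using h.scomp t (Complex.ofRealCLM.hasDerivAt (x := t))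

/-- The fixed sign kills one of the two upwind terms and turns $|u|$ into $\sigma u$. -/
theorem SolvesStripODE.solvesUpwindODE (hs : 0 < s) (hσ : σ = 1 ∨ σ = -1)
    (hX : SolvesStripODE σ ε δ u f g₀ X)
    (hreal : ∀ x t : ℝ, |t| < δ → (u x t).im = 0)
    (hsign : ∀ x t : ℝ, |t| < δ → 0 ≤ σ * (u x t).re) {f' : ℝ → ℝ → ℂ}
    (hf : ∀ x : ℝ, ∀ t ∈ Ico 0 δ, f x (t : ℝ) = f' x t) :
    SolvesUpwindODE ε δ (fun x t => (u x t).re) f' (fun x => g₀ x)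
      (fun t => restrictReal hs (X t)) := by
  refine ⟨fun x => ?_, fun t ht => ?_⟩
  · rw [restrictReal_apply, Complex.ofReal_zero, hX.init _ (ofReal_mem_closedStrip hs.le x)]
  have htδ : |t| < δ := by rw [abs_of_nonneg ht.1]; exact ht.2
  have htb : (t : ℂ) ∈ Metric.ball 0 δ := by simpa using htδ
  refine ⟨restrictReal hs (deriv X t), ?_, fun x => ?_⟩
  · have h1 : HasDerivAt (fun t => restrictRealL hs (X t)) (restrictRealL hs (deriv X t)) (t : ℂ) :=
      (restrictRealL hs).hasFDerivAt.comp_hasDerivAt (t : ℂ) (hX.hasDerivAt htb)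
    exact (hasDerivAt_comp_ofReal h1).hasDerivWithinAt
  · have hure : ∀ y : ℝ, u y t = ((u y t).re : ℂ) := fun y =>
      Complex.ext (by simp) (by simp [hreal y t htδ])
    rw [restrictReal_apply, hX.ode t htb x (ofReal_mem_strip hs x), ← hf x t ht]
    simp only [restrictReal_apply]
    rcases hσ with rfl | rfl
    · have hpos : ∀ y : ℝ, 0 ≤ (u y t).re := fun y => by simpa using hsign y t htδ
      rw [max_eq_right (hpos _), abs_of_nonneg (hpos _), max_eq_left (neg_nonpos.2 (hpos _)),
        ← hure, ← hure]
      push_cast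
      simp only [one_mul]
      ring
    · have hneg : ∀ y : ℝ, (u y t).re ≤ 0 := fun y => by simpa using hsign y t htδ
      rw [max_eq_left (hneg _), abs_of_nonpos (hneg _), max_eq_right (neg_nonneg.2 (hneg _))]
      simp only [Complex.ofReal_neg, ← hure]
      push_cast
      simp only [neg_mul, one_mul, sub_neg_eq_add]
      ring

/-- Grönwall in $C_b(\mathbb R)$. No sign of `v` enters: each of the three terms is bounded
separately, whence `3 * M / ε`. -/
theorem SolvesUpwindODE.eq {M : ℝ} {v : ℝ → ℝ → ℝ} {k : ℝ → ℝ → ℂ} {k₀ : ℝ → ℂ}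
    {Y Z : ℝ → ℝ →ᵇ ℂ} (hε : 0 < ε) (hv : ∀ x, ∀ t ∈ Ico 0 δ, |v x t| ≤ M)
    (hY : SolvesUpwindODE ε δ v k k₀ Y) (hZ : SolvesUpwindODE ε δ v k k₀ Z) {t : ℝ}
    (ht : t ∈ Ico 0 δ) : Y t = Z t := by
  have hY' : ∀ t ∈ Ico 0 δ, _ := hY.ode
  have hZ' : ∀ t ∈ Ico 0 δ, _ := hZ.ode
  choose! DY hDY hDYeq using hY'
  choose! DZ hDZ hDZeq using hZ'
  have hsub : Icc 0 t ⊆ Ico 0 δ := fun τ hτ => ⟨hτ.1, hτ.2.trans_lt ht.2⟩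
  have hder : ∀ τ ∈ Ico 0 δ,
      HasDerivWithinAt (fun τ => Y τ - Z τ) (DY τ - DZ τ) (Ici 0) τ := fun τ hτ =>
    (hDY τ hτ).sub (hDZ τ hτ)
  have h := eq_zero_of_abs_deriv_le_mul_abs_self_of_eq_zero_right (a := 0) (b := t)
    (f := fun τ => Y τ - Z τ) (f' := fun τ => DY τ - DZ τ) (K := 3 * M / ε)
    (fun τ hτ => ((hder τ (hsub hτ)).continuousWithinAt).mono Icc_subset_Ici_self)
    (fun τ hτ => (hder τ (hsub (Ico_subset_Icc_self hτ))).mono (Ici_subset_Ici.2 hτ.1))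
    (by rw [sub_eq_zero]; ext x; rw [hY.init, hZ.init])
    (fun τ hτ => ?_) t (right_mem_Icc.2 ht.1)
  · exact sub_eq_zero.1 h
  have hτ' := hsub (Ico_subset_Icc_self hτ)
  have hM0 : 0 ≤ M := (abs_nonneg _).trans (hv 0 τ hτ')
  refine (BoundedContinuousFunction.norm_le (by positivity)).2 fun x => ?_
  have hD : ∀ y, ‖Y τ y - Z τ y‖ ≤ ‖Y τ - Z τ‖ := fun y => (Y τ - Z τ).norm_coe_le_norm y
  have hbd : ∀ (y : ℝ) (c : ℝ), |c| ≤ M → ‖(Y τ y - Z τ y) * (c : ℂ)‖ ≤ ‖Y τ - Z τ‖ * M := by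
    intro y c hc
    rw [norm_mul, Complex.norm_real, Real.norm_eq_abs]
    exact mul_le_mul (hD y) hc (abs_nonneg c) (norm_nonneg _)
  have hmax : ∀ c : ℝ, |c| ≤ M → |max 0 c| ≤ M := fun c hc => by
    rw [abs_of_nonneg (le_max_left _ _)]
    exact max_le hM0 ((le_abs_self c).trans hc)
  have h1 := hbd (x - ε) (max 0 (v (x - ε) τ)) (hmax _ (hv _ τ hτ'))
  have h2 := hbd x |v x τ| (by rw [abs_abs]; exact hv _ τ hτ')
  have h3 := hbd (x + ε) (max 0 (-v (x + ε) τ)) (hmax _ (by rw [abs_neg]; exact hv _ τ hτ'))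
  rw [BoundedContinuousFunction.sub_apply, hDYeq τ hτ', hDZeq τ hτ']
  have heq : ∀ a b c a' b' c' p q r w k : ℂ, w * (a * p - b * q + c * r) - k
      - (w * (a' * p - b' * q + c' * r) - k)
      = w * ((a - a') * p - (b - b') * q + (c - c') * r) := by intros; ring
  have hw : ‖(1 / (ε : ℂ))‖ = 1 / ε := by
    rw [norm_div, norm_one, Complex.norm_real, Real.norm_of_nonneg hε.le]
  rw [heq, norm_mul, hw]
  calc _ ≤ 1 / ε * (‖Y τ - Z τ‖ * M + ‖Y τ - Z τ‖ * M + ‖Y τ - Z τ‖ * M) := by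
        refine mul_le_mul_of_nonneg_left ?_ (by positivity)
        exact (norm_add_le _ _).trans (add_le_add ((norm_sub_le _ _).trans (add_le_add h1 h2)) h3)
    _ = _ := by ring

end Solutions

/-! ### Mollification in `E_s` -/

lemma norm_shift_sub_le {s s' K : ℝ} {g : ℂ → ℂ} (hg : IsStripFunction s' K g) (hs : s < s') {z : ℂ}
    (hz : z ∈ closedStrip s) (y : ℝ) : ‖g (z - y) - g z‖ ≤ K / (s' - s) * |y| := by
  have hconv : Convex ℝ {w : ℂ | w.im = z.im} :=
    convex_hyperplane Complex.imLm.isLinear z.im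
  have hmem : ∀ w : ℂ, w.im = z.im → w ∈ closedStrip s := fun w hw => by
    rw [mem_closedStrip, hw]; exact hz
  have hmv := hconv.norm_image_sub_le_of_norm_hasDerivWithin_le (f := g) (f' := deriv g)
    (C := K / (s' - s)) (x := z) (y := z - y)
    (fun w hw => (hg.diff.differentiableAt ((isOpen_strip s').mem_nhds
      (closedStrip_subset_strip hs (hmem w hw)))).hasDerivAt.hasDerivWithinAt)
    (fun w hw => norm_deriv_le_of_strip hg hs (hmem w hw)) rfl
    (show (z - (y : ℂ)).im = z.im by simp)
  simpa using hmv

/-- Rescaling moves `h` from the kernel to the argument, so all dominations come from the fixed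
function `φ` and are uniform in `h`. -/
lemma mollifyC_eq {φ : ℝ → ℝ} {h : ℝ} (hh : 0 < h) (g : ℂ → ℂ) (z : ℂ) :
    mollifyC φ h g z = ∫ y : ℝ, g (z - (h * y : ℝ)) * (φ y : ℂ) := by
  have h1 := Measure.integral_comp_div (fun y : ℝ => g (z - (h * y : ℝ)) * (φ y : ℂ)) h
  have h2 : ∀ y : ℝ, h * (y / h) = y := fun y => by field_simp
  simp only [h2] at h1
  have h3 : mollifyC φ h g z = (h⁻¹ : ℂ) * ∫ y : ℝ, g (z - (y : ℝ)) * (φ (y / h) : ℂ) := by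
    rw [mollifyC, ← integral_const_mul]
    congr 1
    ext y
    push_cast
    ring
  rw [h3, h1, abs_of_pos hh, Complex.real_smul, ← mul_assoc, inv_mul_cancel₀, one_mul]
  exact_mod_cast hh.ne'

section Mollify

variable {φ : ℝ → ℝ} {h s K : ℝ} {g : ℂ → ℂ}

lemma continuous_shift_mul (hφ : Continuous φ) (hg : ContinuousOn g (closedStrip s)) {z : ℂ}
    (hz : z ∈ closedStrip s) : Continuous fun y : ℝ => g (z - (h * y : ℝ)) * (φ y : ℂ) := by
  refine Continuous.mul ?_ (by fun_prop)
  exact hg.comp_continuous (by fun_prop) fun y => sub_ofReal_mem_closedStrip hz _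

lemma norm_shift_mul_le (hg : IsStripFunction s K g) {z : ℂ} (hz : z ∈ closedStrip s) (y : ℝ) :
    ‖g (z - (h * y : ℝ)) * (φ y : ℂ)‖ ≤ K * ‖φ y‖ := by
  rw [norm_mul, Complex.norm_real]
  exact mul_le_mul_of_nonneg_right (hg.bdd _ (sub_ofReal_mem_closedStrip hz _)) (norm_nonneg _)

lemma integrable_shift_mul (hφ : Continuous φ) (hφi : Integrable φ) (hg : IsStripFunction s K g)
    {z : ℂ} (hz : z ∈ closedStrip s) :
    Integrable fun y : ℝ => g (z - (h * y : ℝ)) * (φ y : ℂ) :=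
  (hφi.norm.const_mul K).mono' (continuous_shift_mul hφ hg.cont hz).aestronglyMeasurable
    (Eventually.of_forall fun y => norm_shift_mul_le hg hz y)

lemma isStripFunction_mollifyC (hφ : Continuous φ) (hφi : Integrable φ) (hh : 0 < h)
    (hg : IsStripFunction s K g) : IsStripFunction s (K * ∫ y, ‖φ y‖) (mollifyC φ h g) := by
  rw [show mollifyC φ h g = fun z => ∫ y : ℝ, g (z - (h * y : ℝ)) * (φ y : ℂ) from
    funext fun z => mollifyC_eq hh g z]
  refine ⟨?_, ?_, fun z hz => ?_, fun z hz => ?_⟩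
  · refine continuousOn_of_dominated (bound := fun y => K * ‖φ y‖)
      (fun z hz => (continuous_shift_mul hφ hg.cont hz).aestronglyMeasurable)
      (fun z hz => Eventually.of_forall fun y => norm_shift_mul_le hg hz y) (hφi.norm.const_mul K)
      (Eventually.of_forall fun y => ?_)
    exact (hg.shift (h * y)).cont.mul continuousOn_const
  · intro z₀ hz₀
    have hz₀' := mem_strip.1 hz₀
    -- Half of the distance to the edge: the other half remains for Cauchy's estimate, which
    -- dominates the differentiated integrand.
    set R := (s - |z₀.im|) / 2 with hR
    have hRpos : 0 < R := by rw [hR]; linarith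
    have hRs : |z₀.im| + R < s := by linarith
    have hmem : ∀ z ∈ Metric.ball z₀ R, z ∈ closedStrip (|z₀.im| + R) := fun z hz =>
      closedBall_subset_closedStrip le_rfl (Metric.ball_subset_closedBall hz)
    have hmem' : ∀ z ∈ Metric.ball z₀ R, z ∈ strip s := fun z hz =>
      closedStrip_subset_strip hRs (hmem z hz)
    have hder := hasDerivAt_integral_of_dominated_loc_of_deriv_le
      (F := fun (z : ℂ) (y : ℝ) => g (z - (h * y : ℝ)) * (φ y : ℂ))
      (F' := fun (z : ℂ) (y : ℝ) => deriv g (z - (h * y : ℝ)) * (φ y : ℂ)) (x₀ := z₀)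
      (μ := volume) (bound := fun y => K / (s - (|z₀.im| + R)) * ‖φ y‖)
      (Metric.ball_mem_nhds z₀ hRpos) ?_ ?_ ?_ ?_ ?_ ?_
    · exact hder.2.differentiableAt.differentiableWithinAt
    · filter_upwards [Metric.ball_mem_nhds z₀ hRpos] with z hz
      exact (continuous_shift_mul hφ hg.cont
        (strip_subset_closedStrip s (hmem' z hz))).aestronglyMeasurable
    · exact integrable_shift_mul hφ hφi hg (strip_subset_closedStrip s hz₀)
    · exact (continuous_shift_mul hφ (isStripFunction_deriv hg hRs).cont
        (hmem z₀ (Metric.mem_ball_self hRpos))).aestronglyMeasurable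
    · exact Eventually.of_forall fun y z hz =>
        norm_shift_mul_le (isStripFunction_deriv hg hRs) (hmem z hz) y
    · exact hφi.norm.const_mul _
    · refine Eventually.of_forall fun y z hz => ?_
      have h1 := (hg.diff.differentiableAt ((isOpen_strip s).mem_nhds
        (sub_ofReal_mem_strip (hmem' z hz) (h * y)))).hasDerivAt
      exact (h1.comp_sub_const z ((h * y : ℝ) : ℂ)).mul_const _
  · congr 1
    ext y
    rw [(hg.shift (h * y)).per z hz]
  · refine (norm_integral_le_integral_norm _).trans ?_
    rw [← integral_const_mul]
    exact integral_mono (integrable_shift_mul hφ hφi hg hz).norm (hφi.norm.const_mul K)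
      fun y => norm_shift_mul_le hg hz y

/-- Mollification as a continuous linear map of `E_s`. -/
def mollifyL (s : ℝ) (hφ : Continuous φ) (hφi : Integrable φ) (hh : 0 < h) :
    StripSpace s →L[ℂ] StripSpace s :=
  ofFunL s (∫ y, ‖φ y‖) (fun f => mollifyC φ h (val f))
    (integral_nonneg fun _ => norm_nonneg _)
    (fun f => by
      rw [mul_comm]
      exact isStripFunction_mollifyC hφ hφi hh (isStripFunction_val f))
    (fun f g z hz => by
      rw [mollifyC_eq hh, mollifyC_eq hh, mollifyC_eq hh,
        ← integral_add (integrable_shift_mul hφ hφi (isStripFunction_val f) hz)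
          (integrable_shift_mul hφ hφi (isStripFunction_val g) hz)]
      simp only [val_add, add_mul])
    (fun c f z _ => by
      rw [mollifyC_eq hh, mollifyC_eq hh, ← integral_const_mul]
      simp only [val_smul, mul_assoc])

lemma val_mollifyL (hφ : Continuous φ) (hφi : Integrable φ) (hh : 0 < h) (f : StripSpace s) {z : ℂ}
    (hz : z ∈ closedStrip s) : val (mollifyL s hφ hφi hh f) z = mollifyC φ h (val f) z :=
  val_ofFunL f hz

lemma norm_mollifyL_le (hφ : Continuous φ) (hφi : Integrable φ) (hh : 0 < h) (f : StripSpace s) :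
    ‖mollifyL s hφ hφi hh f‖ ≤ (∫ y, ‖φ y‖) * ‖f‖ := norm_ofFunL_le f

/-- As `φ` has integral 1, the error averages `g (z - h * y) - g z`, which Cauchy's estimate makes
$O(h|y|)$. Compact support makes the first moment finite. -/
lemma norm_mollifyC_sub_le {s' : ℝ} (hφ : Continuous φ) (hφc : HasCompactSupport φ)
    (hφ1 : ∫ y, φ y = 1) (hh : 0 < h) (hg : IsStripFunction s' K g) (hs : s < s') {z : ℂ}
    (hz : z ∈ closedStrip s) :
    ‖mollifyC φ h g z - g z‖ ≤ K / (s' - s) * h * ∫ y, |y| * ‖φ y‖ := by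
  have hφi : Integrable φ := hφ.integrable_of_hasCompactSupport hφc
  have hz' := closedStrip_mono hs.le hz
  have hint1 := integrable_shift_mul (h := h) hφ hφi hg hz'
  have hint2 : Integrable fun y : ℝ => g z * (φ y : ℂ) := hφi.ofReal.const_mul (g z)
  have hg1 : g z = ∫ y : ℝ, g z * (φ y : ℂ) := by
    rw [integral_const_mul, integral_complex_ofReal, hφ1, Complex.ofReal_one, mul_one]
  have hint3 : Integrable fun y : ℝ => |y| * ‖φ y‖ :=
    (continuous_abs.mul hφ.norm).integrable_of_hasCompactSupport hφc.norm.mul_left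
  rw [mollifyC_eq hh]
  conv_lhs => rw [hg1]
  rw [← integral_sub hint1 hint2, ← integral_const_mul]
  refine (norm_integral_le_integral_norm _).trans
    (integral_mono (hint1.sub hint2).norm (hint3.const_mul _) fun y => ?_)
  have := norm_shift_sub_le hg hs hz (h * y)
  dsimp only
  rw [← sub_mul, norm_mul, Complex.norm_real, ← mul_assoc]
  refine mul_le_mul_of_nonneg_right (this.trans_eq ?_) (norm_nonneg _)
  rw [abs_mul, abs_of_pos hh, mul_assoc]

end Mollify

/-! ### The pressure term -/

section Pressure

variable {φ : ℝ → ℝ} {h s s' : ℝ}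

/-- The pressure term `∂(vⁿ)/∂z`, `v = f * φ_h`, as a map `E_{s'} → E_s` for `s < s'`. -/
def pressure (hs : s < s') (n : ℕ) (hφ : Continuous φ) (hφi : Integrable φ) (hh : 0 < h)
    (f : StripSpace s') : StripSpace s :=
  derivL hs (ofFun s' fun z => val (mollifyL s' hφ hφi hh f) z ^ n)

lemma isStripFunction_val_pow (n : ℕ) (f : StripSpace s) :
    IsStripFunction s (‖f‖ ^ n) fun z => val f z ^ n :=
  (isStripFunction_val f).pow n

lemma val_pressure (hs : s < s') (n : ℕ) (hφ : Continuous φ) (hφi : Integrable φ) (hh : 0 < h)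
    (f : StripSpace s') {z : ℂ} (hz : z ∈ closedStrip s) :
    val (pressure hs n hφ hφi hh f) z = pressureGradC n φ h (val f) z := by
  have hz' := closedStrip_subset_strip hs hz
  rw [pressure, val_derivL hs _ hz]
  have heq : val (ofFun s' fun z => val (mollifyL s' hφ hφi hh f) z ^ n)
      =ᶠ[𝓝 z] fun z => mollifyC φ h (val f) z ^ n := by
    filter_upwards [(isOpen_strip s').mem_nhds hz'] with w hw
    have hw' := strip_subset_closedStrip s' hw
    rw [(isStripFunction_val_pow n _).val_ofFun hw', val_mollifyL hφ hφi hh f hw']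
  have hd : DifferentiableAt ℂ (mollifyC φ h (val f)) z :=
    (isStripFunction_mollifyC hφ hφi hh (isStripFunction_val f)).diff.differentiableAt
      ((isOpen_strip s').mem_nhds hz')
  rw [heq.deriv_eq, pressureGradC, deriv_fun_pow hd]

/-- No negative power of `h` appears: the derivative is paid for by the width `s' - s` and never
falls on the mollifier. -/
lemma norm_pressure_le (hs : s < s') (n : ℕ) (hφ : Continuous φ) (hφi : Integrable φ) (hh : 0 < h)
    (f : StripSpace s') {B : ℝ} (hf : ‖f‖ ≤ B) :
    ‖pressure hs n hφ hφi hh f‖ ≤ 1 / (s' - s) * ((∫ y, ‖φ y‖) * B) ^ n := by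
  have hφ0 : 0 ≤ ∫ y, ‖φ y‖ := integral_nonneg fun _ => norm_nonneg _
  refine (norm_derivL_le hs _).trans (mul_le_mul_of_nonneg_left ?_
    (by have := sub_pos.2 hs; positivity))
  refine ((isStripFunction_val_pow n _).norm_ofFun_le
    (pow_nonneg (norm_nonneg (mollifyL s' hφ hφi hh f)) n)).trans ?_
  refine pow_le_pow_left₀ (norm_nonneg (mollifyL s' hφ hφi hh f)) ?_ n
  exact (norm_mollifyL_le hφ hφi hh f).trans (mul_le_mul_of_nonneg_left hf hφ0)

lemma differentiableOn_pressure (hs : s < s') (n : ℕ) (hφ : Continuous φ) (hφi : Integrable φ)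
    (hh : 0 < h) {X : ℂ → StripSpace s'} {T B : ℝ} (hX : DifferentiableOn ℂ X (Metric.ball 0 T))
    (hB : ∀ t ∈ Metric.ball 0 T, ‖X t‖ ≤ B) :
    DifferentiableOn ℂ (fun t => pressure hs n hφ hφi hh (X t)) (Metric.ball 0 T) := by
  refine (derivL hs).differentiable.comp_differentiableOn ?_
  have hφ0 : 0 ≤ ∫ y, ‖φ y‖ := integral_nonneg fun _ => norm_nonneg _
  refine differentiableOn_of_val (K := ((∫ y, ‖φ y‖) * B) ^ n) (fun t ht z hz => ?_)
    fun z hz => ?_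
  · rw [(isStripFunction_val_pow n _).val_ofFun hz, norm_pow]
    refine pow_le_pow_left₀ (norm_nonneg _) ?_ n
    exact ((norm_val_le _ _).trans (norm_mollifyL_le hφ hφi hh _)).trans
      (mul_le_mul_of_nonneg_left (hB t ht) hφ0)
  · have h1 : DifferentiableOn ℂ (fun t => val (mollifyL s' hφ hφi hh (X t)) z ^ n)
        (Metric.ball 0 T) :=
      (((evalL s' z).comp (mollifyL s' hφ hφi hh)).differentiable.comp_differentiableOn hX).pow n
    exact h1.congr fun t _ => (isStripFunction_val_pow n _).val_ofFun hz

/-- Real translations preserve the strip, so the pressure sees only values on it. This lets a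
solution on a wide strip be exchanged for its restriction. -/
lemma pressureGradC_congr {n : ℕ} {f g : ℂ → ℂ} (hfg : ∀ w ∈ closedStrip s, f w = g w) {z : ℂ}
    (hz : z ∈ strip s) : pressureGradC n φ h f z = pressureGradC n φ h g z := by
  have hm : ∀ w ∈ closedStrip s, mollifyC φ h f w = mollifyC φ h g w := fun w hw => by
    rw [mollifyC, mollifyC]
    congr 1
    ext y
    rw [hfg _ (sub_ofReal_mem_closedStrip hw y)]
  have hev : mollifyC φ h f =ᶠ[𝓝 z] mollifyC φ h g := by
    filter_upwards [(isOpen_strip s).mem_nhds hz] with w hw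
    exact hm w (strip_subset_closedStrip s hw)
  rw [pressureGradC, pressureGradC, hm z (strip_subset_closedStrip s hz), hev.deriv_eq]

lemma pressureGrad_restrictReal (hs : 0 < s) (n : ℕ) (hφ : Continuous φ) (hφi : Integrable φ)
    (hh : 0 < h) (f : StripSpace s) (x : ℝ) :
    pressureGradC n φ h (val f) x = pressureGrad n φ h (restrictReal hs f) x := by
  have hm : mollify φ h (restrictReal hs f) = fun x : ℝ => mollifyC φ h (val f) x := by
    ext x
    rw [mollify, mollifyC]
    congr 1
    ext y
    rw [restrictReal_apply, Complex.ofReal_sub]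
  have hd := ((isStripFunction_mollifyC hφ hφi hh (isStripFunction_val f)).diff.differentiableAt
    ((isOpen_strip s).mem_nhds (ofReal_mem_strip hs x))).hasDerivAt
  rw [pressureGrad, pressureGradC, hm, (hasDerivAt_comp_ofReal hd).deriv]

/-- The mollified functions stay bounded and holomorphic and differ from `g i` by $O(h)$, so they
share its limit and their derivatives converge too. -/
theorem tendsto_pressureGradC {ι : Type*} {l : Filter ι} [l.NeBot] {K : ℝ} {h : ι → ℝ}
    {g : ι → ℂ → ℂ} {g₀ : ℂ → ℂ} (n : ℕ) (hφ : Continuous φ) (hφc : HasCompactSupport φ)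
    (hφ1 : ∫ y, φ y = 1) (hs : s < s') (hh : ∀ᶠ i in l, 0 < h i) (hh0 : Tendsto h l (𝓝 0))
    (hg : ∀ᶠ i in l, IsStripFunction s' K (g i))
    (hp : ∀ z ∈ strip s, Tendsto (fun i => g i z) l (𝓝 (g₀ z))) {z : ℂ} (hz : z ∈ strip s) :
    Tendsto (fun i => pressureGradC n φ (h i) (g i) z) l (𝓝 (deriv (fun w => g₀ w ^ n) z)) := by
  have hφi : Integrable φ := hφ.integrable_of_hasCompactSupport hφc
  have hstrip : ∀ᶠ i in l, IsStripFunction s' (K * ∫ y, ‖φ y‖) (mollifyC φ (h i) (g i)) := by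
    filter_upwards [hg, hh] with i hgi hhi using isStripFunction_mollifyC hφ hφi hhi hgi
  have hpt : ∀ w ∈ strip s, Tendsto (fun i => mollifyC φ (h i) (g i) w) l (𝓝 (g₀ w)) := by
    intro w hw
    have h1 : Tendsto (fun i => mollifyC φ (h i) (g i) w - g i w) l (𝓝 0) := by
      refine squeeze_zero_norm' (a := fun i => K / (s' - s) * h i * ∫ y, |y| * ‖φ y‖) ?_ ?_
      · filter_upwards [hg, hh] with i hgi hhi
        exact norm_mollifyC_sub_le hφ hφc hφ1 hhi hgi hs (strip_subset_closedStrip s hw)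
      · simpa using (hh0.const_mul (K / (s' - s))).mul_const (∫ y, |y| * ‖φ y‖)
    simpa using h1.add (hp w hw)
  have hdiff : ∀ᶠ i in l, DifferentiableOn ℂ (mollifyC φ (h i) (g i)) (strip s) := by
    filter_upwards [hstrip] with i hi using hi.diff.mono (strip_mono hs.le)
  have hbdd : ∀ᶠ i in l, ∀ w ∈ strip s, ‖mollifyC φ (h i) (g i) w‖ ≤ K * ∫ y, ‖φ y‖ := by
    filter_upwards [hstrip] with i hi w hw
    exact hi.bdd w (closedStrip_mono hs.le (strip_subset_closedStrip s hw))
  have hder := tendsto_deriv_of_bounded (isOpen_strip s) hdiff hbdd hpt hz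
  have hg₀ : DifferentiableAt ℂ g₀ z :=
    ((tendstoLocallyUniformlyOn_of_bounded (isOpen_strip s) hdiff hbdd hpt).differentiableOn hdiff
      (isOpen_strip s)).differentiableAt ((isOpen_strip s).mem_nhds hz)
  rw [deriv_fun_pow hg₀]
  exact (((hpt z hz).pow (n - 1)).const_mul (n : ℂ)).mul hder

end Pressure

/-! ### Joint regularity of holomorphic maps into `E_s` -/

section Joint

variable {s δ : ℝ} {X : ℂ → StripSpace s}

/-- Continuity of `X` in the norm of $E_s$ is uniform in $z$, so separate continuity becomes joint.
-/
lemma continuousOn_val_joint (hX : ContinuousOn X (Metric.ball 0 δ)) :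
    ContinuousOn (fun p : ℂ × ℂ => val (X p.2) p.1) (closedStrip s ×ˢ Metric.ball 0 δ) := by
  rintro ⟨z₀, t₀⟩ ⟨hz₀, ht₀⟩
  have hX' : ContinuousWithinAt (fun p : ℂ × ℂ => ‖X p.2 - X t₀‖)
      (closedStrip s ×ˢ Metric.ball 0 δ) (z₀, t₀) := by
    have h1 : ContinuousWithinAt (fun p : ℂ × ℂ => X p.2) (closedStrip s ×ˢ Metric.ball 0 δ)
        (z₀, t₀) :=
      ContinuousWithinAt.comp (t := Metric.ball 0 δ) (hX t₀ ht₀)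
        continuous_snd.continuousWithinAt fun p hp => hp.2
    exact (h1.sub continuousWithinAt_const).norm
  have hv : ContinuousWithinAt (fun p : ℂ × ℂ => val (X t₀) p.1)
      (closedStrip s ×ˢ Metric.ball 0 δ) (z₀, t₀) :=
    ContinuousWithinAt.comp (t := closedStrip s) (continuousOn_val (X t₀) z₀ hz₀)
      continuous_fst.continuousWithinAt fun p hp => hp.1
  have hdiff : ContinuousWithinAt (fun p : ℂ × ℂ => val (X p.2 - X t₀) p.1)
      (closedStrip s ×ˢ Metric.ball 0 δ) (z₀, t₀) := by
    have hz : val (X t₀ - X t₀) z₀ = 0 := by rw [val_sub, sub_self]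
    have hX'' := hX'.tendsto
    have hn : ‖X t₀ - X t₀‖ = 0 := by rw [sub_self, norm_zero]
    rw [hn] at hX''
    rw [ContinuousWithinAt, hz]
    exact squeeze_zero_norm (fun p => norm_val_le _ _) hX''
  refine (hdiff.add hv).congr (fun p _ => ?_) ?_
  · rw [Pi.add_apply, val_sub, sub_add_cancel]
  · rw [Pi.add_apply, val_sub, sub_add_cancel]

/-- The differential of `(z, t) ↦ X(t)(z)`. -/
def jointFDeriv (X : ℂ → StripSpace s) (z t : ℂ) : ℂ × ℂ →L[ℂ] ℂ :=
  (ContinuousLinearMap.toSpanSingleton ℂ (deriv (val (X t)) z)).coprod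
    (ContinuousLinearMap.toSpanSingleton ℂ (val (deriv X t) z))

lemma continuousAt_deriv_val (hX : DifferentiableOn ℂ X (Metric.ball 0 δ)) {p : ℂ × ℂ}
    (hp : p ∈ strip s ×ˢ Metric.ball 0 δ) :
    ContinuousAt (fun q : ℂ × ℂ => deriv (val (X q.2)) q.1) p := by
  -- On an intermediate strip the $z$-derivative is the image of `X` under the bounded map `derivL`,
  -- so joint continuity applies to it.
  obtain ⟨s', hs1, hs2⟩ := exists_between (mem_strip.1 hp.1)
  have hc := continuousOn_val_joint
    ((derivL hs2).continuous.comp_continuousOn hX.continuousOn)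
  have hmem : strip s' ×ˢ Metric.ball 0 δ ∈ 𝓝 p :=
    ((isOpen_strip s').prod Metric.isOpen_ball).mem_nhds ⟨hs1, hp.2⟩
  have hc' := hc.continuousAt (mem_of_superset hmem
    (prod_mono (strip_subset_closedStrip s') Subset.rfl))
  refine hc'.congr ?_
  filter_upwards [hmem] with q hq
  exact val_derivL hs2 _ (strip_subset_closedStrip s' hq.1)

lemma continuousAt_val_deriv (hX : DifferentiableOn ℂ X (Metric.ball 0 δ)) {p : ℂ × ℂ}
    (hp : p ∈ strip s ×ˢ Metric.ball 0 δ) :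
    ContinuousAt (fun q : ℂ × ℂ => val (deriv X q.2) q.1) p :=
  (continuousOn_val_joint (hX.deriv Metric.isOpen_ball).continuousOn).continuousAt
    (mem_of_superset (((isOpen_strip s).prod Metric.isOpen_ball).mem_nhds hp)
      (prod_mono (strip_subset_closedStrip s) Subset.rfl))

/-- Both partial derivatives exist and are jointly continuous. Joint holomorphy is what allows
locally uniform convergence in $(z,t)$. -/
lemma hasFDerivAt_val_joint (hX : DifferentiableOn ℂ X (Metric.ball 0 δ)) {p : ℂ × ℂ}
    (hp : p ∈ strip s ×ˢ Metric.ball 0 δ) :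
    HasFDerivAt (fun q : ℂ × ℂ => val (X q.2) q.1) (jointFDeriv X p.1 p.2) p := by
  have hnhds := ((isOpen_strip s).prod Metric.isOpen_ball).mem_nhds hp
  have h := hasStrictFDerivAt_uncurry_coprod (𝕜 := ℂ) (u := p) (f := fun z t => val (X t) z)
    (f₁ := fun z t => ContinuousLinearMap.toSpanSingleton ℂ (deriv (val (X t)) z))
    (f₂ := fun z t => ContinuousLinearMap.toSpanSingleton ℂ (val (deriv X t) z)) ?_ ?_ ?_ ?_
  · exact h.hasFDerivAt
  · filter_upwards [hnhds] with q hq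
    exact (differentiableAt_val (X q.2) hq.1).hasDerivAt.hasFDerivAt
  · filter_upwards [hnhds] with q hq
    exact ((evalL s q.1).hasFDerivAt.comp_hasDerivAt q.2
      (hX.differentiableAt (Metric.isOpen_ball.mem_nhds hq.2)).hasDerivAt).hasFDerivAt
  · exact (ContinuousLinearMap.toSpanSingletonCLE (𝕜 := ℂ)).continuous.continuousAt.comp
      (continuousAt_deriv_val hX hp)
  · exact (ContinuousLinearMap.toSpanSingletonCLE (𝕜 := ℂ)).continuous.continuousAt.comp
      (continuousAt_val_deriv hX hp)

lemma differentiableOn_val_joint (hX : DifferentiableOn ℂ X (Metric.ball 0 δ)) :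
    DifferentiableOn ℂ (fun q : ℂ × ℂ => val (X q.2) q.1) (strip s ×ˢ Metric.ball 0 δ) :=
  fun _ hp => (hasFDerivAt_val_joint hX hp).differentiableAt.differentiableWithinAt

lemma contDiffAt_val_joint (hX : DifferentiableOn ℂ X (Metric.ball 0 δ)) {p : ℂ × ℂ}
    (hp : p ∈ strip s ×ˢ Metric.ball 0 δ) :
    ContDiffAt ℂ 1 (fun q : ℂ × ℂ => val (X q.2) q.1) p := by
  rw [contDiffAt_one_iff]
  refine ⟨fun q => jointFDeriv X q.1 q.2, strip s ×ˢ Metric.ball 0 δ,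
    ((isOpen_strip s).prod Metric.isOpen_ball).mem_nhds hp, fun q hq => ?_,
    fun q hq => hasFDerivAt_val_joint hX hq⟩
  have h1 : ContinuousAt (fun q : ℂ × ℂ => ContinuousLinearMap.toSpanSingleton ℂ
      (deriv (val (X q.2)) q.1)) q :=
    (ContinuousLinearMap.toSpanSingletonCLE (𝕜 := ℂ)).continuous.continuousAt.comp
      (continuousAt_deriv_val hX hq)
  have h2 : ContinuousAt (fun q : ℂ × ℂ => ContinuousLinearMap.toSpanSingleton ℂ
      (val (deriv X q.2) q.1)) q :=
    (ContinuousLinearMap.toSpanSingletonCLE (𝕜 := ℂ)).continuous.continuousAt.comp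
      (continuousAt_val_deriv hX hq)
  refine ContinuousAt.continuousWithinAt ?_
  have h3 : ∀ a b : ℂ →L[ℂ] ℂ, a.coprod b = a.comp (ContinuousLinearMap.fst ℂ ℂ ℂ)
      + b.comp (ContinuousLinearMap.snd ℂ ℂ ℂ) := fun a b => by ext <;> simp
  simp only [jointFDeriv, h3]
  exact (h1.clm_comp continuousAt_const).add (h2.clm_comp continuousAt_const)

end Joint

/-! ### Classical solutions -/

section Classical

variable {s δ : ℝ} {u : ℝ → ℝ → ℝ} {f : ℝ → ℝ → ℂ} {g₀ : ℝ → ℂ}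

theorem isClassicalSolution_of_strip (hs : 0 < s) {X : ℂ → StripSpace s}
    (hX : DifferentiableOn ℂ X (Metric.ball 0 δ)) {U : ℂ → ℂ → ℂ}
    (hU : ∀ t : ℝ, t ∈ Ico 0 δ → DifferentiableOn ℂ (fun z => U z t) (strip s))
    (hu : ∀ x t : ℝ, t ∈ Ico 0 δ → (u x t : ℂ) = U x t)
    (hinit : ∀ x : ℝ, val (X 0) x = g₀ x)
    (hode : ∀ t : ℝ, t ∈ Ico 0 δ → ∀ x : ℝ,
      val (deriv X t) x = -deriv (fun z => val (X t) z * U z t) x - f x t) :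
    IsClassicalSolution δ u f g₀ (fun x t => val (X t) x) := by
  have hball : ∀ t : ℝ, t ∈ Ico 0 δ → (t : ℂ) ∈ Metric.ball 0 δ := fun t ht => by
    simpa [abs_of_nonneg ht.1] using ht.2
  refine ⟨fun t ht x => ?_, fun p hp => ?_, fun x => ?_, fun x t ht => ?_⟩
  · have := val_periodic (X t) (ofReal_mem_closedStrip hs.le x)
    push_cast
    exact this
  · refine ContDiffAt.contDiffWithinAt ?_
    have h1 : ContDiffAt ℝ 1 (fun q : ℂ × ℂ => val (X q.2) q.1) ((p.1 : ℂ), (p.2 : ℂ)) :=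
      (contDiffAt_val_joint hX ⟨ofReal_mem_strip hs p.1, hball p.2 hp.2⟩).restrict_scalars ℝ
    have h2 : ContDiff ℝ 1 (fun q : ℝ × ℝ => ((q.1 : ℂ), (q.2 : ℂ))) :=
      (Complex.ofRealCLM.contDiff.comp contDiff_fst).prodMk
        (Complex.ofRealCLM.contDiff.comp contDiff_snd)
    exact h1.comp p h2.contDiffAt
  · simpa using hinit x
  · have hd : DifferentiableAt ℂ (fun z => val (X t) z * U z t) (x : ℂ) :=
      (differentiableAt_val _ (ofReal_mem_strip hs x)).mul
        ((hU t ht).differentiableAt ((isOpen_strip s).mem_nhds (ofReal_mem_strip hs x)))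
    refine ⟨deriv (fun z => val (X t) z * U z t) x, ?_, ?_⟩
    · have := hasDerivAt_comp_ofReal hd.hasDerivAt
      simpa only [hu _ t ht] using this
    · rw [← hode t ht x]
      have := (evalL s x).hasFDerivAt.comp_hasDerivAt (t : ℂ)
        (hX.differentiableAt (Metric.isOpen_ball.mem_nhds (hball t ht))).hasDerivAt
      exact (hasDerivAt_comp_ofReal this).hasDerivWithinAt

lemma IsClassicalSolution.differentiableAt {Y : ℝ → ℝ → ℂ} (hY : IsClassicalSolution δ u f g₀ Y)
    {t : ℝ} (ht : t ∈ Ico 0 δ) (x : ℝ) : DifferentiableAt ℝ (fun ξ => Y ξ t) x := by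
  have h1 := (hY.contDiffOn.differentiableOn one_ne_zero) (x, t) ⟨mem_univ _, ht⟩
  have h2 : DifferentiableWithinAt ℝ (fun ξ : ℝ => (ξ, t)) univ x :=
    (differentiableAt_id.prodMk (differentiableAt_const t)).differentiableWithinAt
  have h3 := DifferentiableWithinAt.comp (t := univ ×ˢ Ico 0 δ) x h1 h2
    fun ξ _ => ⟨mem_univ ξ, ht⟩
  exact differentiableWithinAt_univ.1 h3

/-- In the maximum principle the maximum may sit at the final time, so only comparison from the left
is available. -/
lemma nonneg_of_hasDerivAt_of_le_left {m : ℝ → ℝ} {m' t : ℝ} (hm : HasDerivAt m m' t) (ht : 0 < t)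
    (hle : ∀ τ ∈ Icc 0 t, m τ ≤ m t) : 0 ≤ m' := by
  have h := (hasDerivWithinAt_iff_tendsto_slope' (s := Iio t) (lt_irrefl t)).1
    hm.hasDerivWithinAt
  refine ge_of_tendsto h ?_
  filter_upwards [Ioo_mem_nhdsLT ht] with τ hτ
  rw [slope_def_field]
  exact div_nonneg_of_nonpos (sub_nonpos.2 (hle τ ⟨hτ.1.le, hτ.2.le⟩)) (sub_nonpos.2 hτ.2.le)

/-- Maximum principle for $|D|^2e^{-(2K+1)t}$, where $D=Y-Z$. At a positive maximum the time is
positive because the initial data agree, and the time derivative there is both nonnegative and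
strictly negative. -/
theorem IsClassicalSolution.eq {K : ℝ} {u' : ℝ → ℝ → ℝ}
    (hu : ∀ t ∈ Ico 0 δ, ∀ x, HasDerivAt (fun ξ => u ξ t) (u' x t) x)
    (hK : ∀ t ∈ Ico 0 δ, ∀ x, |u' x t| ≤ K) {Y Z : ℝ → ℝ → ℂ}
    (hY : IsClassicalSolution δ u f g₀ Y) (hZ : IsClassicalSolution δ u f g₀ Z) (x : ℝ) {t : ℝ}
    (ht : t ∈ Ico 0 δ) : Y x t = Z x t := by
  have hsub : Icc 0 t ⊆ Ico 0 δ := fun τ hτ => ⟨hτ.1, hτ.2.trans_lt ht.2⟩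
  set D : ℝ → ℝ → ℂ := fun x t => Y x t - Z x t with hD
  have hper : ∀ τ ∈ Ico 0 δ, Function.Periodic (fun x => D x τ) (2 * Real.pi) := fun τ hτ x => by
    have h1 := hY.periodic τ hτ x
    have h2 := hZ.periodic τ hτ x
    simp only at h1 h2
    simp only [hD, h1, h2]
  -- The term $-u_xD$ makes $|D|^2$ grow at rate at most $2K$; the additional 1 makes the decay
  -- strict.
  set q : ℝ × ℝ → ℝ := fun p => ‖D p.1 p.2‖ ^ 2 * Real.exp (-(2 * K + 1) * p.2) with hq
  have hqcont : ContinuousOn q (Icc 0 (2 * Real.pi) ×ˢ Icc 0 t) := by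
    have hsub' : Icc 0 (2 * Real.pi) ×ˢ Icc 0 t ⊆ (univ : Set ℝ) ×ˢ Ico 0 δ :=
      prod_mono (subset_univ _) hsub
    have h1 := hY.contDiffOn.continuousOn.mono hsub'
    have h2 := hZ.contDiffOn.continuousOn.mono hsub'
    exact ((h1.sub h2).norm.pow 2).mul (Continuous.continuousOn (by fun_prop))
  obtain ⟨⟨x₀, t₀⟩, ⟨hx₀, ht₀⟩, hmax⟩ := (isCompact_Icc.prod isCompact_Icc).exists_isMaxOn
    ⟨(0, 0), ⟨⟨le_rfl, by positivity⟩, ⟨le_rfl, ht.1⟩⟩⟩ hqcont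
  replace ht₀ : t₀ ∈ Icc 0 t := ht₀
  have hmax' : ∀ y, ∀ τ ∈ Icc 0 t, q (y, τ) ≤ q (x₀, t₀) := by
    intro y τ hτ
    obtain ⟨y', hy', hyy⟩ := (hper τ (hsub hτ)).exists_mem_Ico₀ (by positivity) y
    have h1 : q (y', τ) ≤ q (x₀, t₀) := hmax ⟨⟨hy'.1, hy'.2.le⟩, hτ⟩
    have h2 : q (y, τ) = q (y', τ) := by simp only [hq]; rw [show D y τ = D y' τ from hyy]
    rwa [h2]
  have hzero : q (x₀, t₀) ≤ 0 := by
    by_contra! hpos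
    have hDpos : 0 < ‖D x₀ t₀‖ ^ 2 := by
      by_contra! hle
      exact hpos.not_ge (mul_nonpos_of_nonpos_of_nonneg hle (Real.exp_pos _).le)
    have ht₀' := hsub ht₀
    have ht₀pos : 0 < t₀ := by
      refine ht₀.1.lt_of_ne fun h => ?_
      rw [← h] at hDpos
      simp only [hD, hY.init, hZ.init, sub_self, norm_zero] at hDpos
      norm_num at hDpos
    obtain ⟨dY, hdY, hdYt⟩ := hY.pde x₀ t₀ ht₀'
    obtain ⟨dZ, hdZ, hdZt⟩ := hZ.pde x₀ t₀ ht₀'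
    have hux := hu t₀ ht₀' x₀
    have hDx : HasDerivAt (fun ξ => D ξ t₀) (deriv (fun ξ => D ξ t₀) x₀) x₀ :=
      ((hY.differentiableAt ht₀' x₀).sub (hZ.differentiableAt ht₀' x₀)).hasDerivAt
    set dx := deriv (fun ξ => D ξ t₀) x₀
    have hprod := hDx.mul hux.ofReal_comp
    have hprod' : HasDerivAt (fun ξ => D ξ t₀ * (u ξ t₀ : ℂ)) (dY - dZ) x₀ := by
      refine (hdY.sub hdZ).congr_of_eventuallyEq (Eventually.of_forall fun ξ => ?_)
      simp only [hD, Pi.sub_apply, sub_mul]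
    have hdd := hprod'.unique hprod
    have hDt : HasDerivAt (fun τ => D x₀ τ) (-(dx * u x₀ t₀ + D x₀ t₀ * u' x₀ t₀)) t₀ := by
      have h1 := (hdYt.sub hdZt).hasDerivAt (Ici_mem_nhds ht₀pos)
      rw [← hdd]
      refine h1.congr_deriv ?_
      ring
    -- A spatial maximum of $|D|^2$ forces $D_x\perp D$ in $\mathbb R^2$; as $u$ is real, the
    -- transport term $uD_x$ drops out.
    have hinner0 : inner ℝ (D x₀ t₀) dx = 0 := by
      have hloc : IsLocalMax (fun ξ => ‖D ξ t₀‖ ^ 2) x₀ := Eventually.of_forall fun ξ => by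
        have := hmax' ξ t₀ ht₀
        simp only [hq] at this
        exact le_of_mul_le_mul_right this (Real.exp_pos _)
      have := hloc.hasDerivAt_eq_zero hDx.norm_sq
      linarith
    have hexp : HasDerivAt (fun τ => Real.exp (-(2 * K + 1) * τ))
        (Real.exp (-(2 * K + 1) * t₀) * -(2 * K + 1)) t₀ := by
      have := ((hasDerivAt_id t₀).const_mul (-(2 * K + 1))).exp
      simpa using this
    have hm := hDt.norm_sq.mul hexp
    have hnn := nonneg_of_hasDerivAt_of_le_left hm ht₀pos fun τ hτ =>
      hmax' x₀ τ ⟨hτ.1, hτ.2.trans ht₀.2⟩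
    have hinner : inner ℝ (D x₀ t₀) (-(dx * u x₀ t₀ + D x₀ t₀ * u' x₀ t₀))
        = -(u' x₀ t₀ * ‖D x₀ t₀‖ ^ 2) := by
      rw [inner_neg_right, inner_add_right, mul_comm dx, mul_comm (D x₀ t₀), ← Complex.real_smul,
        ← Complex.real_smul, inner_smul_right, inner_smul_right, hinner0,
        real_inner_self_eq_norm_sq]
      ring
    have hnn' : 0 ≤ (2 * -(u' x₀ t₀ * ‖D x₀ t₀‖ ^ 2)) * Real.exp (-(2 * K + 1) * t₀)
        + ‖D x₀ t₀‖ ^ 2 * (Real.exp (-(2 * K + 1) * t₀) * -(2 * K + 1)) := by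
      rw [← hinner]
      exact hnn
    have hfac : (2 * -(u' x₀ t₀ * ‖D x₀ t₀‖ ^ 2)) * Real.exp (-(2 * K + 1) * t₀)
        + ‖D x₀ t₀‖ ^ 2 * (Real.exp (-(2 * K + 1) * t₀) * -(2 * K + 1))
        = -((2 * (u' x₀ t₀ + K) + 1) * (‖D x₀ t₀‖ ^ 2 * Real.exp (-(2 * K + 1) * t₀))) := by ring
    rw [hfac] at hnn'
    have hu'K : 0 < 2 * (u' x₀ t₀ + K) + 1 := by
      linarith [neg_le_of_abs_le (hK t₀ ht₀' x₀)]
    have hE : 0 < ‖D x₀ t₀‖ ^ 2 * Real.exp (-(2 * K + 1) * t₀) := mul_pos hDpos (Real.exp_pos _)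
    linarith [mul_pos hu'K hE]
  have hfin := (hmax' x t (right_mem_Icc.2 ht.1)).trans hzero
  have hle : ‖D x t‖ ^ 2 ≤ 0 := by
    simp only [hq] at hfin
    exact le_of_mul_le_mul_right (by rwa [zero_mul]) (Real.exp_pos (-(2 * K + 1) * t))
  have : ‖D x t‖ = 0 := by nlinarith [norm_nonneg (D x t)]
  exact sub_eq_zero.1 (norm_eq_zero.1 this)

end Classical

/-! ### Limits along ultrafilters -/

/-- Bounded complex numbers always converge along an ultrafilter, so no subsequence is extracted.
The strip shrinks because the limit is shown to be holomorphic only inside the open strip `s'`,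
which gives continuity on the smaller closed one. -/
theorem exists_ultrafilter_limit {ι : Type*} (U : Ultrafilter ι) {s s' T K : ℝ} (hs : 0 < s)
    (hss : s < s') {G : ι → ℂ → ℂ → ℂ} (hG : ∀ᶠ i in (U : Filter ι), StripCoefficient s' T K (G i)) :
    ∃ L : ℂ → StripSpace s, DifferentiableOn ℂ L (Metric.ball 0 T) ∧
      (∀ t ∈ Metric.ball 0 T, ‖L t‖ ≤ K) ∧
      ∀ t ∈ Metric.ball 0 T, ∀ z ∈ closedStrip s,
        Tendsto (fun i => G i z t) U (𝓝 (val (L t) z)) := by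
  have hpt : ∀ z t : ℂ, z ∈ closedStrip s' ∧ t ∈ Metric.ball (0 : ℂ) T →
      ∃ y, Tendsto (fun i => G i z t) U (𝓝 y) := by
    rintro z t ⟨hz, ht⟩
    have hle : ((U.map fun i => G i z t : Ultrafilter ℂ) : Filter ℂ) ≤
        𝓟 (Metric.closedBall 0 K) := by
      rw [le_principal_iff]
      change ∀ᶠ i in (U : Filter ι), G i z t ∈ Metric.closedBall 0 K
      filter_upwards [hG] with i hi
      simpa using (hi.space t ht).bdd z hz
    obtain ⟨y, -, hy⟩ := (isCompact_closedBall (0 : ℂ) K).ultrafilter_le_nhds _ hle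
    exact ⟨y, hy⟩
  choose! l hl using hpt
  have hstrip : ∀ t ∈ Metric.ball (0 : ℂ) T, IsStripFunction s K fun z => l z t := by
    intro t ht
    have hd : DifferentiableOn ℂ (fun z => l z t) (strip s') := by
      have hdi : ∀ᶠ i in (U : Filter ι), DifferentiableOn ℂ (fun z => G i z t) (strip s') := by
        filter_upwards [hG] with i hi using (hi.space t ht).diff
      refine (tendstoLocallyUniformlyOn_of_bounded (K := K) (isOpen_strip s') hdi ?_
        fun z hz => hl z t ⟨strip_subset_closedStrip s' hz, ht⟩).differentiableOn hdi
        (isOpen_strip s')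
      filter_upwards [hG] with i hi z hz
      exact (hi.space t ht).bdd z (strip_subset_closedStrip s' hz)
    refine ⟨hd.continuousOn.mono (closedStrip_subset_strip hss), hd.mono (strip_mono hss.le),
      fun z hz => ?_, fun z hz => ?_⟩
    · have hz' := closedStrip_mono hss.le hz
      refine tendsto_nhds_unique (hl _ t ⟨add_two_pi_mem_closedStrip hz', ht⟩)
        ((hl z t ⟨hz', ht⟩).congr' ?_)
      filter_upwards [hG] with i hi
      exact ((hi.space t ht).per z hz').symm
    · have hz' := closedStrip_mono hss.le hz
      refine le_of_tendsto (hl z t ⟨hz', ht⟩).norm ?_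
      filter_upwards [hG] with i hi using (hi.space t ht).bdd z hz'
  refine ⟨fun t => ofFun s fun z => l z t, ?_, fun t ht => ?_, fun t ht z hz => ?_⟩
  · refine differentiableOn_of_val (K := K) (fun t ht z hz => ?_) fun z hz => ?_
    · rw [(hstrip t ht).val_ofFun hz]
      exact (hstrip t ht).bdd z hz
    · have hz' := closedStrip_mono hss.le hz
      have hdi : ∀ᶠ i in (U : Filter ι), DifferentiableOn ℂ (fun t => G i z t) (Metric.ball 0 T) := by
        filter_upwards [hG] with i hi using hi.time z hz'
      have hd : DifferentiableOn ℂ (fun t => l z t) (Metric.ball 0 T) := by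
        refine (tendstoLocallyUniformlyOn_of_bounded (K := K) Metric.isOpen_ball hdi ?_
          fun t ht => hl z t ⟨hz', ht⟩).differentiableOn hdi Metric.isOpen_ball
        filter_upwards [hG] with i hi t ht using (hi.space t ht).bdd z hz'
      exact hd.congr fun t ht => (hstrip t ht).val_ofFun hz
  · exact (hstrip t ht).norm_ofFun_le ((hstrip t ht).nonneg hs.le)
  · rw [(hstrip t ht).val_ofFun hz]
    exact hl z t ⟨closedStrip_mono hss.le hz, ht⟩

lemma stripCoefficient_val {s T K : ℝ} {X : ℂ → StripSpace s}
    (hX : DifferentiableOn ℂ X (Metric.ball 0 T)) (hK : ∀ t ∈ Metric.ball 0 T, ‖X t‖ ≤ K) :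
    StripCoefficient s T K fun z t => val (X t) z :=
  ⟨fun t ht => (isStripFunction_val (X t)).mono_bound (hK t ht),
    fun z _ => (evalL s z).differentiable.comp_differentiableOn hX⟩

/-! ### Passing to the limit in the equation and in the data. -/

section Limit

lemma eventually_mem_Ioo {l : Filter ℝ} (hl : l ≤ 𝓝[>] 0) : ∀ᶠ ε in l, ε ∈ Ioo (0 : ℝ) 1 :=
  hl (Ioo_mem_nhdsGT zero_lt_one)

variable {l : Filter ℝ} [l.NeBot]

/-- Both sides are limits attached to bounded holomorphic families: a derivative in $t$, and a
difference quotient in $z$ with step $\sigma\epsilon$. Since $\sigma^2=1$, the factor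
$(\sigma\epsilon)^{-1}$ is $\sigma/\epsilon$. -/
theorem limit_equation (hl : l ≤ 𝓝[>] 0) {s s' δ σ K M : ℝ} (hss : s < s')
    (hσ : σ = 1 ∨ σ = -1) {u f : ℝ → ℂ → ℂ → ℂ} {g₀ : ℝ → ℂ → ℂ} {X : ℝ → ℂ → StripSpace s'}
    (hX : ∀ ε ∈ Ioo (0 : ℝ) 1, SolvesStripODE σ ε δ (u ε) (f ε) (g₀ ε) (X ε))
    (hK : ∀ ε ∈ Ioo (0 : ℝ) 1, ∀ t ∈ Metric.ball 0 δ, ‖X ε t‖ ≤ K)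
    (hu : ∀ ε ∈ Ioo (0 : ℝ) 1, StripCoefficient s' δ M (u ε)) {L : ℂ → StripSpace s}
    (hLd : DifferentiableOn ℂ L (Metric.ball 0 δ))
    (hL : ∀ t ∈ Metric.ball 0 δ, ∀ z ∈ closedStrip s,
      Tendsto (fun ε => val (X ε t) z) l (𝓝 (val (L t) z)))
    {u₀ f₀ : ℂ → ℂ → ℂ}
    (hu₀ : ∀ t ∈ Metric.ball 0 δ, ∀ z ∈ strip s, Tendsto (fun ε => u ε z t) l (𝓝 (u₀ z t)))
    (hf₀ : ∀ t ∈ Metric.ball 0 δ, ∀ z ∈ strip s, Tendsto (fun ε => f ε z t) l (𝓝 (f₀ z t)))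
    {t : ℂ} (ht : t ∈ Metric.ball 0 δ) {z : ℂ} (hz : z ∈ strip s) :
    val (deriv L t) z = -deriv (fun w => val (L t) w * u₀ w t) z - f₀ z t := by
  have hev := eventually_mem_Ioo hl
  have hzc := strip_subset_closedStrip s hz
  have hleft : Tendsto (fun ε => val (deriv (X ε) t) z) l (𝓝 (val (deriv L t) z)) := by
    have hdL : deriv (fun t => val (L t) z) t = val (deriv L t) z :=
      ((evalL s z).hasFDerivAt.comp_hasDerivAt t
        (hLd.differentiableAt (Metric.isOpen_ball.mem_nhds ht)).hasDerivAt).deriv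
    rw [← hdL]
    refine (tendsto_deriv_of_bounded (g := fun ε t => val (X ε t) z)
      (g₀ := fun t => val (L t) z) (K := K) Metric.isOpen_ball ?_ ?_
      (fun t ht => hL t ht z hzc) ht).congr' ?_
    · filter_upwards [hev] with ε hε
      exact (evalL s' z).differentiable.comp_differentiableOn (hX ε hε).holo
    · filter_upwards [hev] with ε hε t ht using (norm_val_le _ _).trans (hK ε hε t ht)
    · filter_upwards [hev] with ε hε using ((hX ε hε).hasDerivAt_val z ht).deriv
  have hσ2 : (σ : ℂ) * σ = 1 := by rcases hσ with rfl | rfl <;> simp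
  have hσ0 : (σ : ℂ) ≠ 0 := fun h => by simp [h] at hσ2
  have hmul : ∀ ε ∈ Ioo (0 : ℝ) 1,
      IsStripFunction s' (K * M) fun w => val (X ε t) w * u ε w t := fun ε hε => by
    have hK0 : 0 ≤ K := (norm_nonneg _).trans (hK ε hε t ht)
    exact ((isStripFunction_val (X ε t)).mono_bound (hK ε hε t ht)).mul ((hu ε hε).space t ht) hK0
  have hdq : Tendsto (fun ε : ℝ => ((σ : ℂ) * ε)⁻¹ * (val (X ε t) z * u ε z t
      - val (X ε t) (z - σ * ε) * u ε (z - σ * ε) t)) l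
      (𝓝 (deriv (fun w => val (L t) w * u₀ w t) z)) := by
    refine tendsto_differenceQuotient_of_bounded (g := fun ε w => val (X ε t) w * u ε w t)
      (g₀ := fun w => val (L t) w * u₀ w t) (K := K * M) (h := fun ε : ℝ => (σ : ℂ) * ε)
      (isOpen_strip s) ?_ ?_ (fun w hw => (hL t ht w (strip_subset_closedStrip s hw)).mul
        (hu₀ t ht w hw)) hz ?_ ?_
    · filter_upwards [hev] with ε hε using (hmul ε hε).diff.mono (strip_mono hss.le)
    · filter_upwards [hev] with ε hε w hw
      exact (hmul ε hε).bdd w (closedStrip_mono hss.le (strip_subset_closedStrip s hw))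
    · have h1 : Tendsto (fun ε : ℝ => (σ : ℂ) * ε) (𝓝 0) (𝓝 0) := by
        have : Continuous fun ε : ℝ => (σ : ℂ) * ε := by fun_prop
        simpa using this.tendsto 0
      exact h1.mono_left (hl.trans nhdsWithin_le_nhds)
    · filter_upwards [hev] with ε hε
      exact mul_ne_zero hσ0 (by exact_mod_cast hε.1.ne')
  refine tendsto_nhds_unique hleft ((hdq.neg.sub (hf₀ t ht z hz)).congr' ?_)
  filter_upwards [hev] with ε hε
  rw [(hX ε hε).ode t ht z (strip_mono hss.le hz)]
  have hinv : ((σ : ℂ) * ε)⁻¹ = (σ : ℂ) / ε := by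
    have hε0 : (ε : ℂ) ≠ 0 := by exact_mod_cast hε.1.ne'
    field_simp
    linear_combination -hσ2
  rw [hinv, neg_mul]

/-- The locally uniform limit is also the $L^1$ limit over one period; two continuous functions at
$L^1$ distance zero agree there, hence everywhere by periodicity. -/
theorem eq_of_convergesL1Torus (hl : l ≤ 𝓝[>] 0) {s K : ℝ} (hs : 0 < s) {g : ℝ → ℂ → ℂ}
    {g₀ : ℝ → ℂ} (h : ConvergesL1Torus (fun ε x => g ε x) g₀)
    (hg : ∀ ε ∈ Ioo (0 : ℝ) 1, IsStripFunction s K (g ε)) {L : ℂ → ℂ}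
    (hL : ∀ z ∈ strip s, Tendsto (fun ε => g ε z) l (𝓝 (L z))) (x : ℝ) : L x = g₀ x := by
  have hev := eventually_mem_Ioo hl
  have hdi : ∀ᶠ ε in l, DifferentiableOn ℂ (g ε) (strip s) := by
    filter_upwards [hev] with ε hε using (hg ε hε).diff
  have hloc : TendstoLocallyUniformlyOn g L l (strip s) := by
    refine tendstoLocallyUniformlyOn_of_bounded (K := K) (isOpen_strip s) hdi ?_ hL
    filter_upwards [hev] with ε hε z hz
    exact (hg ε hε).bdd z (strip_subset_closedStrip s hz)
  have hreal : ∀ k : ℂ → ℂ, DifferentiableOn ℂ k (strip s) → Continuous fun x : ℝ => k x :=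
    fun k hk => hk.continuousOn.comp_continuous Complex.continuous_ofReal
      fun x => ofReal_mem_strip hs x
  have hLc := hreal L (hloc.differentiableOn hdi (isOpen_strip s))
  have hpi : -Real.pi < Real.pi := by linarith [Real.pi_pos]
  have hint : ∀ k m : ℝ → ℂ, Continuous k → Continuous m →
      IntervalIntegrable (fun x => ‖k x - m x‖) volume (-Real.pi) Real.pi := fun k m hk hm =>
    (hk.sub hm).norm.intervalIntegrable _ _
  have hunif : Tendsto (fun ε => ∫ x in (-Real.pi)..Real.pi, ‖g ε x - L x‖) l (𝓝 0) := by
    have hcomp : IsCompact ((fun x : ℝ => (x : ℂ)) '' Icc (-Real.pi) Real.pi) :=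
      isCompact_Icc.image Complex.continuous_ofReal
    have hu := (tendstoLocallyUniformlyOn_iff_forall_isCompact (isOpen_strip s)).1 hloc _
      (by rintro _ ⟨y, -, rfl⟩; exact ofReal_mem_strip hs y) hcomp
    rw [Metric.tendsto_nhds]
    intro e he
    filter_upwards [Metric.tendstoUniformlyOn_iff.1 hu (e / (4 * Real.pi)) (by positivity)]
      with ε hε
    have hb := intervalIntegral.norm_integral_le_of_norm_le_const (a := -Real.pi) (b := Real.pi)
      (f := fun x : ℝ => ‖g ε x - L x‖) (C := e / (4 * Real.pi)) fun y hy => by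
        rw [uIoc_of_le hpi.le] at hy
        have := hε y ⟨y, Ioc_subset_Icc_self hy, rfl⟩
        rw [dist_comm, dist_eq_norm] at this
        rw [norm_norm]
        exact this.le
    rw [dist_zero_right]
    refine hb.trans_lt ?_
    rw [show Real.pi - -Real.pi = 2 * Real.pi by ring, abs_of_pos (by positivity)]
    have hp := Real.pi_pos
    have : e / (4 * Real.pi) * (2 * Real.pi) = e / 2 := by field_simp; ring
    linarith
  have hI : ∫ x in (-Real.pi)..Real.pi, ‖L x - g₀ x‖ ≤ 0 := by
    have hsum := hunif.add (h.tendsto.mono_left hl)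
    rw [add_zero] at hsum
    refine ge_of_tendsto hsum ?_
    filter_upwards [hev] with ε hε
    have hgc := hreal (g ε) (hg ε hε).diff
    rw [← intervalIntegral.integral_add (hint _ _ hgc hLc) (hint _ _ hgc h.continuous)]
    refine intervalIntegral.integral_mono_on hpi.le (hint _ _ hLc h.continuous)
      ((hint _ _ hgc hLc).add (hint _ _ hgc h.continuous)) fun y _ => ?_
    rw [norm_sub_rev (g ε y) (L y)]
    exact norm_sub_le_norm_sub_add_norm_sub _ _ _
  have heq : ∀ y ∈ Icc (-Real.pi) Real.pi, L y = g₀ y := by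
    intro y hy
    by_contra hne
    exact hI.not_gt (intervalIntegral.integral_pos hpi (hLc.sub h.continuous).norm.continuousOn
      (fun _ _ => norm_nonneg _) ⟨y, hy, norm_pos_iff.2 (sub_ne_zero.2 hne)⟩)
  have hper : Function.Periodic (fun y : ℝ => L y - g₀ y) (2 * Real.pi) := by
    intro y
    have h1 : L ((y + 2 * Real.pi : ℝ) : ℂ) = L y := by
      refine tendsto_nhds_unique (hL _ (ofReal_mem_strip hs _))
        ((hL _ (ofReal_mem_strip hs y)).congr' ?_)
      filter_upwards [hev] with ε hε
      have := (hg ε hε).per y (ofReal_mem_closedStrip hs.le y)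
      push_cast
      exact this.symm
    simp only [h1, h.periodic y]
  obtain ⟨y, hy, hxy⟩ := hper.exists_mem_Ico (by positivity) x (-Real.pi)
  have hy' : y ∈ Icc (-Real.pi) Real.pi := ⟨hy.1, by linarith [hy.2]⟩
  refine sub_eq_zero.1 ?_
  rw [hxy]
  exact sub_eq_zero.2 (heq y hy')

end Limit

/-! ### Uniqueness and convergence -/

/-- Agreement at small positive reals suffices, as these accumulate at `0`; the one-sided form
matches times $t\ge0$. -/
lemma eqOn_of_eq_ofReal {V : Set ℂ} (hV : IsOpen V) (hVc : IsPreconnected V) (h0 : (0 : ℂ) ∈ V)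
    {f g : ℂ → ℂ} (hf : DifferentiableOn ℂ f V) (hg : DifferentiableOn ℂ g V) {r : ℝ} (hr : 0 < r)
    (hfg : ∀ x : ℝ, x ∈ Ioo 0 r → f x = g x) : EqOn f g V := by
  refine (hf.analyticOnNhd hV).eqOn_of_preconnected_of_frequently_eq (hg.analyticOnNhd hV) hVc h0 ?_
  have ht : Tendsto (fun x : ℝ => (x : ℂ)) (𝓝[>] 0) (𝓝[≠] 0) := by
    refine tendsto_nhdsWithin_iff.2 ⟨?_, ?_⟩
    · have := Complex.continuous_ofReal.tendsto 0
      rw [Complex.ofReal_zero] at this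
      exact this.mono_left nhdsWithin_le_nhds
    · filter_upwards [self_mem_nhdsWithin] with x hx
      exact Complex.ofReal_ne_zero.2 (ne_of_gt hx)
  refine ht.frequently (Eventually.frequently ?_)
  filter_upwards [Ioo_mem_nhdsGT hr] with x hx using hfg x hx

lemma isPreconnected_strip (s : ℝ) : IsPreconnected (strip s) := by
  have : strip s = Complex.imLm ⁻¹' Ioo (-s) s := by
    ext z
    rw [mem_strip, abs_lt]
    rfl
  rw [this]
  exact ((convex_Ioo (-s) s).linear_preimage Complex.imLm).isPreconnected

/-- The identity theorem twice: in $t$ at each real $x$, then in $z$ at each complex $t$. -/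
theorem eqOn_ball_of_eq_real {s δ : ℝ} (hs : 0 < s) (hδ : 0 < δ) {X Y : ℂ → StripSpace s}
    (hX : DifferentiableOn ℂ X (Metric.ball 0 δ)) (hY : DifferentiableOn ℂ Y (Metric.ball 0 δ))
    (h : ∀ x t : ℝ, t ∈ Ico 0 δ → val (X t) x = val (Y t) x) : EqOn X Y (Metric.ball 0 δ) := by
  have hreal : ∀ x : ℝ, EqOn (fun t => val (X t) x) (fun t => val (Y t) x) (Metric.ball 0 δ) :=
    fun x => eqOn_of_eq_ofReal Metric.isOpen_ball (convex_ball _ _).isPreconnected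
      (Metric.mem_ball_self hδ) ((evalL s x).differentiable.comp_differentiableOn hX)
      ((evalL s x).differentiable.comp_differentiableOn hY) hδ
      fun t ht => h x t (Ioo_subset_Ico_self ht)
  intro t ht
  refine val_ext_strip hs (eqOn_of_eq_ofReal (isOpen_strip s) (isPreconnected_strip s)
    (by simpa [mem_strip] using hs) (differentiableOn_val _) (differentiableOn_val _) one_pos
    fun x _ => hreal x ht)

/-- Convergence along every finer ultrafilter is convergence; the uniform bound then upgrades it in
both variables at once. -/
theorem convergesOnCompacts_of_ultrafilter {s δ K : ℝ} {Xε : ℝ → ℂ → StripSpace s}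
    {X : ℂ → StripSpace s}
    (hd : ∀ ε ∈ Ioo (0 : ℝ) 1, DifferentiableOn ℂ (Xε ε) (Metric.ball 0 δ))
    (hK : ∀ ε ∈ Ioo (0 : ℝ) 1, ∀ t ∈ Metric.ball 0 δ, ‖Xε ε t‖ ≤ K)
    (h : ∀ U : Ultrafilter ℝ, (U : Filter ℝ) ≤ 𝓝[>] 0 → ∀ t ∈ Metric.ball 0 δ, ∀ z ∈ strip s,
      Tendsto (fun ε => val (Xε ε t) z) U (𝓝 (val (X t) z))) :
    ConvergesOnCompacts δ Xε X := by
  intro Q hQ hQs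
  have hopen : IsOpen (strip s ×ˢ Metric.ball (0 : ℂ) δ) :=
    (isOpen_strip s).prod Metric.isOpen_ball
  have hev := eventually_mem_Ioo (l := 𝓝[>] 0) le_rfl
  refine (tendstoLocallyUniformlyOn_iff_forall_isCompact hopen).1 ?_ Q hQs hQ
  refine tendstoLocallyUniformlyOn_of_bounded (K := K) hopen ?_ ?_ fun p hp => ?_
  · filter_upwards [hev] with ε hε using differentiableOn_val_joint (hd ε hε)
  · filter_upwards [hev] with ε hε p hp using (norm_val_le _ _).trans (hK ε hε p.2 hp.2)
  · exact (tendsto_iff_ultrafilter _ _ _).2 fun U hU => h U hU p.2 hp.2 p.1 hp.1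

/-! ### The main theorem -/

lemma AnalyticCoefficient.stripCoefficient {r s₀ a M σ η : ℝ} {u : ℝ → ℂ → ℂ → ℂ}
    (h : AnalyticCoefficient r s₀ a M σ η u) (hr : s₀ < r) {ε : ℝ} (hε : ε ∈ Ioo (0 : ℝ) 1) :
    StripCoefficient s₀ a M (u ε) := by
  have hsub := closedStrip_subset_strip hr
  refine ⟨fun t ht => ?_, fun z hz => ?_⟩
  · have hd : DifferentiableOn ℂ (fun z => u ε z t) (strip r) :=
      (h.holo ε hε).comp (f := fun z => (z, t))
        (differentiableOn_id.prodMk (differentiableOn_const t)) fun z hz => ⟨hz, ht⟩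
    exact ⟨hd.continuousOn.mono hsub, hd.mono (strip_mono hr.le),
      fun z hz => h.periodic ε hε z (hsub hz) t ht, fun z hz => h.bounded ε hε z hz t ht⟩
  · exact (h.holo ε hε).comp (f := fun t => (z, t))
      ((differentiableOn_const z).prodMk differentiableOn_id) fun t ht => ⟨hsub hz, ht⟩

lemma AnalyticDatum.isStripFunction {r s₀ B : ℝ} {g : ℝ → ℂ → ℂ} (h : AnalyticDatum r s₀ B g)
    (hr : s₀ < r) {ε : ℝ} (hε : ε ∈ Ioo (0 : ℝ) 1) : IsStripFunction s₀ B (g ε) :=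
  ⟨(h.holo ε hε).continuousOn.mono (closedStrip_subset_strip hr),
    (h.holo ε hε).mono (strip_mono hr.le),
    fun z hz => h.periodic ε hε z (closedStrip_subset_strip hr hz), h.bounded ε hε⟩

/-- Existence with a bound that does not depend on `ε`, on a smaller strip. -/
theorem exists_solvesStripODE_bounded {s s' δ M σ ε F B : ℝ} (hs : 0 < s) (hss : s < s')
    (hδ : 0 < δ) (hM : 0 < M) (hσ : |σ| = 1) (hε : 0 < ε) (hδs : 16 * M * δ ≤ s' - s)
    {u : ℂ → ℂ → ℂ} (hu : StripCoefficient s' δ M u) {f : ℂ → StripSpace s'}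
    (hf : DifferentiableOn ℂ f (Metric.ball 0 δ)) (hF : ∀ t ∈ Metric.ball 0 δ, ‖f t‖ ≤ F)
    {g₀ : ℂ → ℂ} (hg₀ : IsStripFunction s' B g₀) :
    ∃ X : ℂ → StripSpace s, SolvesStripODE σ ε δ u (fun z t => val (f t) z) g₀ X ∧
      ∀ t ∈ Metric.ball 0 δ, ‖X t‖ ≤ 4 * (B + F * δ) := by
  obtain ⟨X, hX, K, hK⟩ := exists_solvesStripODE (hs.trans hss) hδ hσ hε hu hf hF hg₀
  have hB : 0 ≤ B := hg₀.nonneg (hs.trans hss).le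
  have hF0 : 0 ≤ F := (norm_nonneg _).trans (hF 0 (Metric.mem_ball_self hδ))
  refine ⟨fun t => restrictL hss.le (X t), hX.restrict hss.le le_rfl fun _ _ _ _ => rfl,
    fun t ht => ?_⟩
  refine norm_le_of_val_le (by positivity) fun z hz => ?_
  rw [val_restrictL hss.le _ hz]
  -- The width `s' - s` given up exceeds $16M|t|$ on the whole disc, so the bound reaches every
  -- point of the smaller strip.
  refine hX.norm_val_le_of_bound hM hσ hε hu
    (fun t ht z _ => (norm_val_le _ _).trans (hF t ht)) hB hF0 hg₀.bdd hK ht ?_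
    (closedStrip_subset_strip hss hz)
  have h1 : 16 * M * ‖t‖ ≤ 16 * M * δ :=
    mul_le_mul_of_nonneg_left (mem_ball_zero_iff.1 ht).le (by positivity)
  linarith [mem_closedStrip.1 hz]

lemma IsClassicalSolution.congr_source {δ : ℝ} {u : ℝ → ℝ → ℝ} {f f' : ℝ → ℝ → ℂ} {g₀ : ℝ → ℂ}
    {Y : ℝ → ℝ → ℂ} (h : IsClassicalSolution δ u f g₀ Y)
    (hf : ∀ x, ∀ t ∈ Ico 0 δ, f x t = f' x t) : IsClassicalSolution δ u f' g₀ Y :=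
  ⟨h.periodic, h.contDiffOn, h.init, fun x t ht => by rw [← hf x t ht]; exact h.pde x t ht⟩

/-! ### Ultrafilter limits of the coefficients and of the solutions. -/

section Assembly

variable {M s₀ s₁ s₃ s δ σ B α : ℝ} {n : ℕ} {φ : ℝ → ℝ} {uε : ℝ → ℂ → ℂ → ℂ}
  {v₀ε w₀ε : ℝ → ℂ → ℂ} {u : ℝ → ℝ → ℝ} {v₀ w₀ : ℝ → ℂ}

/-- Along an ultrafilter, the coefficients converge to a bounded holomorphic extension of `u`. -/
theorem exists_limit_coefficient (hs : 0 < s) (hss : s < s₀)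
    (hcoef : ∀ ε ∈ Ioo (0 : ℝ) 1, StripCoefficient s₀ δ M (uε ε))
    (hu : ∀ t ∈ Ico 0 δ, ConvergesL1Torus (fun ε x => uε ε x t) (fun x => (u x t : ℂ)))
    (U : Ultrafilter ℝ) (hU : (U : Filter ℝ) ≤ 𝓝[>] 0) :
    ∃ L : ℂ → StripSpace s, (∀ t ∈ Metric.ball 0 δ, ‖L t‖ ≤ M) ∧
      (∀ t ∈ Metric.ball 0 δ, ∀ z ∈ closedStrip s,
        Tendsto (fun ε => uε ε z t) U (𝓝 (val (L t) z))) ∧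
      (∀ x t : ℝ, t ∈ Ico 0 δ → (u x t : ℂ) = val (L t) x) := by
  obtain ⟨L, -, hLM, hLt⟩ := exists_ultrafilter_limit (T := δ) (K := M) U hs hss (G := uε)
    ((eventually_mem_Ioo hU).mono hcoef)
  refine ⟨L, hLM, hLt, fun x t ht => ?_⟩
  have htb : (t : ℂ) ∈ Metric.ball 0 δ := by simpa [abs_of_nonneg ht.1] using ht.2
  exact (eq_of_convergesL1Torus hU hs (hu t ht)
    (fun ε hε => ((hcoef ε hε).space t htb).mono hss.le)
    (fun z hz => hLt t htb z (strip_subset_closedStrip s hz)) x).symm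

/-- Uniqueness of the classical solutions for the limit coefficient. -/
theorem isClassicalSolution_unique (hs : 0 < s) {L : ℂ → StripSpace s}
    (hLM : ∀ t ∈ Metric.ball 0 δ, ‖L t‖ ≤ M)
    (hLu : ∀ x t : ℝ, t ∈ Ico 0 δ → (u x t : ℂ) = val (L t) x) {f : ℝ → ℝ → ℂ} {g₀ : ℝ → ℂ}
    {Y Z : ℝ → ℝ → ℂ} (hY : IsClassicalSolution δ u f g₀ Y)
    (hZ : IsClassicalSolution δ u f g₀ Z) (x : ℝ) {t : ℝ} (ht : t ∈ Ico 0 δ) : Y x t = Z x t := by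
  -- The Lipschitz bound for $u$ is Cauchy's estimate from the strip `s` to the real line, the
  -- closed strip of width `0`.
  refine IsClassicalSolution.eq (K := M / (s - 0))
    (u' := fun x t => (deriv (val (L t)) x).re) (fun t ht x => ?_) (fun t ht x => ?_) hY hZ x ht
  · have h1 := (differentiableAt_val (L t) (ofReal_mem_strip hs x)).hasDerivAt.real_of_complex
    have h2 : (fun ξ : ℝ => (val (L t) ξ).re) = fun ξ => u ξ t := by
      ext ξ
      rw [← hLu ξ t ht, Complex.ofReal_re]
    rwa [h2] at h1
  · have htb : (t : ℂ) ∈ Metric.ball 0 δ := by simpa [abs_of_nonneg ht.1] using ht.2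
    exact (Complex.abs_re_le_norm _).trans (norm_deriv_le_of_strip
      ((isStripFunction_val (L t)).mono_bound (hLM t htb)) hs (ofReal_mem_closedStrip le_rfl x))

/-- Along an ultrafilter, the approximate solutions converge to classical solutions. -/
theorem exists_ultrafilter_solution (hs : 0 < s) (hs1 : s < s₁) (hs3 : s < s₃) (hs1' : s₁ ≤ s₀)
    (hs3' : s₃ ≤ s₀)
    (hδ : 0 < δ) (hσ : σ = 1 ∨ σ = -1) (hα : 0 < α) (hφ : Continuous φ)
    (hφc : HasCompactSupport φ) (hφ1 : ∫ y, φ y = 1)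
    (hcoef : ∀ ε ∈ Ioo (0 : ℝ) 1, StripCoefficient s₀ δ M (uε ε))
    (hv : ∀ ε ∈ Ioo (0 : ℝ) 1, IsStripFunction s₀ B (v₀ε ε))
    (hw : ∀ ε ∈ Ioo (0 : ℝ) 1, IsStripFunction s₀ B (w₀ε ε))
    (hv₀ : ConvergesL1Torus (fun ε x => v₀ε ε x) v₀)
    (hw₀ : ConvergesL1Torus (fun ε x => w₀ε ε x) w₀)
    {Xε : ℝ → ℂ → StripSpace s₃} {Wε : ℝ → ℂ → StripSpace s₁} {K K' : ℝ}
    (hX : ∀ ε ∈ Ioo (0 : ℝ) 1, SolvesStripODE σ ε δ (uε ε) (fun _ _ => 0) (v₀ε ε) (Xε ε))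
    (hXK : ∀ ε ∈ Ioo (0 : ℝ) 1, ∀ t ∈ Metric.ball 0 δ, ‖Xε ε t‖ ≤ K)
    (hW : ∀ ε ∈ Ioo (0 : ℝ) 1, SolvesStripODE σ ε δ (uε ε)
      (fun z t => pressureGradC n φ (ε ^ α) (val (Xε ε t)) z) (w₀ε ε) (Wε ε))
    (hWK : ∀ ε ∈ Ioo (0 : ℝ) 1, ∀ t ∈ Metric.ball 0 δ, ‖Wε ε t‖ ≤ K')
    (U : Ultrafilter ℝ) (hU : (U : Filter ℝ) ≤ 𝓝[>] 0) {L : ℂ → StripSpace s}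
    (hL : ∀ t ∈ Metric.ball 0 δ, ∀ z ∈ closedStrip s,
      Tendsto (fun ε => uε ε z t) U (𝓝 (val (L t) z)))
    (hLu : ∀ x t : ℝ, t ∈ Ico 0 δ → (u x t : ℂ) = val (L t) x) :
    ∃ X W : ℂ → StripSpace s,
      DifferentiableOn ℂ X (Metric.ball 0 δ) ∧ DifferentiableOn ℂ W (Metric.ball 0 δ) ∧
      (∀ t ∈ Metric.ball 0 δ, ∀ z ∈ closedStrip s,
        Tendsto (fun ε => val (Xε ε t) z) U (𝓝 (val (X t) z))) ∧
      (∀ t ∈ Metric.ball 0 δ, ∀ z ∈ closedStrip s,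
        Tendsto (fun ε => val (Wε ε t) z) U (𝓝 (val (W t) z))) ∧
      IsClassicalSolution δ u (fun _ _ => 0) v₀ (fun x t => val (X t) x) ∧
      IsClassicalSolution δ u (fun x t => deriv (fun ξ : ℝ => val (X t) ξ ^ n) x) w₀
        (fun x t => val (W t) x) := by
  have hev := eventually_mem_Ioo hU
  have hball : ∀ t : ℝ, t ∈ Ico 0 δ → (t : ℂ) ∈ Metric.ball 0 δ := fun t ht => by
    simpa [abs_of_nonneg ht.1] using ht.2
  have h0 : (0 : ℂ) ∈ Metric.ball 0 δ := Metric.mem_ball_self hδ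
  obtain ⟨X, hXd, -, hXt⟩ := exists_ultrafilter_limit (T := δ) (K := K) U hs hs3
    (G := fun ε z t => val (Xε ε t) z)
    (hev.mono fun ε hε => stripCoefficient_val (hX ε hε).holo (hXK ε hε))
  obtain ⟨W, hWd, -, hWt⟩ := exists_ultrafilter_limit (T := δ) (K := K') U hs hs1
    (G := fun ε z t => val (Wε ε t) z)
    (hev.mono fun ε hε => stripCoefficient_val (hW ε hε).holo (hWK ε hε))
  have hLs : ∀ t ∈ Metric.ball 0 δ, ∀ z ∈ strip s,
      Tendsto (fun ε => uε ε z t) U (𝓝 (val (L t) z)) := fun t ht z hz =>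
    hL t ht z (strip_subset_closedStrip s hz)
  have hpress : ∀ t ∈ Metric.ball 0 δ, ∀ z ∈ strip s,
      Tendsto (fun ε : ℝ => pressureGradC n φ (ε ^ α) (val (Xε ε t)) z) U
        (𝓝 (deriv (fun w => val (X t) w ^ n) z)) := by
    intro t ht z hz
    refine tendsto_pressureGradC (K := K) n hφ hφc hφ1 hs3 ?_ ?_ ?_
      (fun w hw => hXt t ht w (strip_subset_closedStrip s hw)) hz
    · filter_upwards [hev] with ε hε using Real.rpow_pos_of_pos hε.1 α
    · have h1 : Tendsto (fun ε : ℝ => ε ^ α) (𝓝 0) (𝓝 0) := by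
        have := (Real.continuousAt_rpow_const 0 α (Or.inr hα.le)).tendsto
        rwa [Real.zero_rpow hα.ne'] at this
      exact h1.mono_left (hU.trans nhdsWithin_le_nhds)
    · filter_upwards [hev] with ε hε
      exact (isStripFunction_val _).mono_bound (hXK ε hε t ht)
  refine ⟨X, W, hXd, hWd, hXt, hWt, ?_, ?_⟩
  · refine isClassicalSolution_of_strip hs hXd (U := fun z t => val (L t) z)
      (fun t _ => differentiableOn_val _) hLu (fun x => ?_) fun t ht x => ?_
    · refine eq_of_convergesL1Torus hU hs hv₀ (fun ε hε => (hv ε hε).mono (hs3.le.trans hs3'))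
        (fun z hz => ?_) x
      have hzc := strip_subset_closedStrip s hz
      refine (hXt 0 h0 z hzc).congr' ?_
      filter_upwards [hev] with ε hε using (hX ε hε).init z (closedStrip_mono hs3.le hzc)
    · exact limit_equation hU hs3 hσ hX hXK (fun ε hε => (hcoef ε hε).mono hs3' le_rfl) hXd hXt
        (u₀ := fun z t => val (L t) z) hLs (f₀ := fun _ _ => 0)
        (fun _ _ _ _ => tendsto_const_nhds) (hball t ht) (ofReal_mem_strip hs x)
  · refine isClassicalSolution_of_strip hs hWd (U := fun z t => val (L t) z)
      (fun t _ => differentiableOn_val _) hLu (fun x => ?_) fun t ht x => ?_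
    · refine eq_of_convergesL1Torus hU hs hw₀ (fun ε hε => (hw ε hε).mono (hs1.le.trans hs1'))
        (fun z hz => ?_) x
      have hzc := strip_subset_closedStrip s hz
      refine (hWt 0 h0 z hzc).congr' ?_
      filter_upwards [hev] with ε hε using (hW ε hε).init z (closedStrip_mono hs1.le hzc)
    · have hd : DifferentiableAt ℂ (fun w => val (X t) w ^ n) (x : ℂ) :=
        (differentiableAt_val _ (ofReal_mem_strip hs x)).pow n
      rw [(hasDerivAt_comp_ofReal hd.hasDerivAt).deriv]
      exact limit_equation hU hs1 hσ hW hWK (fun ε hε => (hcoef ε hε).mono hs1' le_rfl) hWd hWt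
        (u₀ := fun z t => val (L t) z) hLs
        (f₀ := fun z t => deriv (fun w => val (X t) w ^ n) z) hpress (hball t ht)
        (ofReal_mem_strip hs x)

end Assembly

end WeakAsymptotic

end

open WeakAsymptotic in
theorem mainTheorem3 (M : ℝ) (hM : 0 < M) :
    ∃ C : ℝ, 0 < C ∧
    ∀ (r s₀ a σ η B α : ℝ) (n : ℕ) (φ : ℝ → ℝ)
      (uε : ℝ → ℂ → ℂ → ℂ) (v₀ε w₀ε : ℝ → ℂ → ℂ)
      (u : ℝ → ℝ → ℝ) (v₀ w₀ : ℝ → ℂ),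
      0 < s₀ → s₀ < r → 0 < a → (σ = 1 ∨ σ = -1) → 0 < η → 0 < α → α ≤ 1 →
      ContDiff ℝ (⊤ : ℕ∞) φ → HasCompactSupport φ → (∫ y, φ y) = 1 →
      AnalyticCoefficient r s₀ a M σ η uε →
      AnalyticDatum r s₀ B v₀ε →
      AnalyticDatum r s₀ B w₀ε →
      (∀ t ∈ Set.Ico 0 a, ConvergesL1Torus (fun ε x => uε ε x t) (fun x => (u x t : ℂ))) →
      ConvergesL1Torus (fun ε x => v₀ε ε x) v₀ →
      ConvergesL1Torus (fun ε x => w₀ε ε x) w₀ →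
      ∀ (s : ℝ) (hs : 0 < s), s < s₀ → ∀ δ : ℝ, δ = min a (C * (s₀ - s)) →
      ∃ (Xε Wε : ℝ → ℂ → StripSpace s) (X W : ℂ → StripSpace s),
        -- existence and uniqueness of the holomorphic solutions, for each `ε`
        (∀ ε ∈ Set.Ioo (0 : ℝ) 1,
          SolvesStripODE σ ε δ (uε ε) (fun _ _ => 0) (v₀ε ε) (Xε ε) ∧
          (∀ Y : ℂ → StripSpace s,
            SolvesStripODE σ ε δ (uε ε) (fun _ _ => 0) (v₀ε ε) Y →
              Set.EqOn Y (Xε ε) (Metric.ball 0 δ)) ∧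
          SolvesStripODE σ ε δ (uε ε)
            (fun z t => pressureGradC n φ (ε ^ α) (val (Xε ε t)) z) (w₀ε ε) (Wε ε) ∧
          (∀ Y : ℂ → StripSpace s,
            SolvesStripODE σ ε δ (uε ε)
              (fun z t => pressureGradC n φ (ε ^ α) (val (Xε ε t)) z) (w₀ε ε) Y →
              Set.EqOn Y (Wε ε) (Metric.ball 0 δ))) ∧
        -- on the real axis they are the unique solutions of the ODEs in `C_b(ℝ)`
        (∀ ε ∈ Set.Ioo (0 : ℝ) 1,
          SolvesUpwindODE ε δ (fun x t => (uε ε x t).re) (fun _ _ => 0) (fun x => v₀ε ε x)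
            (fun t => restrictReal hs (Xε ε t)) ∧
          (∀ Y : ℝ → BoundedContinuousFunction ℝ ℂ,
            SolvesUpwindODE ε δ (fun x t => (uε ε x t).re) (fun _ _ => 0) (fun x => v₀ε ε x) Y →
              ∀ t ∈ Set.Ico 0 δ, Y t = restrictReal hs (Xε ε t)) ∧
          SolvesUpwindODE ε δ (fun x t => (uε ε x t).re)
            (fun x t => pressureGrad n φ (ε ^ α) (restrictReal hs (Xε ε t)) x)
              (fun x => w₀ε ε x)
            (fun t => restrictReal hs (Wε ε t)) ∧
          (∀ Y : ℝ → BoundedContinuousFunction ℝ ℂ,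
            SolvesUpwindODE ε δ (fun x t => (uε ε x t).re)
              (fun x t => pressureGrad n φ (ε ^ α) (restrictReal hs (Xε ε t)) x)
              (fun x => w₀ε ε x) Y →
              ∀ t ∈ Set.Ico 0 δ, Y t = restrictReal hs (Wε ε t))) ∧
        -- bounds uniform in `ε`
        UniformlyBounded δ Xε ∧ UniformlyBounded δ Wε ∧
        -- the classical analytic solution exists for the same time and is the only classical one
        DifferentiableOn ℂ X (Metric.ball 0 δ) ∧ DifferentiableOn ℂ W (Metric.ball 0 δ) ∧
        IsClassicalSolution δ u (fun _ _ => 0) v₀ (fun x t => val (X t) x) ∧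
        (∀ Y : ℝ → ℝ → ℂ, IsClassicalSolution δ u (fun _ _ => 0) v₀ Y →
          ∀ x : ℝ, ∀ t ∈ Set.Ico 0 δ, Y x t = val (X t) x) ∧
        IsClassicalSolution δ u (fun x t => deriv (fun ξ : ℝ => val (X t) ξ ^ n) x) w₀
          (fun x t => val (W t) x) ∧
        (∀ Y : ℝ → ℝ → ℂ,
          IsClassicalSolution δ u (fun x t => deriv (fun ξ : ℝ => val (X t) ξ ^ n) x) w₀ Y →
          ∀ x : ℝ, ∀ t ∈ Set.Ico 0 δ, Y x t = val (W t) x) ∧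
        -- convergence
        ConvergesOnCompacts δ Xε X ∧ ConvergesOnCompacts δ Wε W := by
  -- 64 is 16 times 4: the constant of `SolvesStripODE.norm_val_le_of_bound`, and the four quarters
  -- of $s_0-s$.
  refine ⟨1 / (64 * M), by positivity, ?_⟩
  intro r s₀ a σ η B α n φ uε v₀ε w₀ε u v₀ w₀ hs₀ hr ha hσ hη hα _ hφs hφc hφ1 hu hv hw hul hv₀ hw₀
    s hs hss δ hδ
  -- From $s_0$ down to $s$, the quarters pay for the bound on $X^\epsilon$, the derivative in the
  -- pressure, the bound on $w^\epsilon$ and the passage to the limit.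
  set q := (s₀ - s) / 4 with hq
  have hqpos : 0 < q := by rw [hq]; linarith
  have hδa : δ ≤ a := hδ ▸ min_le_left _ _
  have hδpos : 0 < δ := by
    rw [hδ]
    exact lt_min ha (mul_pos (by positivity) (by linarith))
  have hδq : 16 * M * δ ≤ q := by
    have h1 : δ ≤ 1 / (64 * M) * (s₀ - s) := hδ ▸ min_le_right _ _
    calc 16 * M * δ ≤ 16 * M * (1 / (64 * M) * (s₀ - s)) := by gcongr
      _ = q := by rw [hq]; field_simp; ring
  have hσ1 : |σ| = 1 := by rcases hσ with rfl | rfl <;> simp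
  have hφ : Continuous φ := hφs.continuous
  have hφi : MeasureTheory.Integrable φ := hφ.integrable_of_hasCompactSupport hφc
  have hcoef : ∀ ε ∈ Set.Ioo (0 : ℝ) 1, StripCoefficient s₀ δ M (uε ε) := fun ε hε =>
    (hu.stripCoefficient hr hε).mono le_rfl hδa
  have hvs : ∀ ε ∈ Set.Ioo (0 : ℝ) 1, IsStripFunction s₀ B (v₀ε ε) := fun ε hε =>
    hv.isStripFunction hr hε
  have hws : ∀ ε ∈ Set.Ioo (0 : ℝ) 1, IsStripFunction s₀ B (w₀ε ε) := fun ε hε =>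
    hw.isStripFunction hr hε
  have hs1 : s < s + q := by linarith
  have hs12 : s + q < s + 2 * q := by linarith
  have hs23 : s + 2 * q < s + 3 * q := by linarith
  have hs3 : s < s + 3 * q := by linarith
  have hs30 : s + 3 * q < s₀ := by linarith
  -- the solution `X^ε` on a larger strip
  have hexX : ∀ ε ∈ Set.Ioo (0 : ℝ) 1, ∃ X : ℂ → StripSpace (s + 3 * q),
      SolvesStripODE σ ε δ (uε ε) (fun _ _ => 0) (v₀ε ε) X ∧
        ∀ t ∈ Metric.ball 0 δ, ‖X t‖ ≤ 4 * B := by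
    intro ε hε
    obtain ⟨X, hX, hXb⟩ := exists_solvesStripODE_bounded (f := fun _ => 0) (F := 0)
      (by linarith) hs30 hδpos hM hσ1 hε.1 (by linarith) (hcoef ε hε)
      (differentiableOn_const _) (fun _ _ => norm_zero.le) (hvs ε hε)
    refine ⟨X, ⟨hX.holo, hX.init, fun t ht z hz => ?_⟩,
      by simpa only [zero_mul, add_zero] using hXb⟩
    have hzero : val (0 : StripSpace s₀) z = 0 := (evalL s₀ z).map_zero
    rw [hX.ode t ht z hz, hzero]
  choose! X3 hX3 hX3b using hexX
  -- the solution `w^ε` on a larger strip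
  set F := 1 / (s + 3 * q - (s + 2 * q)) * ((∫ y, ‖φ y‖) * (4 * B)) ^ n with hF
  have hexW : ∀ ε ∈ Set.Ioo (0 : ℝ) 1, ∃ W : ℂ → StripSpace (s + q),
      SolvesStripODE σ ε δ (uε ε) (fun z t => pressureGradC n φ (ε ^ α) (val (X3 ε t)) z)
        (w₀ε ε) W ∧ ∀ t ∈ Metric.ball 0 δ, ‖W t‖ ≤ 4 * (B + F * δ) := by
    intro ε hε
    have hh := Real.rpow_pos_of_pos hε.1 α
    obtain ⟨W, hW, hWb⟩ := exists_solvesStripODE_bounded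
      (f := fun t => pressure hs23 n hφ hφi hh (X3 ε t)) (F := F)
      (by linarith) hs12 hδpos hM hσ1 hε.1 (by linarith)
      ((hcoef ε hε).mono (by linarith) le_rfl)
      (differentiableOn_pressure hs23 n hφ hφi hh (hX3 ε hε).holo (hX3b ε hε))
      (fun t ht => norm_pressure_le hs23 n hφ hφi hh _ (hX3b ε hε t ht))
      ((hws ε hε).mono (by linarith))
    refine ⟨W, ⟨hW.holo, hW.init, fun t ht z hz => ?_⟩, hWb⟩
    rw [hW.ode t ht z hz, val_pressure hs23 n hφ hφi hh _
      (closedStrip_mono hs12.le (strip_subset_closedStrip _ hz))]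
  choose! W1 hW1 hW1b using hexW
  -- The wider versions `X3` and `W1` are kept as well, because the ultrafilter limits need room
  -- beyond the strip `s`.
  set Xε : ℝ → ℂ → StripSpace s := fun ε t => restrictL hs3.le (X3 ε t) with hXε
  set Wε : ℝ → ℂ → StripSpace s := fun ε t => restrictL hs1.le (W1 ε t) with hWε
  have hXsol : ∀ ε ∈ Set.Ioo (0 : ℝ) 1,
      SolvesStripODE σ ε δ (uε ε) (fun _ _ => 0) (v₀ε ε) (Xε ε) := fun ε hε =>
    (hX3 ε hε).restrict hs3.le le_rfl fun _ _ _ _ => rfl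
  have hWsol : ∀ ε ∈ Set.Ioo (0 : ℝ) 1, SolvesStripODE σ ε δ (uε ε)
      (fun z t => pressureGradC n φ (ε ^ α) (val (Xε ε t)) z) (w₀ε ε) (Wε ε) := fun ε hε =>
    (hW1 ε hε).restrict hs1.le le_rfl fun t _ z hz =>
      pressureGradC_congr (fun w hw => (val_restrictL hs3.le _ hw).symm) hz
  have hXb : ∀ ε ∈ Set.Ioo (0 : ℝ) 1, ∀ t ∈ Metric.ball 0 δ, ‖Xε ε t‖ ≤ 4 * B := fun ε hε t ht =>
    (norm_restrictL_le hs3.le _).trans (hX3b ε hε t ht)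
  have hWb : ∀ ε ∈ Set.Ioo (0 : ℝ) 1, ∀ t ∈ Metric.ball 0 δ, ‖Wε ε t‖ ≤ 4 * (B + F * δ) :=
    fun ε hε t ht => (norm_restrictL_le hs1.le _).trans (hW1b ε hε t ht)
  have hunorm : ∀ ε ∈ Set.Ioo (0 : ℝ) 1, ∀ z ∈ strip s, ∀ t ∈ Metric.ball (0 : ℂ) δ,
      ‖uε ε z t‖ ≤ M := fun ε hε z hz t ht =>
    ((hcoef ε hε).space t ht).bdd z (closedStrip_mono hss.le (strip_subset_closedStrip s hz))
  have hureal : ∀ ε ∈ Set.Ioo (0 : ℝ) 1, ∀ x t : ℝ, |t| < δ → (uε ε x t).im = 0 :=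
    fun ε hε x t ht => hu.real ε hε x t (ht.trans_le hδa)
  have husign : ∀ ε ∈ Set.Ioo (0 : ℝ) 1, ∀ x t : ℝ, |t| < δ → 0 ≤ σ * (uε ε x t).re :=
    fun ε hε x t ht => hη.le.trans (hu.sign ε hε x t (ht.trans_le hδa))
  have hball : ∀ t : ℝ, t ∈ Set.Ico 0 δ → (t : ℂ) ∈ Metric.ball 0 δ := fun t ht => by
    simpa [abs_of_nonneg ht.1] using ht.2
  have hubound : ∀ ε ∈ Set.Ioo (0 : ℝ) 1, ∀ x : ℝ, ∀ t ∈ Set.Ico 0 δ, |(uε ε x t).re| ≤ M :=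
    fun ε hε x t ht => (Complex.abs_re_le_norm _).trans
      (hunorm ε hε x (ofReal_mem_strip hs x) t (hball t ht))
  have hXup : ∀ ε ∈ Set.Ioo (0 : ℝ) 1, SolvesUpwindODE ε δ (fun x t => (uε ε x t).re)
      (fun _ _ => 0) (fun x => v₀ε ε x) (fun t => restrictReal hs (Xε ε t)) := fun ε hε =>
    (hXsol ε hε).solvesUpwindODE hs hσ (hureal ε hε) (husign ε hε) fun _ _ _ => rfl
  have hWup : ∀ ε ∈ Set.Ioo (0 : ℝ) 1, SolvesUpwindODE ε δ (fun x t => (uε ε x t).re)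
      (fun x t => pressureGrad n φ (ε ^ α) (restrictReal hs (Xε ε t)) x) (fun x => w₀ε ε x)
      (fun t => restrictReal hs (Wε ε t)) := fun ε hε =>
    (hWsol ε hε).solvesUpwindODE hs hσ (hureal ε hε) (husign ε hε) fun x t _ =>
      pressureGrad_restrictReal hs n hφ hφi (Real.rpow_pos_of_pos hε.1 α) _ x
  -- the limits
  have hulδ : ∀ t ∈ Set.Ico 0 δ,
      ConvergesL1Torus (fun ε x => uε ε x t) (fun x => (u x t : ℂ)) := fun t ht =>
    hul t ⟨ht.1, ht.2.trans_le hδa⟩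
  have hlim := fun (U : Ultrafilter ℝ) (hU : (U : Filter ℝ) ≤ nhdsWithin 0 (Set.Ioi 0)) =>
    exists_limit_coefficient hs hss hcoef hulδ U hU
  have hsol := fun (U : Ultrafilter ℝ) (hU : (U : Filter ℝ) ≤ nhdsWithin 0 (Set.Ioi 0))
      (L : ℂ → StripSpace s) hL hLu =>
    exists_ultrafilter_solution (L := L) (u := u) hs hs1 hs3 (by linarith) hs30.le hδpos hσ hα hφ
      hφc hφ1 hcoef hvs hws hv₀ hw₀ hX3 hX3b hW1 hW1b U hU hL hLu
  -- One ultrafilter, chosen arbitrarily, defines `X` and `W`; every other one is then compared with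
  -- it.
  obtain ⟨L, hLM, hLt, hLu⟩ := hlim (Ultrafilter.of _) (Ultrafilter.of_le _)
  obtain ⟨X, W, hXd, hWd, -, -, hXc, hWc⟩ := hsol _ (Ultrafilter.of_le _) L hLt hLu
  have huniq : ∀ {f : ℝ → ℝ → ℂ} {g₀ : ℝ → ℂ} {Y Z : ℝ → ℝ → ℂ},
      IsClassicalSolution δ u f g₀ Y → IsClassicalSolution δ u f g₀ Z → ∀ x : ℝ,
      ∀ t ∈ Set.Ico 0 δ, Y x t = Z x t := fun hY hZ x t ht =>
    isClassicalSolution_unique hs hLM hLu hY hZ x ht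
  have hconv : ∀ U : Ultrafilter ℝ, (U : Filter ℝ) ≤ nhdsWithin 0 (Set.Ioi 0) →
      ∀ t ∈ Metric.ball 0 δ, ∀ z ∈ strip s,
        Filter.Tendsto (fun ε => val (Xε ε t) z) U (nhds (val (X t) z)) ∧
        Filter.Tendsto (fun ε => val (Wε ε t) z) U (nhds (val (W t) z)) := by
    intro U hU t ht z hz
    have hzc := strip_subset_closedStrip s hz
    obtain ⟨L', -, hLt', hLu'⟩ := hlim U hU
    obtain ⟨X', W', hXd', hWd', hXt', hWt', hXc', hWc'⟩ := hsol U hU L' hLt' hLu'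
    have hXX : Set.EqOn X' X (Metric.ball 0 δ) :=
      eqOn_ball_of_eq_real hs hδpos hXd' hXd fun x t ht => huniq hXc' hXc x t ht
    -- The source of the equation for `W'` involves `X'`; it must be rewritten with `X` before
    -- uniqueness can compare `W'` with `W`.
    have hWc'' := hWc'.congr_source
      (f' := fun x t => deriv (fun ξ : ℝ => val (X t) ξ ^ n) x)
      fun x t ht => by rw [hXX (hball t ht)]
    have hWW : Set.EqOn W' W (Metric.ball 0 δ) :=
      eqOn_ball_of_eq_real hs hδpos hWd' hWd fun x t ht => huniq hWc'' hWc x t ht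
    refine ⟨?_, ?_⟩
    · rw [← hXX ht]
      exact (hXt' t ht z hzc).congr fun ε => (val_restrictL hs3.le _ hzc).symm
    · rw [← hWW ht]
      exact (hWt' t ht z hzc).congr fun ε => (val_restrictL hs1.le _ hzc).symm
  refine ⟨Xε, Wε, X, W, fun ε hε => ⟨hXsol ε hε, fun Y hY => ?_, hWsol ε hε, fun Y hY => ?_⟩,
    fun ε hε => ⟨hXup ε hε, fun Y hY t ht => ?_, hWup ε hε, fun Y hY t ht => ?_⟩,
    fun ρ hρ => ⟨4 * B, fun ε hε t ht => ?_⟩, fun ρ hρ => ⟨4 * (B + F * δ), fun ε hε t ht => ?_⟩,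
    hXd, hWd, hXc, fun Y hY => huniq hY hXc, hWc, fun Y hY => huniq hY hWc, ?_, ?_⟩
  · exact hY.eqOn hs hσ1 hε.1 (hunorm ε hε) (hXsol ε hε)
  · exact hY.eqOn hs hσ1 hε.1 (hunorm ε hε) (hWsol ε hε)
  · exact hY.eq hε.1 (hubound ε hε) (hXup ε hε) ht
  · exact hY.eq hε.1 (hubound ε hε) (hWup ε hε) ht
  · exact hXb ε hε t (mem_ball_zero_iff.2 (ht.trans_lt hρ))
  · exact hWb ε hε t (mem_ball_zero_iff.2 (ht.trans_lt hρ))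
  · exact convergesOnCompacts_of_ultrafilter (fun ε hε => (hXsol ε hε).holo) hXb
      fun U hU t ht z hz => (hconv U hU t ht z hz).1
  · exact convergesOnCompacts_of_ultrafilter (fun ε hε => (hWsol ε hε).holo) hWb
      fun U hU t ht z hz => (hconv U hU t ht z hz).2
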